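/- **Tail covariance of the generalized skew-Laplace distribution.** *Notation.* For $g:[0,\infty)\to\mathbb R$ put $\overline G(u)=\int_u^\infty g(v)\,dv$, $\overline{\mathcal G}(u)=\int_u^\infty\overline G(v)\,dv$. For a generator $g$ and $m\ge 1$ let $c_m(g)=\frac{\Gamma(m/2)}{(2\pi)^{m/2}}\big[\int_0^\infty s^{m/2-1}g(s)\,ds\big]^{-1}$, and $c_0(g)=1/g(0)$ ($\mathbb R^0$ is a point of mass one). $E_m(\mu,\Sigma,g)$ is the law with density $\frac{c_m(g)}{\sqrt{|\Sigma|}}\,g\big(\tfrac12(x-\mu)^T\Sigma^{-1}(x-\mu)\big)$. For $H:\mathbb R\to[0,1]$ with $H(-s)=1-H(s)$ and $\gamma\in\mathbb R^m$, $GSE_m(\mu,\Sigma,\gamma,g,H)$ is the law with density $\frac{2c_m(g)}{\sqrt{|\Sigma|}}\,g\big(\tfrac12(y-\mu)^T\Sigma^{-1}(y-\mu)\big)\,H\big(\gamma^T\Sigma^{-1/2}(y-\mu)\big)$. Inequalities between vectors are componentwise; for a density $f$ write $\overline E^{t}_f[h]=\int_{\{x>t\}}h(x)f(x)\,dx$ and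 $\overline F_f(t)=\int_{\{x>t\}}f(x)\,dx$. For a random vector $X$, $MTCE_X(t)=E[X\mid X>t]$ and $MTCov_X(t)=E[(X-MTCE_X(t))(X-MTCE_X(t))^T\mid X>t]$; $VaR_q(X)$ is the vector of the marginal quantiles $\inf\{x: F_{X_k}(x)\ge q_k\}$. Let $g(u)=e^{-\sqrt{2u}}$, $n\ge1$, $\mu,\gamma\in\mathbb R^n$, $\Sigma$ positive definite, $q\in(0,1)^n$, and let $Y$ be a random vector in $\mathbb R^n$, $Z=\Sigma^{-1/2}(Y-\mu)$, $\lambda=\Sigma^{-1/2}(VaR_q(Y)-\mu)$. A subscript $-k$ (or $-ij$) means that the $k$-th (or $i$-th and $j$-th) entry is removed. Let $W_{-k}$, $V_{-k}$, $U_{-ij}$ ($i\ne j$) have the densities $c^*_{n-1,k}\overline G(\tfrac12w^Tw+\tfrac12\lambda_k^2)$ and $c^{**}_{n-1,k}\overline{\mathcal G}(\tfrac12v^Tv+\tfrac12\lambda_k^2)$ on $\mathbb R^{n-1}$ and $c^{**}_{n-2,ij}\overline{\mathcal G}(\tfrac12u^Tu+\tfrac12\lambda_i^2+\tfrac12\lambda_j^2)$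 on $\mathbb R^{n-2}$, where the constants are $c_{n-1}$, $c_{n-1}$, $c_{n-2}$ of the respective shifted generators. Let $\xi_k$ (filled with $W_{-k}$), $\eta_k$ (filled with $V_{-k}$) be the vectors with $k$-th entry $\lambda_k$, and $\tau_{ij}$ (filled with $U_{-ij}$) the one with $i$-th and $j$-th entries $\lambda_i,\lambda_j$. Write $c_n=c_n(g)$, $c_n^*=c_n(\overline G)$, $c_n^{**}=c_n(\overline{\mathcal G})$, $X^{**}\sim E_n(0,I,\overline{\mathcal G})$, $M\sim E_n(0,I,g)$. **(1)** For $t\ge0$: $\overline G(t)=(1+\sqrt{2t})e^{-\sqrt{2t}}$ and $\overline{\mathcal G}(t)=(3+2t+3\sqrt{2t})e^{-\sqrt{2t}}$; moreover $$c_n=\frac{\Gamma(n/2)}{2\pi^{n/2}\Gamma(n)},\quad c_n^*=\frac{n\Gamma(n/2)}{2\pi^{n/2}\Gamma(n+2)},\quad c_n^{**}=\frac{n(n+2)\Gamma(n/2)}{2\pi^{n/2}\Gamma(n+4)}.$$ **(2)** Put $\beta(x)=(1+\sqrt x)e^{-\sqrt x}$, $\kappa(x)=(3+x+3\sqrt x)e^{-\sqrt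 x}$. The densities are $f_{W_{-k}}(w)=c^*_{n-1,k}\,\beta(w^Tw+\lambda_k^2)$, $f_{V_{-k}}(v)=c^{**}_{n-1,k}\,\kappa(v^Tv+\lambda_k^2)$, $f_{U_{-ij}}(u)=c^{**}_{n-2,ij}\,\kappa(u^Tu+\lambda_i^2+\lambda_j^2)$; these, and the densities of $X^{**}$ and $M$, have integral $1$. For $n\ge2$ let $I_k=\int_0^\infty t^{\frac{n-3}2}\beta(2t+\lambda_k^2)\,dt$, $J_k=\int_0^\infty t^{\frac{n-3}2}\kappa(2t+\lambda_k^2)\,dt$; then $$c^*_{n-1,k}=\frac{\Gamma(\frac{n-1}2)}{(2\pi)^{(n-1)/2}I_k},\quad c^{**}_{n-1,k}=\frac{\Gamma(\frac{n-1}2)}{(2\pi)^{(n-1)/2}J_k},\quad \frac{c_n}{c^*_{n-1,k}}=\frac{\Gamma(\frac n2)2^{(n-3)/2}}{\Gamma(n)\Gamma(\frac{n-1}2)\sqrt\pi}I_k,\quad \frac{c_n}{c^{**}_{n-1,k}}=\frac{\Gamma(\frac n2)2^{(n-3)/2}}{\Gamma(n)\Gamma(\frac{n-1}2)\sqrt\pi}J_k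 .$$ For $n\ge3$, $i\ne j$ let $K_{ij}=\int_0^\infty t^{\frac{n-4}2}\kappa(2t+\lambda_i^2+\lambda_j^2)\,dt$; then $$c^{**}_{n-2,ij}=\frac{\Gamma(\frac{n-2}2)}{(2\pi)^{(n-2)/2}K_{ij}},\qquad \frac{c_n}{c^{**}_{n-2,ij}}=\frac{(n-2)\,2^{(n-6)/2}}{\Gamma(n)\,\pi}K_{ij}.$$ **(3)** Let $H$ be measurable with values in $[0,1]$ and $H(-s)=1-H(s)$, and let $Y\sim GSE_n(\mu,\Sigma,\gamma,g,H)$. Then $Z\sim GSE_n(0,I,\gamma,g,H)$, all second moments of $Y$ and $Z$ are finite, and with $\Omega:=MTCov_Z(\lambda)$ the conditional covariance matrix of $Y$ given $\{Z>\lambda\}$ is $\Sigma^{1/2}\Omega\Sigma^{1/2}$. If $\Sigma$ is diagonal, then $MTCov_Y(VaR_q(Y))=\Sigma^{1/2}\Omega\Sigma^{1/2}$. **(4)** Suppose in addition that $H$ is differentiable, that $H'$ is absolutely continuous on bounded intervals, that $P(Z>\lambda)>0$, and that the tail expectations of $H'$ and $H''$ below exist (as absolutely convergent integrals). Let $f_Z$,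 $f_{Z^*}$ be the densities of $GSE_n(0,I,\gamma,g,H)$, $GSE_n(0,I,\gamma,\overline G,H)$ and write $\overline F_Z,\overline F_{Z^*}$ for their tail functions at $\lambda$, and $m=MTCE_Z(\lambda)$. Then for $i\neq j$ $$\Omega_{ij}=\frac2{\overline F_Z}\Big\{\tfrac{c_n}{c^{**}_{n-2,ij}}\overline E^{\lambda_{-ij}}_{U_{-ij}}[H(\gamma^T\tau_{ij})]+\tfrac{c_n}{c^{**}_{n-1,i}}\gamma_j\overline E^{\lambda_{-i}}_{V_{-i}}[H'(\gamma^T\eta_i)]+\tfrac{c_n}{c^{**}_{n-1,j}}\gamma_i\overline E^{\lambda_{-j}}_{V_{-j}}[H'(\gamma^T\eta_j)]+(n+3)(n+1)\gamma_i\gamma_j\overline E^{\lambda}_{X^{**}}[H''(\gamma^TX^{**})]\Big\}-m_im_j,$$ $$\Omega_{ii}=\frac2{\overline F_Z}\Big\{\tfrac{c_n}{c^{*}_{n-1,i}}\lambda_i\overline E^{\lambda_{-i}}_{W_{-i}}[H(\gamma^T\xi_i)]+\tfrac{c_n}{c^{**}_{n-1,i}}\gamma_i\overline E^{\lambda_{-i}}_{V_{-i}}[H'(\gamma^T\eta_i)]+(n+3)(n+1)\gamma_i^2\overline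 E^{\lambda}_{X^{**}}[H''(\gamma^TX^{**})]\Big\}+(n+1)\frac{\overline F_{Z^*}}{\overline F_Z}-m_i^2,$$ $$m_k=\frac2{\overline F_Z}\Big\{\tfrac{c_n}{c^*_{n-1,k}}\overline E^{\lambda_{-k}}_{W_{-k}}[H(\gamma^T\xi_k)]+\gamma_k\overline E^\lambda_M\big[(1+\sqrt{M^TM})H'(\gamma^TM)\big]\Big\}.$$ **(5)** (Skew-Laplace.) Let $la(s)=\frac12e^{-|s|}$ and $La(s)=\int_{-\infty}^s la$. If $Y\sim GSE_n(\mu,\Sigma,\gamma,g,La)$, then $P(Z>\lambda)>0$ and the three formulas of (4) hold with $H=La$, $H'=la$ and $H''(\gamma^TX^{**})$ replaced by $-\frac{\gamma^TX^{**}}{|\gamma^TX^{**}|}\,la(\gamma^TX^{**})$. **(6)** (Symmetric Laplace, $H=\frac12$.) If $Y\sim E_n(\mu,\Sigma,g)$, then $Z\sim E_n(0,I,g)$, $P(Z>\lambda)>0$, and, with $Z^*\sim E_n(0,I,\overline G)$ and all tail functions of $Z,Z^*$ at $\lambda$, $$\Omega_{ij}=\frac1{\overline F_Z}\frac{c_n}{c^{**}_{n-2,ij}}\overline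 F_{U_{-ij}}(\lambda_{-ij})-m_im_j\ (i\ne j),\qquad \Omega_{ii}=\frac1{\overline F_Z}\frac{c_n}{c^*_{n-1,i}}\lambda_i\overline F_{W_{-i}}(\lambda_{-i})+(n+1)\frac{\overline F_{Z^*}}{\overline F_Z}-m_i^2,$$ $$m_k=\frac1{\overline F_Z}\frac{c_n}{c^*_{n-1,k}}\overline F_{W_{-k}}(\lambda_{-k}).$$ -/

import Mathlib

open MeasureTheory ProbabilityTheory Set Real Matrix
open scoped MatrixOrder

noncomputable section

namespace SkewLaplace

/-! ### Density generators and their normalizing constants -/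

/-- The cumulative generator `u ↦ ∫_u^∞ g(v) dv` of a generator `g`. The second cumulative
generator is `cumGen (cumGen g)`. -/
def cumGen (g : ℝ → ℝ) (u : ℝ) : ℝ := ∫ v in Ioi u, g v

/-- The normalizing constant of a generator `g` in dimension `m`,
`Γ(m/2) / (2π)^(m/2) * (∫_0^∞ s^(m/2-1) g(s) ds)⁻¹` for `m ≥ 1`. In dimension `0` the space is one
point of mass one, and the constant that makes `c * g(0)` have total mass one is `1 / g(0)`. -/
def normConst (m : ℕ) (g : ℝ → ℝ) : ℝ :=
  if m = 0 then (g 0)⁻¹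
  else Real.Gamma ((m : ℝ) / 2) / (2 * π) ^ ((m : ℝ) / 2)
    * (∫ s in Ioi (0 : ℝ), s ^ ((m : ℝ) / 2 - 1) * g s)⁻¹

section Densities

variable {ι : Type*} [Fintype ι]

/-- Density of the spherical distribution `E_m(0, I_m, g)`, where `m` is the size of `ι`. -/
def sphDensity (g : ℝ → ℝ) (x : ι → ℝ) : ℝ :=
  normConst (Fintype.card ι) g * g ((1 / 2) * (x ⬝ᵥ x))

/-- Density of the elliptical distribution `E_m(μ, Σ, g)`. -/
def ellDensity [DecidableEq ι] (μ : ι → ℝ) (Sg : Matrix ι ι ℝ) (g : ℝ → ℝ) (x : ι → ℝ) : ℝ :=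
  normConst (Fintype.card ι) g / √(Sg.det) * g ((1 / 2) * ((x - μ) ⬝ᵥ (Sg⁻¹ *ᵥ (x - μ))))

/-- The map `y ↦ Σ^(-1/2) (y - μ)`, with the positive definite square root of `Σ`. -/
def standardize [DecidableEq ι] (μ : ι → ℝ) (Sg : Matrix ι ι ℝ) (y : ι → ℝ) : ι → ℝ :=
  (CFC.sqrt Sg)⁻¹ *ᵥ (y - μ)

/-- Density of the generalized skew-elliptical distribution `GSE_m(μ, Σ, g, H)` with skewing
function `H : ℝ^m → ℝ`. -/
def gseDensity [DecidableEq ι] (μ : ι → ℝ) (Sg : Matrix ι ι ℝ) (g : ℝ → ℝ) (H : (ι → ℝ) → ℝ)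
    (y : ι → ℝ) : ℝ :=
  2 * ellDensity μ Sg g y * H (standardize μ Sg y)

/-- The measure on `ℝ^m` with Lebesgue density `f`. -/
def lawOf (f : (ι → ℝ) → ℝ) : Measure (ι → ℝ) :=
  volume.withDensity fun x => ENNReal.ofReal (f x)

/-- The region `{x | x > t}` (componentwise strict inequality). -/
def tailSet (t : ι → ℝ) : Set (ι → ℝ) := {x | ∀ k, t k < x k}

/-- Tail expectation `∫_t^∞ h(x) f(x) dx` of `h` under the density `f`. -/
def tailExp (f : (ι → ℝ) → ℝ) (t : ι → ℝ) (h : (ι → ℝ) → ℝ) : ℝ :=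
  ∫ x in tailSet t, h x * f x

/-- The integrand of `tailExp f t h` is integrable: the tail expectation exists. -/
def HasTailExp (f : (ι → ℝ) → ℝ) (t : ι → ℝ) (h : (ι → ℝ) → ℝ) : Prop :=
  IntegrableOn (fun x => h x * f x) (tailSet t)

/-- Tail function `∫_t^∞ f(x) dx` of the density `f`. -/
def tailFn (f : (ι → ℝ) → ℝ) (t : ι → ℝ) : ℝ := ∫ x in tailSet t, f x

end Densities

/-! ### Value at risk, multivariate tail conditional expectation and tail covariance -/

section Risk

variable {Ω : Type*} [MeasurableSpace Ω]

/-- The `q`-th quantile `inf {x | F_X(x) ≥ q}`. -/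
def valueAtRisk (P : Measure Ω) (q : ℝ) (X : Ω → ℝ) : ℝ :=
  sInf {x : ℝ | q ≤ P.real {ω | X ω ≤ x}}

/-- The vector of marginal quantiles. -/
def vectorVaR {ι : Type*} (P : Measure Ω) (q : ι → ℝ) (X : Ω → ι → ℝ) : ι → ℝ :=
  fun k => valueAtRisk P (q k) fun ω => X ω k

/-- The event `{X > t}`. -/
def exceed {ι : Type*} (X : Ω → ι → ℝ) (t : ι → ℝ) : Set Ω := {ω | ∀ k, t k < X ω k}

/-- `E[X | A]`. -/
def condMean {ι : Type*} (P : Measure Ω) (A : Set Ω) (X : Ω → ι → ℝ) : ι → ℝ :=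
  fun k => ∫ ω, X ω k ∂(ProbabilityTheory.cond P A)

/-- `E[(X - E[X | A]) (X - E[X | A])ᵀ | A]`. -/
def condCov {ι : Type*} (P : Measure Ω) (A : Set Ω) (X : Ω → ι → ℝ) : Matrix ι ι ℝ :=
  Matrix.of fun i j =>
    ∫ ω, (X ω i - condMean P A X i) * (X ω j - condMean P A X j) ∂(ProbabilityTheory.cond P A)

/-- Multivariate tail conditional expectation `E[X | X > t]`. -/
def MTCE {ι : Type*} (P : Measure Ω) (X : Ω → ι → ℝ) (t : ι → ℝ) : ι → ℝ :=
  condMean P (exceed X t) X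

/-- Multivariate tail covariance at the threshold `t`. -/
def MTCov {ι : Type*} (P : Measure Ω) (X : Ω → ι → ℝ) (t : ι → ℝ) : Matrix ι ι ℝ :=
  condCov P (exceed X t) X

end Risk

/-! ### The lower dimensional elliptical vectors `W_{-k}`, `V_{-k}`, `U_{-ij}` -/

section Reduced

variable {n : ℕ}

/-- `λ_{-k}`: the vector `λ` with the `k`-th entry removed. -/
def drop (lam : Fin n → ℝ) (k : Fin n) : {l : Fin n // l ≠ k} → ℝ := fun l => lam l

/-- `λ_{-ij}`: the vector `λ` with the `i`-th and `j`-th entries removed. -/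
def drop₂ (lam : Fin n → ℝ) (i j : Fin n) : {l : Fin n // l ≠ i ∧ l ≠ j} → ℝ := fun l => lam l

/-- The vector with `k`-th entry `λ_k` and other entries from `w`. -/
def put (lam : Fin n → ℝ) (k : Fin n) (w : {l : Fin n // l ≠ k} → ℝ) : Fin n → ℝ :=
  fun l => if h : l ≠ k then w ⟨l, h⟩ else lam l

/-- The vector with `i`-th and `j`-th entries `λ_i`, `λ_j` and other entries from `u`. -/
def put₂ (lam : Fin n → ℝ) (i j : Fin n) (u : {l : Fin n // l ≠ i ∧ l ≠ j} → ℝ) : Fin n → ℝ :=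
  fun l => if h : l ≠ i ∧ l ≠ j then u ⟨l, h⟩ else lam l

/-- Generator of `W_{-k}`: the first cumulative generator shifted by `λ_k² / 2`. -/
def genW (g : ℝ → ℝ) (lam : Fin n → ℝ) (k : Fin n) (u : ℝ) : ℝ :=
  cumGen g (u + (1 / 2) * lam k ^ 2)

/-- Generator of `V_{-k}`: the second cumulative generator shifted by `λ_k² / 2`. -/
def genV (g : ℝ → ℝ) (lam : Fin n → ℝ) (k : Fin n) (u : ℝ) : ℝ :=
  cumGen (cumGen g) (u + (1 / 2) * lam k ^ 2)

/-- Generator of `U_{-ij}`: the second cumulative generator shifted by `λ_i² / 2 + λ_j² / 2`. -/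
def genU (g : ℝ → ℝ) (lam : Fin n → ℝ) (i j : Fin n) (u : ℝ) : ℝ :=
  cumGen (cumGen g) (u + (1 / 2) * lam i ^ 2 + (1 / 2) * lam j ^ 2)

/-- `c*_{n-1,k}`. -/
def constW (g : ℝ → ℝ) (lam : Fin n → ℝ) (k : Fin n) : ℝ := normConst (n - 1) (genW g lam k)

/-- `c**_{n-1,k}`. -/
def constV (g : ℝ → ℝ) (lam : Fin n → ℝ) (k : Fin n) : ℝ := normConst (n - 1) (genV g lam k)

/-- `c**_{n-2,ij}` (used for `i ≠ j`). -/
def constU (g : ℝ → ℝ) (lam : Fin n → ℝ) (i j : Fin n) : ℝ := normConst (n - 2) (genU g lam i j)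

/-- Density of `W_{-k}`. -/
def densW (g : ℝ → ℝ) (lam : Fin n → ℝ) (k : Fin n) (w : {l : Fin n // l ≠ k} → ℝ) : ℝ :=
  constW g lam k * genW g lam k ((1 / 2) * (w ⬝ᵥ w))

/-- Density of `V_{-k}`. -/
def densV (g : ℝ → ℝ) (lam : Fin n → ℝ) (k : Fin n) (v : {l : Fin n // l ≠ k} → ℝ) : ℝ :=
  constV g lam k * genV g lam k ((1 / 2) * (v ⬝ᵥ v))

/-- Density of `U_{-ij}` (used for `i ≠ j`). -/
def densU (g : ℝ → ℝ) (lam : Fin n → ℝ) (i j : Fin n)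
    (u : {l : Fin n // l ≠ i ∧ l ≠ j} → ℝ) : ℝ :=
  constU g lam i j * genU g lam i j ((1 / 2) * (u ⬝ᵥ u))

end Reduced

/-! ### The Laplace generator and the univariate Laplace distribution -/

/-- The generator `g(u) = exp(-√(2u))`. -/
def lapGen (u : ℝ) : ℝ := Real.exp (-√(2 * u))

/-- Density of the standard Laplace distribution on `ℝ`. -/
def lapPdf (x : ℝ) : ℝ := Real.exp (-|x|) / 2

/-- Distribution function of the standard Laplace distribution on `ℝ`. -/
def lapCdf (x : ℝ) : ℝ := ∫ t in Iic x, lapPdf t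

/-- `H : ℝ → ℝ` takes values in `[0, 1]` and satisfies `H(-x) = 1 - H(x)`. -/
def IsSkewing (H : ℝ → ℝ) : Prop :=
  (∀ x, 0 ≤ H x ∧ H x ≤ 1) ∧ ∀ x, H (-x) = 1 - H x

/-- The law `GSLa_n(μ, Σ, γ, H)`: the generalized skew-elliptical law with the Laplace generator
and skewing function `z ↦ H(γᵀ z)`. -/
def gsLaplaceLaw {n : ℕ} (μ : Fin n → ℝ) (Sg : Matrix (Fin n) (Fin n) ℝ) (γ : Fin n → ℝ)
    (H : ℝ → ℝ) : Measure (Fin n → ℝ) :=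
  lawOf (gseDensity μ Sg lapGen fun z => H (γ ⬝ᵥ z))

end SkewLaplace

end

open SkewLaplace

noncomputable section

namespace SkewLaplace

open Filter Topology

/-! ### The cumulative generators of the Laplace generator -/

/-! Everything rests on one identity. If `G = cumGen g`, then `G' = -g`, so the derivative of
`G(½|x|²)` in the coordinate `x_k` is `-x_k g(½|x|²)`. A factor `x_k` in a tail moment is therefore
removed by integrating by parts in `x_k` over the orthant: the face `x_k = λ_k` contributes a tail
integral in one dimension less, and the interior contributes the derivative of the remaining
factors, with `g` replaced by `G`.

For the first moment one such step gives the `W` term, with `H` on the face, and the `M` term, with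
`H'` inside; the weight `1 + √(MᵀM)` is the ratio `G/g` at `½|M|²`. For `x_i x_j` a step in `x_i`
gives a face integral of `x_j G H`, the term `δ_ij ∫ G H` (the `Z*` term), and `γ_i ∫ x_j G H'`. The
last is integrated by parts in `x_j`, giving the `V_j` and `X**` terms. The face integral is `λ_i`
times a `W` tail expectation when `i = j`; otherwise it is a first moment in dimension `n - 1`, and
a further step in `x_j` gives the `U` and `V_i` terms.

The delicate step is the one with `H'`: this function is only locally absolutely continuous and may
be unbounded, and integrability of `x_j G H'` is not assumed. Both the identity and the
integrability come from Fubini on each line parallel to an axis (`integral_Ioi_mul_of_primitive`),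
thanks to the uniform comparison `integral_Ioi_abs_mul_le` of tail integrals of `|s| G` with the
second cumulative generator; `setIntegral_tailSet_coord_mul` integrates this over the other
coordinates.

The constants are Gamma integrals: in `r = √(2t)` each generator is a polynomial times `exp(-r)`,
whence `c_n = (n+1) c_n* = (n+3)(n+1) c_n**`. The passage from `Y` to `Z` is an affine change of
variables together with bilinearity of the covariance. -/

theorem hasDerivAt_sqrt_two_mul {s : ℝ} (hs : 0 < s) :
    HasDerivAt (fun v : ℝ => √(2 * v)) (√(2 * s))⁻¹ s := by
  have h := ((hasDerivAt_id s).const_mul 2).sqrt (by simp; linarith)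
  refine h.congr_deriv ?_
  simp only [id]
  field_simp

theorem tendsto_sqrt_two_mul_atTop : Tendsto (fun v : ℝ => √(2 * v)) atTop atTop :=
  tendsto_sqrt_atTop.comp (tendsto_id.const_mul_atTop two_pos)

/-- By the chain rule the integrand is the derivative of `p(√(2v))`. Its constant sign makes it
integrable as soon as the primitive has a limit, and the singularity of the substitution at `v = 0`
is harmless because only continuity is needed at the left endpoint. -/
theorem integral_Ioi_comp_sqrt {p p' : ℝ → ℝ} (hp : ∀ r, HasDerivAt p (p' r) r)
    (hpos : ∀ r, 0 ≤ r → p' r ≤ 0) (hlim : Tendsto p atTop (𝓝 0)) {t : ℝ} (ht : 0 ≤ t) :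
    IntegrableOn (fun v => p' (√(2 * v)) * (√(2 * v))⁻¹) (Ioi t) ∧
      ∫ v in Ioi t, p' (√(2 * v)) * (√(2 * v))⁻¹ = - p (√(2 * t)) := by
  have hc : Continuous p := continuous_iff_continuousAt.2 fun r => (hp r).continuousAt
  have h1 : ContinuousWithinAt (fun v => p (√(2 * v))) (Ici t) t :=
    (by fun_prop : Continuous fun v => p (√(2 * v))).continuousWithinAt
  have h2 : ∀ v ∈ Ioi t, HasDerivAt (fun v => p (√(2 * v))) (p' (√(2 * v)) * (√(2 * v))⁻¹) v :=
    fun v hv => (hp _).comp v (hasDerivAt_sqrt_two_mul (lt_of_le_of_lt ht hv))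
  have h3 : ∀ v ∈ Ioi t, p' (√(2 * v)) * (√(2 * v))⁻¹ ≤ 0 := fun v _ =>
    mul_nonpos_of_nonpos_of_nonneg (hpos _ (sqrt_nonneg _)) (by positivity)
  have h4 : Tendsto (fun v => p (√(2 * v))) atTop (𝓝 0) := hlim.comp tendsto_sqrt_two_mul_atTop
  exact ⟨integrableOn_Ioi_deriv_of_nonpos h1 h2 h3 h4, by
    rw [integral_Ioi_of_hasDerivAt_of_nonpos h1 h2 h3 h4, zero_sub]⟩

theorem tendsto_pow_mul_exp_neg (k : ℕ) :
    Tendsto (fun r : ℝ => r ^ k * Real.exp (-r)) atTop (𝓝 0) :=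
  tendsto_pow_mul_exp_neg_atTop_nhds_zero k

theorem integrableOn_lapGen_and_cumGen_eq {t : ℝ} (ht : 0 ≤ t) :
    IntegrableOn lapGen (Ioi t) ∧ cumGen lapGen t = (1 + √(2 * t)) * Real.exp (-√(2 * t)) := by
  -- The factor `r` in this derivative cancels the Jacobian `r⁻¹` of `r = √(2v)` and leaves
  -- `exp(-r)`.
  have hd : ∀ r : ℝ, HasDerivAt (fun r => (1 + r) * Real.exp (-r)) (- (r * Real.exp (-r))) r := by
    intro r
    refine (((hasDerivAt_id r).const_add 1).mul (hasDerivAt_neg r).exp).congr_deriv ?_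
    simp only [id]; ring
  have hl : Tendsto (fun r : ℝ => (1 + r) * Real.exp (-r)) atTop (𝓝 0) := by
    have := (tendsto_pow_mul_exp_neg 0).add (tendsto_pow_mul_exp_neg 1)
    rw [add_zero] at this
    exact this.congr fun r => by ring
  obtain ⟨h1, h2⟩ := integral_Ioi_comp_sqrt hd
    (fun r hr => neg_nonpos.2 (by positivity)) hl ht
  have he : EqOn (fun v => -(√(2 * v) * Real.exp (-√(2 * v))) * (√(2 * v))⁻¹)
      (fun v => - lapGen v) (Ioi t) := by
    intro v hv
    have : √(2 * v) ≠ 0 := (sqrt_pos.2 (by have := lt_of_le_of_lt ht hv; linarith)).ne'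
    simp only [lapGen]; field_simp
  rw [integrableOn_congr_fun he measurableSet_Ioi] at h1
  rw [setIntegral_congr_fun measurableSet_Ioi he, integral_neg, neg_inj] at h2
  exact ⟨by simpa using h1.neg, h2⟩

theorem continuous_lapGen : Continuous lapGen := by unfold lapGen; fun_prop

theorem integrableOn_Ioi_of_nonneg {g : ℝ → ℝ} (hg : Continuous g)
    (h0 : IntegrableOn g (Ioi 0)) (u : ℝ) : IntegrableOn g (Ioi u) := by
  rcases le_total 0 u with hu | hu
  · exact h0.mono_set (Ioi_subset_Ioi hu)
  · rw [← Ioc_union_Ioi_eq_Ioi hu]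
    exact (hg.integrableOn_Ioc).union h0

/-- Valid at every real `u`, not only for `u ≥ 0`. Since `√` vanishes on negative numbers, `lapGen`
is continuous on the whole line, and the chain rule with `½|x|²` needs no one-sided derivative at
the origin. -/
theorem hasDerivAt_cumGen {g : ℝ → ℝ} (hg : Continuous g) (h0 : IntegrableOn g (Ioi 0)) (u : ℝ) :
    HasDerivAt (cumGen g) (- g u) u := by
  have hE : cumGen g = fun x => cumGen g u - ∫ t in u..x, g t := by
    ext x
    have := intervalIntegral.integral_interval_add_Ioi (integrableOn_Ioi_of_nonneg hg h0 u)
      (integrableOn_Ioi_of_nonneg hg h0 x)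
    simp only [cumGen]; linarith
  rw [hE]
  simpa using (intervalIntegral.integral_hasDerivAt_right (hg.intervalIntegrable u u)
    hg.stronglyMeasurable.stronglyMeasurableAtFilter hg.continuousAt).const_sub (cumGen g u)

theorem cumGen_lapGen {t : ℝ} (ht : 0 ≤ t) :
    cumGen lapGen t = (1 + √(2 * t)) * Real.exp (-√(2 * t)) := (integrableOn_lapGen_and_cumGen_eq ht).2

theorem hasDerivAt_cumGen_lapGen (u : ℝ) : HasDerivAt (cumGen lapGen) (- lapGen u) u :=
  hasDerivAt_cumGen continuous_lapGen (integrableOn_lapGen_and_cumGen_eq le_rfl).1 u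

theorem continuous_cumGen_lapGen : Continuous (cumGen lapGen) :=
  continuous_iff_continuousAt.2 fun u => (hasDerivAt_cumGen_lapGen u).continuousAt

theorem integrableOn_cumGen_lapGen_and_cumGen_eq {t : ℝ} (ht : 0 ≤ t) :
    IntegrableOn (cumGen lapGen) (Ioi t) ∧
      cumGen (cumGen lapGen) t = (3 + 2 * t + 3 * √(2 * t)) * Real.exp (-√(2 * t)) := by
  have hd : ∀ r : ℝ, HasDerivAt (fun r => (3 + r ^ 2 + 3 * r) * Real.exp (-r))
      (- (r * (1 + r) * Real.exp (-r))) r := by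
    intro r
    refine (((((hasDerivAt_id r).pow 2).const_add 3).add
      ((hasDerivAt_id r).const_mul 3)).mul (hasDerivAt_neg r).exp).congr_deriv ?_
    simp; ring
  have hl : Tendsto (fun r : ℝ => (3 + r ^ 2 + 3 * r) * Real.exp (-r)) atTop (𝓝 0) := by
    have := (((tendsto_pow_mul_exp_neg 0).const_mul 3).add (tendsto_pow_mul_exp_neg 2)).add
      ((tendsto_pow_mul_exp_neg 1).const_mul 3)
    simp only [add_zero, mul_zero] at this
    exact this.congr fun r => by ring
  obtain ⟨h1, h2⟩ := integral_Ioi_comp_sqrt hd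
    (fun r hr => neg_nonpos.2 (by positivity)) hl ht
  have he : EqOn (fun v => -(√(2 * v) * (1 + √(2 * v)) * Real.exp (-√(2 * v))) * (√(2 * v))⁻¹)
      (fun v => - cumGen lapGen v) (Ioi t) := by
    intro v hv
    have hv0 : 0 < v := lt_of_le_of_lt ht hv
    have : √(2 * v) ≠ 0 := (sqrt_pos.2 (by linarith)).ne'
    simp only [cumGen_lapGen hv0.le]; field_simp
  rw [integrableOn_congr_fun he measurableSet_Ioi] at h1
  rw [setIntegral_congr_fun measurableSet_Ioi he, integral_neg, neg_inj,
    sq_sqrt (by positivity)] at h2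
  exact ⟨by simpa using h1.neg, h2⟩

theorem cumGen_cumGen_lapGen {t : ℝ} (ht : 0 ≤ t) :
    cumGen (cumGen lapGen) t = (3 + 2 * t + 3 * √(2 * t)) * Real.exp (-√(2 * t)) :=
  (integrableOn_cumGen_lapGen_and_cumGen_eq ht).2

theorem hasDerivAt_cumGen_cumGen_lapGen (u : ℝ) :
    HasDerivAt (cumGen (cumGen lapGen)) (- cumGen lapGen u) u :=
  hasDerivAt_cumGen continuous_cumGen_lapGen (integrableOn_cumGen_lapGen_and_cumGen_eq le_rfl).1 u

theorem continuous_cumGen_cumGen_lapGen : Continuous (cumGen (cumGen lapGen)) :=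
  continuous_iff_continuousAt.2 fun u => (hasDerivAt_cumGen_cumGen_lapGen u).continuousAt

/-! ### Generators of exponential decay -/

/-- A continuous, positive, decreasing generator that decays like that of the Laplace law. -/
structure IsDecayGen (G : ℝ → ℝ) : Prop where
  continuous : Continuous G
  pos : ∀ t, 0 ≤ t → 0 < G t
  anti : AntitoneOn G (Ici 0)
  bound : ∀ t, 0 ≤ t → G t ≤ 3 * (1 + √(2 * t)) ^ 2 * Real.exp (-√(2 * t))

theorem antitoneOn_Ici_of_hasDerivAt {g G : ℝ → ℝ} (hG : ∀ u, HasDerivAt G (- g u) u)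
    (hg : ∀ t, 0 ≤ t → 0 < g t) : AntitoneOn G (Ici 0) := by
  refine antitoneOn_of_deriv_nonpos (convex_Ici 0)
    (fun u _ => (hG u).continuousAt.continuousWithinAt)
    (fun u _ => (hG u).differentiableAt.differentiableWithinAt) fun u hu => ?_
  rw [interior_Ici] at hu
  rw [(hG u).deriv]
  exact neg_nonpos.2 (hg u (le_of_lt hu)).le

/-- The weight `3(1 + r)²`, `r = √(2t)`, in the decay bound is chosen to cover all three generators
at once; the largest polynomial factor is `3 + 3r + r²`, from the second cumulative generator. -/
theorem isDecayGen_lapGen : IsDecayGen lapGen where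
  continuous := continuous_lapGen
  pos t _ := Real.exp_pos _
  anti s hs t ht hst := by
    simp only [lapGen]
    gcongr
  bound t ht := by
    have := sqrt_nonneg (2 * t)
    refine le_mul_of_one_le_left (Real.exp_pos _).le ?_
    nlinarith

theorem isDecayGen_cumGen_lapGen : IsDecayGen (cumGen lapGen) where
  continuous := continuous_cumGen_lapGen
  pos t ht := by rw [cumGen_lapGen ht]; positivity
  anti := antitoneOn_Ici_of_hasDerivAt hasDerivAt_cumGen_lapGen isDecayGen_lapGen.pos
  bound t ht := by
    have := sqrt_nonneg (2 * t)
    rw [cumGen_lapGen ht]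
    gcongr
    nlinarith

theorem isDecayGen_cumGen_cumGen_lapGen : IsDecayGen (cumGen (cumGen lapGen)) where
  continuous := continuous_cumGen_cumGen_lapGen
  pos t ht := by rw [cumGen_cumGen_lapGen ht]; positivity
  anti := antitoneOn_Ici_of_hasDerivAt hasDerivAt_cumGen_cumGen_lapGen
    isDecayGen_cumGen_lapGen.pos
  bound t ht := by
    have := sqrt_nonneg (2 * t)
    have h2 := sq_sqrt (show 0 ≤ 2 * t by positivity)
    rw [cumGen_cumGen_lapGen ht]
    gcongr
    nlinarith

/-- Monotonicity transfers the decay bound: `G(t + a) ≤ G(t)`. Through this the generators of `W`,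
`V` and `U` inherit every property proved for decaying generators. -/
theorem IsDecayGen.shift {G : ℝ → ℝ} (hG : IsDecayGen G) {a : ℝ} (ha : 0 ≤ a) :
    IsDecayGen fun u => G (u + a) where
  continuous := hG.continuous.comp (by fun_prop)
  pos t ht := hG.pos _ (by positivity)
  anti s hs t ht hst := hG.anti (add_nonneg hs ha) (add_nonneg ht ha) (by linarith)
  bound t ht := (hG.anti ht (add_nonneg ht ha) (by linarith)).trans (hG.bound t ht)

/-! ### Integrability under exponential decay -/

section Integrable

variable {ι : Type*} [Fintype ι]

theorem dotProduct_self_nonneg (x : ι → ℝ) : 0 ≤ x ⬝ᵥ x := 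
  Finset.sum_nonneg fun i _ => mul_self_nonneg (x i)

theorem abs_le_sqrt_dotProduct (x : ι → ℝ) (i : ι) : |x i| ≤ √(x ⬝ᵥ x) := by
  rw [← sqrt_sq_eq_abs]
  refine sqrt_le_sqrt ?_
  simp only [dotProduct, ← sq]
  exact Finset.single_le_sum (f := fun i => x i ^ 2) (fun j _ => sq_nonneg _) (Finset.mem_univ i)

theorem integrable_exp_neg_mul_abs {b : ℝ} (hb : 0 < b) :
    Integrable fun y : ℝ => Real.exp (-(b * |y|)) := by
  rw [← integrableOn_univ, ← Iic_union_Ioi (a := (0 : ℝ))]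
  refine IntegrableOn.union ?_ ?_
  · refine (integrableOn_exp_mul_Iic hb 0).congr_fun (fun y hy => ?_) measurableSet_Iic
    simp [abs_of_nonpos (show y ≤ 0 from hy)]
  · refine (exp_neg_integrableOn_Ioi 0 hb).congr_fun (fun y hy => ?_) measurableSet_Ioi
    simp [abs_of_pos (show 0 < y from hy)]

/-- Half of the exponential absorbs the polynomial. The other half is dominated by a product of
one-dimensional exponentials, because `|x_i| ≤ r` for each `i` gives `ε ∑ |x_i| ≤ r/2`. The power 4
is the 2 of the decay bound plus 2 for second moments. -/
theorem integrable_of_decay {f : (ι → ℝ) → ℝ} (hf : AEStronglyMeasurable f) (C : ℝ)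
    (hb : ∀ x, |f x| ≤ C * (1 + √(x ⬝ᵥ x)) ^ 4 * Real.exp (-√(x ⬝ᵥ x))) : Integrable f := by
  -- The `+ 1` keeps the denominator positive and lets the empty index type through.
  set ε : ℝ := 1 / (2 * (Fintype.card ι + 1)) with hε
  have hε0 : 0 < ε := by positivity
  have hprod : Integrable fun x : ι → ℝ => ∏ i, Real.exp (-(ε * |x i|)) := by
    refine Integrable.fintype_prod (f := fun _ : ι => fun y : ℝ => Real.exp (-(ε * |y|))) fun i => ?_
    exact integrable_exp_neg_mul_abs hε0
  have h0 : 0 ≤ |C| := abs_nonneg C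
  refine (hprod.const_mul (|C| * 4096)).mono' hf (Eventually.of_forall fun x => ?_)
  set r := √(x ⬝ᵥ x) with hr
  have hr0 : 0 ≤ r := sqrt_nonneg _
  have h1 : 1 + r ≤ 8 * Real.exp (r / 8) := by
    have := Real.add_one_le_exp (r / 8); nlinarith
  -- Here `4096 = 8 ^ 4`.
  have h2 : (1 + r) ^ 4 ≤ 4096 * Real.exp (r / 2) := by
    calc (1 + r) ^ 4 ≤ (8 * Real.exp (r / 8)) ^ 4 := by gcongr
      _ = 4096 * Real.exp (r / 2) := by
        rw [mul_pow, ← Real.exp_nat_mul]; norm_num; ring_nf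
  have h3 : Real.exp (-(r / 2)) ≤ ∏ i, Real.exp (-(ε * |x i|)) := by
    rw [← Real.exp_sum]
    refine Real.exp_le_exp.2 ?_
    rw [Finset.sum_neg_distrib, neg_le_neg_iff, ← Finset.mul_sum]
    have : ∑ i, |x i| ≤ (Fintype.card ι : ℝ) * r := by
      calc ∑ i, |x i| ≤ ∑ _i : ι, r := Finset.sum_le_sum fun i _ => abs_le_sqrt_dotProduct x i
        _ = _ := by simp
    calc ε * ∑ i, |x i| ≤ ε * ((Fintype.card ι + 1) * r) := by gcongr; linarith
      _ = r / 2 := by rw [hε]; field_simp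
  calc ‖f x‖ ≤ C * (1 + r) ^ 4 * Real.exp (-r) := hb x
    _ ≤ |C| * (4096 * Real.exp (r / 2)) * Real.exp (-r) := by
      gcongr; exact le_abs_self C
    _ = |C| * 4096 * Real.exp (-(r / 2)) := by
      rw [show -(r / 2) = r / 2 + -r by ring, Real.exp_add]; ring
    _ ≤ _ := by gcongr

theorem IsDecayGen.integrable_mul {G : ℝ → ℝ} (hG : IsDecayGen G) {h : (ι → ℝ) → ℝ}
    (hm : AEStronglyMeasurable h) (C : ℝ) (hb : ∀ x, |h x| ≤ C * (1 + √(x ⬝ᵥ x)) ^ 2) :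
    Integrable fun x : ι → ℝ => h x * G ((1 / 2) * (x ⬝ᵥ x)) := by
  have hc : Continuous fun x : ι → ℝ => G ((1 / 2) * (x ⬝ᵥ x)) :=
    hG.continuous.comp (by unfold dotProduct; fun_prop)
  refine integrable_of_decay (hm.mul hc.aestronglyMeasurable) (C * 3) fun x => ?_
  have h0 : 0 ≤ (1 / 2) * (x ⬝ᵥ x) := by have := dotProduct_self_nonneg x; positivity
  have h1 := hG.bound _ h0
  rw [show 2 * (1 / 2 * (x ⬝ᵥ x)) = x ⬝ᵥ x by ring] at h1
  rw [abs_mul, abs_of_pos (hG.pos _ h0)]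
  calc |h x| * G (1 / 2 * (x ⬝ᵥ x))
      ≤ (C * (1 + √(x ⬝ᵥ x)) ^ 2) * (3 * (1 + √(x ⬝ᵥ x)) ^ 2 * Real.exp (-√(x ⬝ᵥ x))) :=
        mul_le_mul (hb x) h1 (hG.pos _ h0).le ((abs_nonneg _).trans (hb x))
    _ = _ := by ring

theorem IsDecayGen.integrable {G : ℝ → ℝ} (hG : IsDecayGen G) :
    Integrable fun x : ι → ℝ => G ((1 / 2) * (x ⬝ᵥ x)) := by
  have := hG.integrable_mul (ι := ι) (h := fun _ => 1) (by fun_prop) 1 fun x => by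
    have := sqrt_nonneg (x ⬝ᵥ x); rw [abs_one]; nlinarith
  simpa using this

theorem IsDecayGen.integral_pos {G : ℝ → ℝ} (hG : IsDecayGen G) :
    0 < ∫ x : ι → ℝ, G ((1 / 2) * (x ⬝ᵥ x)) := by
  have hp : ∀ x : ι → ℝ, 0 < G ((1 / 2) * (x ⬝ᵥ x)) := fun x =>
    hG.pos _ (by have := dotProduct_self_nonneg x; positivity)
  rw [integral_pos_iff_support_of_nonneg (fun x => (hp x).le) hG.integrable]
  have : Function.support (fun x : ι → ℝ => G ((1 / 2) * (x ⬝ᵥ x))) = univ := by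
    ext x; simpa using (hp x).ne'
  rw [this]
  exact Measure.measure_univ_pos.2 (NeZero.ne _)

end Integrable

/-! ### Radial integrals and normalizing constants -/

/-- The substitution `s = x²/2`, as a scaling followed by a power. Both changes of variables hold
without integrability, so `f` is arbitrary. -/
theorem integral_rpow_mul_eq (m : ℝ) (f : ℝ → ℝ) :
    ∫ s in Ioi (0 : ℝ), s ^ (m / 2 - 1) * f s =
      2 ^ (1 - m / 2) * ∫ x in Ioi (0 : ℝ), x ^ (m - 1) * f ((1 / 2) * x ^ 2) := by
  have h1 := integral_comp_mul_left_Ioi (fun s => s ^ (m / 2 - 1) * f s) 0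
    (show (0 : ℝ) < 1 / 2 by norm_num)
  rw [mul_zero, smul_eq_mul] at h1
  have h2 := integral_comp_rpow_Ioi_of_pos (p := 2)
    (g := fun s => (1 / 2 * s) ^ (m / 2 - 1) * f (1 / 2 * s)) two_pos
  rw [h1] at h2
  have h3 : ∫ s in Ioi (0 : ℝ), s ^ (m / 2 - 1) * f s = (1 / 2) * ∫ x in Ioi (0 : ℝ),
      (2 * x ^ ((2 : ℝ) - 1)) •
        ((1 / 2 * x ^ (2 : ℝ)) ^ (m / 2 - 1) * f (1 / 2 * x ^ (2 : ℝ))) := by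
    rw [h2]; ring
  rw [h3, ← integral_const_mul, ← integral_const_mul]
  refine setIntegral_congr_fun measurableSet_Ioi fun x hx => ?_
  have hx0 : (0 : ℝ) < x := hx
  simp only [smul_eq_mul, rpow_ofNat]
  have e1 : (1 / 2 * x ^ 2) ^ (m / 2 - 1) = 2 ^ (1 - m / 2) * (x ^ (m - 1) * x⁻¹) := by
    rw [mul_rpow (by norm_num) (by positivity), one_div, inv_rpow (by norm_num), ← rpow_neg
      (by norm_num), ← rpow_natCast, ← rpow_mul hx0.le, ← rpow_neg_one x, ← rpow_add hx0]
    congr 2 <;> (push_cast; ring)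
  rw [e1]
  norm_num
  field_simp

/-- Polar coordinates in Euclidean space, carried over to `ι → ℝ`; the surface of the unit sphere is
`m` times the volume of the unit ball. -/
theorem integral_radial {ι : Type*} [Fintype ι] [Nonempty ι] (f : ℝ → ℝ) :
    ∫ x : ι → ℝ, f ((1 / 2) * (x ⬝ᵥ x)) =
      (2 * π) ^ ((Fintype.card ι : ℝ) / 2) / Real.Gamma ((Fintype.card ι : ℝ) / 2) *
        ∫ s in Ioi (0 : ℝ), s ^ ((Fintype.card ι : ℝ) / 2 - 1) * f s := by
  have hm : 0 < Fintype.card ι := Fintype.card_pos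
  have hm' : (0 : ℝ) < Fintype.card ι := by exact_mod_cast hm
  have h1 := integral_fun_norm_addHaar (volume : Measure (EuclideanSpace ℝ ι))
    (fun r => f ((1 / 2) * r ^ 2))
  have h2 : ∫ x : EuclideanSpace ℝ ι, f ((1 / 2) * ‖x‖ ^ 2) =
      ∫ x : ι → ℝ, f ((1 / 2) * (x ⬝ᵥ x)) := by
    rw [← (EuclideanSpace.volume_preserving_symm_measurableEquiv_toLp ι).symm.integral_comp
      (MeasurableEquiv.measurableEmbedding _)]
    refine integral_congr_ae (Eventually.of_forall fun x => ?_)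
    simp [EuclideanSpace.norm_sq_eq, dotProduct, ← sq]
  have h3 : (volume : Measure (EuclideanSpace ℝ ι)).real (Metric.ball 0 1) =
      π ^ ((Fintype.card ι : ℝ) / 2) / Real.Gamma ((Fintype.card ι : ℝ) / 2 + 1) := by
    rw [measureReal_def, EuclideanSpace.volume_ball]
    have : 0 < Real.Gamma ((Fintype.card ι : ℝ) / 2 + 1) := Real.Gamma_pos_of_pos (by positivity)
    simp only [ENNReal.ofReal_one, one_pow, one_mul]
    rw [ENNReal.toReal_ofReal (by positivity), sqrt_eq_rpow, ← rpow_natCast,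
      ← rpow_mul pi_pos.le]
    congr 2; ring
  rw [← h2, h1, h3, integral_rpow_mul_eq, finrank_euclideanSpace]
  have h4 : ∫ y in Ioi (0 : ℝ), y ^ (Fintype.card ι - 1) • f (1 / 2 * y ^ 2) =
      ∫ x in Ioi (0 : ℝ), x ^ ((Fintype.card ι : ℝ) - 1) * f (1 / 2 * x ^ 2) := by
    refine setIntegral_congr_fun measurableSet_Ioi fun x hx => ?_
    simp only [smul_eq_mul]
    rw [← rpow_natCast, Nat.cast_sub hm]; simp
  rw [h4, Real.Gamma_add_one (by positivity), mul_rpow (by norm_num) pi_pos.le,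
    rpow_sub two_pos, rpow_one]
  have : 0 < Real.Gamma ((Fintype.card ι : ℝ) / 2) := Real.Gamma_pos_of_pos (by positivity)
  have h5 : (0 : ℝ) < 2 ^ ((Fintype.card ι : ℝ) / 2) := by positivity
  simp only [nsmul_eq_mul, smul_eq_mul]
  field_simp

/-- The dimension `m` is kept apart from `Fintype.card ι` so that the index types with one or two
points removed can be used with `n - 1` and `n - 2`. -/
theorem IsDecayGen.normConst_mul_integral {G : ℝ → ℝ} (hG : IsDecayGen G) {ι : Type*} [Fintype ι]
    {m : ℕ} (hm : Fintype.card ι = m) :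
    normConst m G * ∫ x : ι → ℝ, G ((1 / 2) * (x ⬝ᵥ x)) = 1 := by
  subst hm
  have hpos := hG.integral_pos (ι := ι)
  rcases isEmpty_or_nonempty ι with h | h
  -- Dimension zero: the integral over the single point of mass one is `G 0`, matching the special
  -- value of `normConst`.
  · have : ∀ x : ι → ℝ, G ((1 / 2) * (x ⬝ᵥ x)) = G 0 := fun x => by simp [dotProduct]
    simp only [this] at hpos ⊢
    have hv : (volume : Measure (ι → ℝ)).real univ = 1 := by simp [measureReal_def, volume_pi]
    rw [integral_const, hv, one_smul] at hpos ⊢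
    rw [normConst, if_pos Fintype.card_eq_zero, inv_mul_cancel₀ hpos.ne']
  · have hm : 0 < Fintype.card ι := Fintype.card_pos
    have h1 : 0 < Real.Gamma ((Fintype.card ι : ℝ) / 2) := Real.Gamma_pos_of_pos (by positivity)
    have h2 : (0 : ℝ) < (2 * π) ^ ((Fintype.card ι : ℝ) / 2) := by positivity
    rw [integral_radial] at hpos ⊢
    have h3 : (∫ s in Ioi (0 : ℝ), s ^ ((Fintype.card ι : ℝ) / 2 - 1) * G s) ≠ 0 := by
      intro h; simp [h] at hpos
    rw [normConst, if_neg hm.ne']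
    generalize (∫ s in Ioi (0 : ℝ), s ^ ((Fintype.card ι : ℝ) / 2 - 1) * G s) = I at h3 ⊢
    field_simp

theorem IsDecayGen.normConst_pos {G : ℝ → ℝ} (hG : IsDecayGen G) (m : ℕ) : 0 < normConst m G := by
  have h := hG.normConst_mul_integral (ι := Fin m) (Fintype.card_fin m)
  have hp := hG.integral_pos (ι := Fin m)
  by_contra! hn
  have := mul_nonpos_of_nonpos_of_nonneg hn hp.le
  linarith

/-- With `r = √(2t)` the radial integral of `(a + br + cr²) exp(-r)` is a combination of `Γ(n)`,
`Γ(n+1)` and `Γ(n+2)`, all of them multiples of `Γ(n)`. One computation serves the three generators.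
-/
theorem normConst_eq_of_eq {n : ℕ} (hn : 1 ≤ n) {G : ℝ → ℝ} {a b c : ℝ}
    (hG : ∀ t, 0 ≤ t → G t = (a + b * √(2 * t) + c * (2 * t)) * Real.exp (-√(2 * t))) :
    normConst n G = Real.Gamma ((n : ℝ) / 2) /
      (2 * π ^ ((n : ℝ) / 2) * ((a + b * n + c * (n * (n + 1))) * Real.Gamma n)) := by
  have hn0 : (0 : ℝ) < n := by exact_mod_cast hn
  have hI : ∀ s : ℝ, 0 < s → IntegrableOn (fun x : ℝ => Real.exp (-x) * x ^ (s - 1)) (Ioi 0) :=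
    fun s hs => Real.GammaIntegral_convergent hs
  have key : ∫ x in Ioi (0 : ℝ), x ^ ((n : ℝ) - 1) * G ((1 / 2) * x ^ 2) =
      (a + b * n + c * (n * (n + 1))) * Real.Gamma n := by
    have h1 : EqOn (fun x : ℝ => x ^ ((n : ℝ) - 1) * G ((1 / 2) * x ^ 2))
        (fun x => a * (Real.exp (-x) * x ^ ((n : ℝ) - 1)) +
          b * (Real.exp (-x) * x ^ ((n + 1 : ℝ) - 1)) +
          c * (Real.exp (-x) * x ^ ((n + 1 + 1 : ℝ) - 1))) (Ioi 0) := by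
      intro x hx
      have hx0 : (0 : ℝ) < x := hx
      have e1 : (2 * (1 / 2 * x ^ 2) : ℝ) = x ^ 2 := by ring
      simp only [hG _ (show 0 ≤ 1 / 2 * x ^ 2 by positivity), e1, sqrt_sq hx0.le]
      have e2 : x ^ ((n + 1 : ℝ) - 1) = x ^ ((n : ℝ) - 1) * x := by
        rw [← rpow_add_one hx0.ne']; ring_nf
      have e3 : x ^ ((n + 1 + 1 : ℝ) - 1) = x ^ ((n : ℝ) - 1) * x * x := by
        rw [← rpow_add_one hx0.ne', ← rpow_add_one hx0.ne']; ring_nf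
      rw [e2, e3]; ring
    rw [setIntegral_congr_fun measurableSet_Ioi h1, integral_add, integral_add,
      integral_const_mul, integral_const_mul, integral_const_mul,
      ← Real.Gamma_eq_integral hn0, ← Real.Gamma_eq_integral (by positivity),
      ← Real.Gamma_eq_integral (by positivity), Real.Gamma_add_one (s := (n : ℝ) + 1)
      (by positivity), Real.Gamma_add_one hn0.ne']
    · ring
    · exact (hI _ hn0).const_mul a
    · exact (hI _ (by positivity)).const_mul b
    · exact ((hI _ hn0).const_mul a).add ((hI _ (by positivity)).const_mul b)
    · exact (hI _ (by positivity)).const_mul c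
  rw [normConst, if_neg (by omega), integral_rpow_mul_eq, key, mul_rpow (by norm_num) pi_pos.le,
    rpow_sub two_pos, rpow_one]
  have h5 : (0 : ℝ) < 2 ^ ((n : ℝ) / 2) := by positivity
  field_simp

theorem normConst_lapGen {n : ℕ} (hn : 1 ≤ n) :
    normConst n lapGen = Real.Gamma ((n : ℝ) / 2) / (2 * π ^ ((n : ℝ) / 2) * Real.Gamma n) := by
  rw [normConst_eq_of_eq hn (a := 1) (b := 0) (c := 0) fun t _ => by simp [lapGen]]
  simp

theorem normConst_cumGen_lapGen {n : ℕ} (hn : 1 ≤ n) :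
    normConst n (cumGen lapGen) =
      n * Real.Gamma ((n : ℝ) / 2) / (2 * π ^ ((n : ℝ) / 2) * Real.Gamma (n + 2)) := by
  have hn0 : (0 : ℝ) < n := by exact_mod_cast hn
  have hg := Real.Gamma_pos_of_pos hn0
  rw [normConst_eq_of_eq hn (a := 1) (b := 1) (c := 0) fun t ht => by
    rw [cumGen_lapGen ht]; ring, show (n : ℝ) + 2 = n + 1 + 1 by ring,
    Real.Gamma_add_one (s := (n : ℝ) + 1) (by positivity), Real.Gamma_add_one hn0.ne']
  field_simp
  ring

theorem normConst_cumGen_cumGen_lapGen {n : ℕ} (hn : 1 ≤ n) :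
    normConst n (cumGen (cumGen lapGen)) =
      n * (n + 2) * Real.Gamma ((n : ℝ) / 2) / (2 * π ^ ((n : ℝ) / 2) * Real.Gamma (n + 4)) := by
  have hn0 : (0 : ℝ) < n := by exact_mod_cast hn
  have hg := Real.Gamma_pos_of_pos hn0
  rw [normConst_eq_of_eq hn (a := 3) (b := 3) (c := 1) fun t ht => by
    rw [cumGen_cumGen_lapGen ht]; ring, show (n : ℝ) + 4 = n + 1 + 1 + 1 + 1 by ring,
    Real.Gamma_add_one (s := (n : ℝ) + 1 + 1 + 1) (by positivity),
    Real.Gamma_add_one (s := (n : ℝ) + 1 + 1) (by positivity),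
    Real.Gamma_add_one (s := (n : ℝ) + 1) (by positivity), Real.Gamma_add_one hn0.ne']
  -- The factorization `(n+1)(n+3)` cancels two of the factors of `Γ(n+4)/Γ(n)`; the surviving
  -- `n(n+2)` is the one in the numerator.
  have : (3 + 3 * n + 1 * (n * (n + 1)) : ℝ) = (n + 1) * (n + 1 + 1 + 1) - 0 := by ring
  rw [this]
  field_simp
  ring

theorem normConst_lapGen_eq_mul_cumGen {n : ℕ} (hn : 1 ≤ n) :
    normConst n lapGen = (n + 1) * normConst n (cumGen lapGen) := by
  have hn0 : (0 : ℝ) < n := by exact_mod_cast hn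
  have hg := Real.Gamma_pos_of_pos hn0
  rw [normConst_lapGen hn, normConst_eq_of_eq hn (G := cumGen lapGen) (a := 1) (b := 1) (c := 0)
    fun t ht => by rw [cumGen_lapGen ht]; ring]
  field_simp
  ring

/-- Source of the coefficient `(n+3)(n+1)` of the `H''` terms: it renormalizes the second cumulative
generator to the density of `X**`. -/
theorem normConst_lapGen_eq_mul_cumGen_cumGen {n : ℕ} (hn : 1 ≤ n) :
    normConst n lapGen = (n + 3) * (n + 1) * normConst n (cumGen (cumGen lapGen)) := by
  have hn0 : (0 : ℝ) < n := by exact_mod_cast hn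
  have hg := Real.Gamma_pos_of_pos hn0
  rw [normConst_lapGen hn, normConst_eq_of_eq hn (G := cumGen (cumGen lapGen))
    (a := 3) (b := 3) (c := 1) fun t ht => by rw [cumGen_cumGen_lapGen ht]; ring]
  field_simp
  ring

/-! ### The lower dimensional densities -/

section Reduced

variable {n : ℕ} (lam : Fin n → ℝ)

theorem isDecayGen_genW (k : Fin n) : IsDecayGen (genW lapGen lam k) :=
  isDecayGen_cumGen_lapGen.shift (by positivity)

theorem isDecayGen_genV (k : Fin n) : IsDecayGen (genV lapGen lam k) :=
  isDecayGen_cumGen_cumGen_lapGen.shift (by positivity)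

theorem isDecayGen_genU (i j : Fin n) : IsDecayGen (genU lapGen lam i j) := by
  have := isDecayGen_cumGen_cumGen_lapGen.shift
    (show 0 ≤ (1 / 2) * lam i ^ 2 + (1 / 2) * lam j ^ 2 by positivity)
  simp only [← add_assoc] at this
  exact this

theorem card_ne (k : Fin n) : Fintype.card {l : Fin n // l ≠ k} = n - 1 := by
  simp [Fintype.card_subtype_compl]

theorem card_ne_and_ne {i j : Fin n} (hij : i ≠ j) :
    Fintype.card {l : Fin n // l ≠ i ∧ l ≠ j} = n - 2 := by
  have h : Finset.univ.filter (fun l : Fin n => l ≠ i ∧ l ≠ j) = ({i, j} : Finset (Fin n))ᶜ := by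
    ext l; simp
  rw [Fintype.card_subtype, h, Finset.card_compl, Finset.card_pair hij, Fintype.card_fin]

theorem integral_densW (k : Fin n) : ∫ w, densW lapGen lam k w = 1 := by
  simp only [densW, integral_const_mul]
  exact (isDecayGen_genW lam k).normConst_mul_integral (card_ne k)

theorem integral_densV (k : Fin n) : ∫ w, densV lapGen lam k w = 1 := by
  simp only [densV, integral_const_mul]
  exact (isDecayGen_genV lam k).normConst_mul_integral (card_ne k)

theorem integral_densU {i j : Fin n} (hij : i ≠ j) : ∫ w, densU lapGen lam i j w = 1 := by
  simp only [densU, integral_const_mul]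
  exact (isDecayGen_genU lam i j).normConst_mul_integral (card_ne_and_ne hij)

theorem integral_sphDensity {G : ℝ → ℝ} (hG : IsDecayGen G) :
    ∫ x : Fin n → ℝ, sphDensity G x = 1 := by
  simp only [sphDensity, integral_const_mul]
  exact hG.normConst_mul_integral rfl

theorem genW_lapGen (k : Fin n) {t : ℝ} (ht : 0 ≤ t) : genW lapGen lam k t =
    (1 + √(2 * t + lam k ^ 2)) * Real.exp (-√(2 * t + lam k ^ 2)) := by
  rw [genW, cumGen_lapGen (by positivity)]
  ring_nf

theorem genV_lapGen (k : Fin n) {t : ℝ} (ht : 0 ≤ t) : genV lapGen lam k t =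
    (3 + (2 * t + lam k ^ 2) + 3 * √(2 * t + lam k ^ 2)) *
      Real.exp (-√(2 * t + lam k ^ 2)) := by
  rw [genV, cumGen_cumGen_lapGen (by positivity)]
  ring_nf

theorem genU_lapGen (i j : Fin n) {t : ℝ} (ht : 0 ≤ t) : genU lapGen lam i j t =
    (3 + (2 * t + lam i ^ 2 + lam j ^ 2) + 3 * √(2 * t + lam i ^ 2 + lam j ^ 2)) *
      Real.exp (-√(2 * t + lam i ^ 2 + lam j ^ 2)) := by
  rw [genU, cumGen_cumGen_lapGen (by positivity)]
  ring_nf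

theorem densW_lapGen (k : Fin n) (w : {l : Fin n // l ≠ k} → ℝ) : densW lapGen lam k w =
    constW lapGen lam k * (1 + √(w ⬝ᵥ w + lam k ^ 2)) * Real.exp (-√(w ⬝ᵥ w + lam k ^ 2)) := by
  rw [densW, genW_lapGen lam k (by have := dotProduct_self_nonneg w; positivity),
    show 2 * (1 / 2 * (w ⬝ᵥ w)) = w ⬝ᵥ w by ring, mul_assoc]

theorem densV_lapGen (k : Fin n) (v : {l : Fin n // l ≠ k} → ℝ) : densV lapGen lam k v =
    constV lapGen lam k * (3 + (v ⬝ᵥ v + lam k ^ 2) + 3 * √(v ⬝ᵥ v + lam k ^ 2)) *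
      Real.exp (-√(v ⬝ᵥ v + lam k ^ 2)) := by
  rw [densV, genV_lapGen lam k (by have := dotProduct_self_nonneg v; positivity),
    show 2 * (1 / 2 * (v ⬝ᵥ v)) = v ⬝ᵥ v by ring, mul_assoc]

theorem densU_lapGen (i j : Fin n) (u : {l : Fin n // l ≠ i ∧ l ≠ j} → ℝ) :
    densU lapGen lam i j u = constU lapGen lam i j *
      (3 + (u ⬝ᵥ u + lam i ^ 2 + lam j ^ 2) + 3 * √(u ⬝ᵥ u + lam i ^ 2 + lam j ^ 2)) *
        Real.exp (-√(u ⬝ᵥ u + lam i ^ 2 + lam j ^ 2)) := by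
  rw [densU, genU_lapGen lam i j (by have := dotProduct_self_nonneg u; positivity),
    show 2 * (1 / 2 * (u ⬝ᵥ u)) = u ⬝ᵥ u by ring, mul_assoc]

theorem normConst_sub_one (hn : 2 ≤ n) (G : ℝ → ℝ) :
    normConst (n - 1) G = Real.Gamma (((n : ℝ) - 1) / 2) / (2 * π) ^ (((n : ℝ) - 1) / 2) *
      (∫ t in Ioi (0 : ℝ), t ^ (((n : ℝ) - 3) / 2) * G t)⁻¹ := by
  rw [normConst, if_neg (by omega), Nat.cast_sub (by omega),
    show (((n : ℝ) - (1 : ℕ)) / 2 - 1) = ((n : ℝ) - 3) / 2 by push_cast; ring]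
  simp

theorem normConst_sub_two (hn : 3 ≤ n) (G : ℝ → ℝ) :
    normConst (n - 2) G = Real.Gamma (((n : ℝ) - 2) / 2) / (2 * π) ^ (((n : ℝ) - 2) / 2) *
      (∫ t in Ioi (0 : ℝ), t ^ (((n : ℝ) - 4) / 2) * G t)⁻¹ := by
  rw [normConst, if_neg (by omega), Nat.cast_sub (by omega),
    show (((n : ℝ) - (2 : ℕ)) / 2 - 1) = ((n : ℝ) - 4) / 2 by push_cast; ring]
  simp

theorem constW_lapGen (hn : 2 ≤ n) (k : Fin n) : constW lapGen lam k =
    Real.Gamma (((n : ℝ) - 1) / 2) / (2 * π) ^ (((n : ℝ) - 1) / 2) *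
      (∫ t in Ioi (0 : ℝ), t ^ (((n : ℝ) - 3) / 2) *
        (1 + √(2 * t + lam k ^ 2)) * Real.exp (-√(2 * t + lam k ^ 2)))⁻¹ := by
  rw [constW, normConst_sub_one hn]
  congr 2
  refine setIntegral_congr_fun measurableSet_Ioi fun t ht => ?_
  simp only [genW_lapGen lam k (le_of_lt ht), mul_assoc]

theorem constV_lapGen (hn : 2 ≤ n) (k : Fin n) : constV lapGen lam k =
    Real.Gamma (((n : ℝ) - 1) / 2) / (2 * π) ^ (((n : ℝ) - 1) / 2) *
      (∫ t in Ioi (0 : ℝ), t ^ (((n : ℝ) - 3) / 2) *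
        (3 + (2 * t + lam k ^ 2) + 3 * √(2 * t + lam k ^ 2)) *
        Real.exp (-√(2 * t + lam k ^ 2)))⁻¹ := by
  rw [constV, normConst_sub_one hn]
  congr 2
  refine setIntegral_congr_fun measurableSet_Ioi fun t ht => ?_
  simp only [genV_lapGen lam k (le_of_lt ht), mul_assoc]

theorem constU_lapGen (hn : 3 ≤ n) (i j : Fin n) : constU lapGen lam i j =
    Real.Gamma (((n : ℝ) - 2) / 2) / (2 * π) ^ (((n : ℝ) - 2) / 2) *
      (∫ t in Ioi (0 : ℝ), t ^ (((n : ℝ) - 4) / 2) *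
        (3 + (2 * t + lam i ^ 2 + lam j ^ 2) + 3 * √(2 * t + lam i ^ 2 + lam j ^ 2)) *
        Real.exp (-√(2 * t + lam i ^ 2 + lam j ^ 2)))⁻¹ := by
  rw [constU, normConst_sub_two hn]
  congr 2
  refine setIntegral_congr_fun measurableSet_Ioi fun t ht => ?_
  simp only [genU_lapGen lam i j (le_of_lt ht), mul_assoc]

theorem normConst_div_sub_one (hn : 2 ≤ n) (I : ℝ) :
    normConst n lapGen /
        (Real.Gamma (((n : ℝ) - 1) / 2) / (2 * π) ^ (((n : ℝ) - 1) / 2) * I⁻¹) =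
      Real.Gamma ((n : ℝ) / 2) * 2 ^ (((n : ℝ) - 3) / 2) /
        (Real.Gamma n * Real.Gamma (((n : ℝ) - 1) / 2) * √π) * I := by
  have hn2 : (2 : ℝ) ≤ n := by exact_mod_cast hn
  have h1 : 0 < Real.Gamma (((n : ℝ) - 1) / 2) := Real.Gamma_pos_of_pos (by linarith)
  have h2 : 0 < Real.Gamma (n : ℝ) := Real.Gamma_pos_of_pos (by linarith)
  have h3 : 0 < √π := sqrt_pos.2 pi_pos
  have e1 : (2 * π) ^ (((n : ℝ) - 1) / 2) =
      2 ^ (((n : ℝ) - 3) / 2) * 2 * (π ^ ((n : ℝ) / 2) * (√π)⁻¹) := by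
    rw [mul_rpow two_pos.le pi_pos.le, ← rpow_add_one two_ne_zero, sqrt_eq_rpow,
      ← rpow_neg pi_pos.le, ← rpow_add pi_pos]
    ring_nf
  rw [normConst_lapGen (by omega), e1]
  have h4 : 0 < π ^ ((n : ℝ) / 2) := by positivity
  have h5 : (0 : ℝ) < 2 ^ (((n : ℝ) - 3) / 2) := by positivity
  rw [div_mul_eq_mul_div, div_div_eq_mul_div]
  -- For `I = 0` both sides are zero by the convention `0⁻¹ = 0`, so the integral need not be known
  -- to be nonzero.
  by_cases hI : I = 0
  · simp [hI]
  field_simp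

theorem normConst_div_sub_two (hn : 3 ≤ n) (I : ℝ) :
    normConst n lapGen /
        (Real.Gamma (((n : ℝ) - 2) / 2) / (2 * π) ^ (((n : ℝ) - 2) / 2) * I⁻¹) =
      ((n : ℝ) - 2) * 2 ^ (((n : ℝ) - 6) / 2) / (Real.Gamma n * π) * I := by
  have hn3 : (3 : ℝ) ≤ n := by exact_mod_cast hn
  have h1 : 0 < Real.Gamma (((n : ℝ) - 2) / 2) := Real.Gamma_pos_of_pos (by linarith)
  have h2 : 0 < Real.Gamma (n : ℝ) := Real.Gamma_pos_of_pos (by linarith)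
  have e1 : (2 * π) ^ (((n : ℝ) - 2) / 2) =
      2 ^ (((n : ℝ) - 6) / 2) * 4 * (π ^ ((n : ℝ) / 2) * π⁻¹) := by
    rw [mul_rpow two_pos.le pi_pos.le, show (4 : ℝ) = 2 ^ (2 : ℝ) by norm_num,
      ← rpow_add two_pos, ← rpow_neg_one π, ← rpow_add pi_pos]
    ring_nf
  -- Dimensions `n` and `n - 2` differ by one step of the Gamma recursion, so this ratio, unlike the
  -- one for `n - 1`, keeps no quotient of half-integer Gamma values.
  have e2 : Real.Gamma ((n : ℝ) / 2) =
      ((n : ℝ) - 2) / 2 * Real.Gamma (((n : ℝ) - 2) / 2) := by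
    rw [← Real.Gamma_add_one (by linarith)]; ring_nf
  rw [normConst_lapGen (by omega), e1, e2]
  have h4 : 0 < π ^ ((n : ℝ) / 2) := by positivity
  have h5 : (0 : ℝ) < 2 ^ (((n : ℝ) - 6) / 2) := by positivity
  by_cases hI : I = 0
  · simp [hI]
  field_simp
  ring

end Reduced

/-! ### Singling out one coordinate -/

theorem measurableSet_tailSet {ι : Type*} [Fintype ι] (t : ι → ℝ) : MeasurableSet (tailSet t) := by
  have : tailSet t = ⋂ k, {x | t k < x k} := by ext x; simp [tailSet]
  rw [this]
  exact MeasurableSet.iInter fun k => measurableSet_lt measurable_const (measurable_pi_apply k)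

section Insert

variable {ι : Type*} [DecidableEq ι]

/-- The vector with `k`-th entry `s` and the other entries from `w`. -/
def ins (k : ι) (s : ℝ) (w : {l : ι // l ≠ k} → ℝ) : ι → ℝ :=
  fun l => if h : l ≠ k then w ⟨l, h⟩ else s

/-- The vector `v` with the `k`-th entry removed. -/
def rem (v : ι → ℝ) (k : ι) : {l : ι // l ≠ k} → ℝ := fun l => v l

@[simp] theorem ins_self (k : ι) (s : ℝ) (w : {l : ι // l ≠ k} → ℝ) : ins k s w k = s := by
  simp [ins]

theorem ins_of_ne {k l : ι} (h : l ≠ k) (s : ℝ) (w : {l : ι // l ≠ k} → ℝ) :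
    ins k s w l = w ⟨l, h⟩ := by
  simp [ins, h]

/-- The splitting of `ℝ^ι` into the `k`-th coordinate and the others. -/
def insEquiv (k : ι) : (({l : ι // l ≠ k} → ℝ) × ℝ) ≃ᵐ (ι → ℝ) :=
  letI : Unique {l : ι // ¬ l ≠ k} := ⟨⟨⟨k, by simp⟩⟩, fun l => Subtype.ext (not_not.1 l.2)⟩
  ((MeasurableEquiv.refl _).prodCongr (MeasurableEquiv.funUnique {l : ι // ¬ l ≠ k} ℝ).symm).trans
    (MeasurableEquiv.piEquivPiSubtypeProd (fun _ : ι => ℝ) (fun l => l ≠ k)).symm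

theorem insEquiv_apply (k : ι) (p : ({l : ι // l ≠ k} → ℝ) × ℝ) :
    insEquiv k p = ins k p.2 p.1 := rfl

theorem insEquiv_preimage_tailSet (lam : ι → ℝ) (k : ι) :
    insEquiv k ⁻¹' tailSet lam = tailSet (rem lam k) ×ˢ Ioi (lam k) := by
  ext ⟨w, s⟩
  simp only [mem_preimage, insEquiv_apply, tailSet, mem_prod, mem_Ioi, mem_ofPred_eq]
  constructor
  · intro h
    exact ⟨fun l => by have := h l; rwa [ins_of_ne l.2] at this, by simpa using h k⟩
  · rintro ⟨h1, h2⟩ l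
    by_cases hl : l = k
    · subst hl; simpa using h2
    · rw [ins_of_ne hl]; exact h1 ⟨l, hl⟩

variable [Fintype ι]

theorem dotProduct_ins (k : ι) (s : ℝ) (w : {l : ι // l ≠ k} → ℝ) (v : ι → ℝ) :
    v ⬝ᵥ ins k s w = rem v k ⬝ᵥ w + v k * s := by
  simp only [dotProduct]
  rw [← Fintype.sum_subtype_add_sum_subtype (fun l => l ≠ k) (fun i => v i * ins k s w i)]
  congr 1
  · exact Finset.sum_congr rfl fun l _ => by rw [ins_of_ne l.2]; rfl
  · have : ∀ l : {l : ι // ¬ l ≠ k}, v l * ins k s w l = v k * s := fun l => by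
      rw [not_not.1 l.2, ins_self]
    rw [Finset.sum_congr rfl fun l _ => this l, Finset.sum_const, Finset.card_univ]
    simp

theorem ins_dotProduct_ins (k : ι) (s : ℝ) (w : {l : ι // l ≠ k} → ℝ) :
    ins k s w ⬝ᵥ ins k s w = w ⬝ᵥ w + s ^ 2 := by
  rw [dotProduct_ins, ins_self, sq]
  congr 2
  ext l
  exact ins_of_ne l.2 _ _

theorem measurePreserving_insEquiv (k : ι) :
    MeasurePreserving (insEquiv k) (volume.prod volume) volume := by
  let _ : Unique {l : ι // ¬ l ≠ k} := ⟨⟨⟨k, by simp⟩⟩, fun l => Subtype.ext (not_not.1 l.2)⟩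
  have h1 := (volume_preserving_piEquivPiSubtypeProd (fun _ : ι => ℝ) (fun l => l ≠ k)).symm
  have h2 : MeasurePreserving (MeasurableEquiv.funUnique {l : ι // ¬ l ≠ k} ℝ).symm
      (volume : Measure ℝ) volume := by
    convert (volume_preserving_funUnique {l : ι // ¬ l ≠ k} ℝ).symm
  exact h1.comp ((MeasurePreserving.id _).prod h2)

theorem measurePreserving_insEquiv_tailSet (lam : ι → ℝ) (k : ι) :
    MeasurePreserving (insEquiv k)
      ((volume.restrict (tailSet (rem lam k))).prod (volume.restrict (Ioi (lam k))))
      (volume.restrict (tailSet lam)) := by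
  have := (measurePreserving_insEquiv k).restrict_preimage_emb
    (MeasurableEquiv.measurableEmbedding _) (tailSet lam)
  rwa [insEquiv_preimage_tailSet, ← Measure.prod_restrict] at this

theorem integrableOn_tailSet_iff (lam : ι → ℝ) (k : ι) (f : (ι → ℝ) → ℝ) :
    IntegrableOn f (tailSet lam) ↔ Integrable (fun p => f (ins k p.2 p.1))
      ((volume.restrict (tailSet (rem lam k))).prod (volume.restrict (Ioi (lam k)))) :=
  ((measurePreserving_insEquiv_tailSet lam k).integrable_comp_emb
    (MeasurableEquiv.measurableEmbedding _)).symm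

theorem setIntegral_tailSet {lam : ι → ℝ} (k : ι) {f : (ι → ℝ) → ℝ}
    (hf : IntegrableOn f (tailSet lam)) :
    ∫ x in tailSet lam, f x =
      ∫ w in tailSet (rem lam k), ∫ s in Ioi (lam k), f (ins k s w) := by
  rw [← integral_prod _ ((integrableOn_tailSet_iff lam k f).1 hf)]
  exact ((measurePreserving_insEquiv_tailSet lam k).integral_comp
    (MeasurableEquiv.measurableEmbedding _) f).symm

/-- Integration of a partial derivative over an orthant. -/
theorem setIntegral_tailSet_of_hasDerivAt {lam : ι → ℝ} (k : ι) {F D : (ι → ℝ) → ℝ}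
    (hD : IntegrableOn D (tailSet lam))
    (hF : ∀ w s, HasDerivAt (fun s => F (ins k s w)) (D (ins k s w)) s)
    (hlim : ∀ w, Tendsto (fun s => F (ins k s w)) atTop (𝓝 0)) :
    ∫ x in tailSet lam, D x = - ∫ w in tailSet (rem lam k), F (ins k (lam k) w) := by
  rw [setIntegral_tailSet k hD, ← integral_neg]
  refine integral_congr_ae ?_
  -- By Fubini `D` is integrable on almost every line parallel to the `k`-axis, and there the
  -- fundamental theorem of calculus applies on the half-line.
  filter_upwards [((integrableOn_tailSet_iff lam k D).1 hD).prod_right_ae] with w hw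
  rw [integral_Ioi_of_hasDerivAt_of_tendsto' (fun s _ => hF w s) hw (hlim w), zero_sub]

end Insert

/-! ### Integration by parts against an absolutely continuous factor -/

/-- If `φ` is a primitive of `ψ` on `[a, ∞)` and `Q` dominates the tail integrals of `|p|`, then
`∫ p φ` can be evaluated by exchanging the order of integration. -/
theorem integral_Ioi_mul_of_primitive {a C : ℝ} {p Q φ ψ : ℝ → ℝ} (hp : IntegrableOn p (Ioi a))
    (hQ0 : ∀ t, 0 ≤ Q t) (hQ : ∀ t, a ≤ t → ∫ s in Ioi t, |p s| ≤ C * Q t)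
    (hψ : AEStronglyMeasurable ψ (volume.restrict (Ioi a)))
    (hQψ : IntegrableOn (fun t => Q t * ψ t) (Ioi a))
    (hφ : ∀ s, a < s → φ s = φ a + ∫ t in Ioc a s, ψ t) :
    IntegrableOn (fun s => p s * φ s) (Ioi a) ∧
      ∫ s in Ioi a, p s * φ s =
        φ a * (∫ s in Ioi a, p s) + ∫ t in Ioi a, (∫ s in Ioi t, p s) * ψ t ∧
      ∫ s in Ioi a, |p s * φ s| ≤ |φ a| * (C * Q a) + C * ∫ t in Ioi a, |Q t * ψ t| := by
  set ν : Measure ℝ := volume.restrict (Ioi a) with hν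
  -- The kernel `p(s) ψ(t)` on `t ≤ s`: integrating in `t` first gives `p(s)(φ(s) - φ(a))`, in `s`
  -- first the tail integral of `p` times `ψ(t)`.
  set f : ℝ × ℝ → ℝ := {x : ℝ × ℝ | x.2 ≤ x.1}.indicator fun x => p x.1 * ψ x.2 with hf
  have hmem : ∀ᵐ t ∂ν, a < t := ae_restrict_mem measurableSet_Ioi
  have hmeas : AEStronglyMeasurable f (ν.prod ν) :=
    (hp.1.comp_fst.mul hψ.comp_snd).indicator (measurableSet_le measurable_snd measurable_fst)
  have hft : ∀ t, (fun s => f (s, t)) = fun s => (Ici t).indicator p s * ψ t := by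
    intro t; ext s
    by_cases h : t ≤ s <;> simp [hf, indicator, h]
  have hfs : ∀ s, (fun t => f (s, t)) = fun t => p s * (Iic s).indicator ψ t := by
    intro s; ext t
    by_cases h : t ≤ s <;> simp [hf, indicator, h]
  have hIci : ∀ t, a < t → ∀ r : ℝ → ℝ, ∫ s, (Ici t).indicator r s ∂ν = ∫ s in Ioi t, r s := by
    intro t ht r
    rw [integral_indicator measurableSet_Ici, hν, Measure.restrict_restrict measurableSet_Ici,
      inter_eq_left.2 (Ici_subset_Ioi.2 ht), integral_Ici_eq_integral_Ioi]
  have hnorm : ∀ t, a < t → ∫ s, ‖f (s, t)‖ ∂ν = (∫ s in Ioi t, |p s|) * |ψ t| := by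
    intro t ht
    rw [← hIci t ht, ← integral_mul_const]
    refine integral_congr_ae (Eventually.of_forall fun s => ?_)
    have := congrFun (hft t) s
    dsimp only at this ⊢
    rw [this, norm_mul, Real.norm_eq_abs, Real.norm_eq_abs]
    by_cases h : t ≤ s <;> simp [indicator, h]
  have hle : ∀ t, a < t → (∫ s in Ioi t, |p s|) * |ψ t| ≤ C * |Q t * ψ t| := by
    intro t ht
    rw [abs_mul, abs_of_nonneg (hQ0 t), ← mul_assoc]
    exact mul_le_mul_of_nonneg_right (hQ t ht.le) (abs_nonneg _)
  -- Absolute integrability of the kernel comes from the last hypothesis on `Q`: the inner norm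
  -- integral is at most `C |Q ψ|`.
  have hint2 : Integrable (fun t => ∫ s, ‖f (s, t)‖ ∂ν) ν := by
    refine (hQψ.abs.const_mul C).mono' hmeas.prod_swap.norm.integral_prod_right' ?_
    filter_upwards [hmem] with t ht
    rw [hnorm t ht, Real.norm_eq_abs, abs_of_nonneg
      (mul_nonneg (integral_nonneg fun s => abs_nonneg _) (abs_nonneg _))]
    exact hle t ht
  have hfi : Integrable f (ν.prod ν) := by
    refine (integrable_prod_iff' hmeas).2 ⟨?_, hint2⟩
    refine Eventually.of_forall fun t => ?_
    rw [hft t]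
    exact (Integrable.indicator hp measurableSet_Ici).mul_const _
  have hinner : ∀ s, a < s → ∫ t, f (s, t) ∂ν = p s * (φ s - φ a) := by
    intro s hs
    rw [hfs s, integral_const_mul, integral_indicator measurableSet_Iic, hν,
      Measure.restrict_restrict measurableSet_Iic, inter_comm, Ioi_inter_Iic, hφ s hs]
    ring
  have hE : ∀ᵐ s ∂ν, p s * φ s = φ a * p s + ∫ t, f (s, t) ∂ν := by
    filter_upwards [hmem] with s hs
    rw [hinner s hs]; ring
  have hi1 : Integrable (fun s => φ a * p s) ν := Integrable.const_mul hp _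
  have hi2 : Integrable (fun s => ∫ t, f (s, t) ∂ν) ν := hfi.integral_prod_left
  refine ⟨(hi1.add hi2).congr (hE.mono fun s hs => hs.symm), ?_, ?_⟩
  · rw [integral_congr_ae hE, integral_add hi1 hi2, integral_const_mul,
      integral_integral_swap (f := fun s t => f (s, t)) hfi, add_right_inj]
    refine integral_congr_ae ?_
    filter_upwards [hmem] with t ht
    rw [hft t, integral_mul_const, hIci t ht]
  -- The quantitative bound is what later allows integration over the remaining coordinates.
  · have h1 : ∫ s, |p s * φ s| ∂ν ≤ ∫ s, (|φ a| * |p s| + ∫ t, ‖f (s, t)‖ ∂ν) ∂ν := by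
      refine integral_mono_ae ((hi1.add hi2).congr (hE.mono fun s hs => hs.symm)).abs
        ((Integrable.const_mul hp.abs _).add hfi.norm.integral_prod_left) ?_
      filter_upwards [hE] with s hs
      rw [hs, ← abs_mul]
      exact (abs_add_le _ _).trans (add_le_add_right (norm_integral_le_integral_norm (μ := ν) fun t => f (s, t)) _)
    refine h1.trans ?_
    rw [integral_add (Integrable.const_mul hp.abs _) hfi.norm.integral_prod_left,
      integral_const_mul, integral_integral_swap (f := fun s t => ‖f (s, t)‖) hfi.norm]
    refine add_le_add (mul_le_mul_of_nonneg_left (hQ a le_rfl) (abs_nonneg _)) ?_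
    rw [← integral_const_mul]
    refine integral_mono_ae hint2 (hQψ.abs.const_mul C) ?_
    filter_upwards [hmem] with t ht
    exact (hnorm t ht).trans_le (hle t ht)

theorem IsDecayGen.tendsto_zero {G : ℝ → ℝ} (hG : IsDecayGen G) : Tendsto G atTop (𝓝 0) := by
  have h : Tendsto (fun r : ℝ => 3 * (1 + r) ^ 2 * Real.exp (-r)) atTop (𝓝 0) := by
    have := (((tendsto_pow_mul_exp_neg 0).const_mul 3).add
      ((tendsto_pow_mul_exp_neg 1).const_mul 6)).add ((tendsto_pow_mul_exp_neg 2).const_mul 3)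
    simp only [add_zero, mul_zero] at this
    exact this.congr fun r => by ring
  exact squeeze_zero' (eventually_atTop.2 ⟨0, fun t ht => (hG.pos t ht).le⟩)
    (eventually_atTop.2 ⟨0, hG.bound⟩) (h.comp tendsto_sqrt_two_mul_atTop)

theorem IsDecayGen.tendsto_half_add_sq {G : ℝ → ℝ} (hG : IsDecayGen G) (b : ℝ) :
    Tendsto (fun s : ℝ => G ((1 / 2) * (b + s ^ 2))) atTop (𝓝 0) := by
  refine hG.tendsto_zero.comp (Tendsto.const_mul_atTop (by norm_num) ?_)
  exact tendsto_atTop_add_const_left _ b (tendsto_pow_atTop two_ne_zero)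

theorem hasDerivAt_half_add_sq {g G : ℝ → ℝ} (h : ∀ u, HasDerivAt G (- g u) u) (b s : ℝ) :
    HasDerivAt (fun s : ℝ => G ((1 / 2) * (b + s ^ 2))) (- (s * g ((1 / 2) * (b + s ^ 2)))) s := by
  have h1 : HasDerivAt (fun s : ℝ => (1 / 2) * (b + s ^ 2)) s s := by
    refine (((hasDerivAt_id s).pow 2).const_add b |>.const_mul (1 / 2)).congr_deriv ?_
    simp
  exact ((h _).comp s h1).congr_deriv (by ring)

/-- The integrand is minus the derivative of `G(½(b + s²))`. Its sign gives integrability on `(0,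
∞)`, and continuity extends this to a half-line with negative endpoint. -/
theorem integral_Ioi_id_mul {g G : ℝ → ℝ} (hg : IsDecayGen g) (hG : IsDecayGen G)
    (h : ∀ u, HasDerivAt G (- g u) u) {b : ℝ} (hb : 0 ≤ b) (t : ℝ) :
    IntegrableOn (fun s : ℝ => s * g ((1 / 2) * (b + s ^ 2))) (Ioi t) ∧
      ∫ s in Ioi t, s * g ((1 / 2) * (b + s ^ 2)) = G ((1 / 2) * (b + t ^ 2)) := by
  have hd := hasDerivAt_half_add_sq h b
  have hl := hG.tendsto_half_add_sq b
  have h0 : IntegrableOn (fun s : ℝ => s * g ((1 / 2) * (b + s ^ 2))) (Ioi 0) := by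
    have := integrableOn_Ioi_deriv_of_nonpos' (a := 0) (fun s _ => hd s) (fun s hs => by
      have := hg.pos ((1 / 2) * (b + s ^ 2)) (by positivity)
      exact neg_nonpos.2 (mul_nonneg (le_of_lt hs) this.le)) hl
    simpa using this.neg
  have hi := integrableOn_Ioi_of_nonneg (by have := hg.continuous; fun_prop) h0 t
  refine ⟨hi, ?_⟩
  have := integral_Ioi_of_hasDerivAt_of_tendsto' (fun s _ => hd s) hi.neg hl
  rw [integral_neg] at this
  linarith

/-- The point is that the constant does not depend on `b` or on `t ≥ a`. For `t ≥ 0` the absolute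
value is idle and the integral is exact. For `a ≤ t ≤ 0` the integral over the whole line is twice
the value `Q 0`, and `√(b + t²) ≤ √b + |a|` costs at most a factor `exp |a|` in comparing `Q 0` with
`Q t`. -/
theorem integral_Ioi_abs_mul_le {t a b : ℝ} (hb : 0 ≤ b) (ht : a ≤ t) :
    ∫ s in Ioi t, |s * cumGen lapGen ((1 / 2) * (b + s ^ 2))| ≤
      2 * Real.exp |a| * cumGen (cumGen lapGen) ((1 / 2) * (b + t ^ 2)) := by
  set p : ℝ → ℝ := fun s => s * cumGen lapGen ((1 / 2) * (b + s ^ 2)) with hp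
  set Q : ℝ → ℝ := fun s => cumGen (cumGen lapGen) ((1 / 2) * (b + s ^ 2)) with hQ
  have hpQ := integral_Ioi_id_mul isDecayGen_cumGen_lapGen isDecayGen_cumGen_cumGen_lapGen
    hasDerivAt_cumGen_cumGen_lapGen hb
  have hG1 : ∀ s : ℝ, 0 < cumGen lapGen ((1 / 2) * (b + s ^ 2)) := fun s =>
    isDecayGen_cumGen_lapGen.pos _ (by positivity)
  have hQpos : ∀ s : ℝ, 0 < Q s := fun s =>
    isDecayGen_cumGen_cumGen_lapGen.pos _ (by positivity)
  have hexp : 1 ≤ Real.exp |a| := Real.one_le_exp (abs_nonneg a)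
  have hnn : ∀ t : ℝ, 0 ≤ t → ∫ s in Ioi t, |p s| = Q t := by
    intro t ht
    refine Eq.trans ?_ (hpQ t).2
    refine setIntegral_congr_fun measurableSet_Ioi fun s hs => ?_
    exact abs_of_pos (mul_pos (lt_of_le_of_lt ht hs) (hG1 s))
  rcases le_total 0 t with h0 | h0
  · rw [hnn t h0]
    exact le_mul_of_one_le_left (hQpos t).le (by linarith)
  · have h1 : ∫ s, |p s| = 2 * Q 0 := by
      rw [← hnn 0 le_rfl, ← integral_comp_abs]
      refine integral_congr_ae (Eventually.of_forall fun s => ?_)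
      simp [hp, abs_mul]
    -- A non-integrable function would have integral zero, contradicting the positive value just
    -- found.
    have h2 : Integrable fun s => |p s| := by
      by_contra h
      rw [integral_undef h] at h1
      have := hQpos 0
      linarith
    have h3 : Q 0 ≤ Real.exp |a| * Q t := by
      simp only [hQ]
      rw [cumGen_cumGen_lapGen (by positivity), cumGen_cumGen_lapGen (by positivity),
        show 2 * (1 / 2 * (b + 0 ^ 2)) = b by ring, show 2 * (1 / 2 * (b + t ^ 2)) = b + t ^ 2 by
        ring]
      have e1 : √b ≤ √(b + t ^ 2) := sqrt_le_sqrt (by nlinarith)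
      have e2 : √(b + t ^ 2) ≤ √b + |a| := by
        refine sqrt_le_iff.2 ⟨by positivity, ?_⟩
        have := sq_sqrt hb
        have : t ^ 2 ≤ |a| ^ 2 := by rw [sq_abs]; nlinarith
        nlinarith [mul_nonneg (sqrt_nonneg b) (abs_nonneg a)]
      calc (3 + b + 3 * √b) * Real.exp (-√b)
          ≤ (3 + (b + t ^ 2) + 3 * √(b + t ^ 2)) * Real.exp (|a| + -√(b + t ^ 2)) := by
            refine mul_le_mul ?_ (Real.exp_le_exp.2 (by linarith)) (Real.exp_pos _).le
              (by positivity)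
            nlinarith
        _ = _ := by rw [Real.exp_add]; ring
    calc ∫ s in Ioi t, |p s| ≤ ∫ s, |p s| :=
          setIntegral_le_integral h2 (Eventually.of_forall fun s => abs_nonneg _)
      _ = 2 * Q 0 := h1
      _ ≤ 2 * (Real.exp |a| * Q t) := by linarith
      _ = _ := by ring

/-- With the factor `c` kept on the integral, the affine substitution also covers `c = 0`, that is,
a vanishing entry of `γ`. -/
theorem eq_add_integral_deriv_comp {φ : ℝ → ℝ}
    (hφ : ∀ a b : ℝ, AbsolutelyContinuousOnInterval φ a b) (d c : ℝ) {a s : ℝ} (has : a < s) :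
    φ (d + c * s) = φ (d + c * a) + ∫ t in Ioc a s, c * deriv φ (d + c * t) := by
  rw [← intervalIntegral.integral_of_le has.le, intervalIntegral.integral_const_mul,
    intervalIntegral.mul_integral_comp_add_mul (f := deriv φ),
    (hφ _ _).integral_deriv_eq_sub]
  ring

theorem continuous_of_absolutelyContinuousOnInterval {φ : ℝ → ℝ}
    (hφ : ∀ a b : ℝ, AbsolutelyContinuousOnInterval φ a b) : Continuous φ := by
  refine continuous_iff_continuousAt.2 fun x => ?_
  have := (hφ (x - 1) (x + 1)).continuousOn
  rw [uIcc_of_le (by linarith)] at this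
  exact this.continuousAt (Icc_mem_nhds (by linarith) (by linarith))

section

variable {ι : Type*} [Fintype ι] [DecidableEq ι]

/-- Integration by parts over an orthant against a function `φ(γᵀ x)` with `φ` locally absolutely
continuous. -/
theorem setIntegral_tailSet_coord_mul {φ : ℝ → ℝ}
    (hφ : ∀ a b : ℝ, AbsolutelyContinuousOnInterval φ a b) (γ lam : ι → ℝ) (k : ι)
    (hface : IntegrableOn (fun w => cumGen (cumGen lapGen) ((1 / 2) * (w ⬝ᵥ w + lam k ^ 2)) *
      φ (γ ⬝ᵥ ins k (lam k) w)) (tailSet (rem lam k)))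
    (hbulk : IntegrableOn (fun x => cumGen (cumGen lapGen) ((1 / 2) * (x ⬝ᵥ x)) *
      deriv φ (γ ⬝ᵥ x)) (tailSet lam)) :
    IntegrableOn (fun x => x k * (cumGen lapGen ((1 / 2) * (x ⬝ᵥ x)) * φ (γ ⬝ᵥ x)))
        (tailSet lam) ∧
      ∫ x in tailSet lam, x k * (cumGen lapGen ((1 / 2) * (x ⬝ᵥ x)) * φ (γ ⬝ᵥ x)) =
        (∫ w in tailSet (rem lam k), cumGen (cumGen lapGen) ((1 / 2) * (w ⬝ᵥ w + lam k ^ 2)) *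
          φ (γ ⬝ᵥ ins k (lam k) w)) +
        γ k * ∫ x in tailSet lam, cumGen (cumGen lapGen) ((1 / 2) * (x ⬝ᵥ x)) *
          deriv φ (γ ⬝ᵥ x) := by
  have hc := continuous_of_absolutelyContinuousOnInterval hφ
  have hbulk' := hbulk
  rw [integrableOn_tailSet_iff lam k] at hbulk'
  simp only [ins_dotProduct_ins] at hbulk'
  simp only [dotProduct_ins] at hbulk'
  set ν := (volume : Measure ({l : ι // l ≠ k} → ℝ)).restrict (tailSet (rem lam k)) with hν
  -- On almost every line: integrability, the integration by parts identity, and an `L¹` bound by a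
  -- face term and an interior term.
  have hfib : ∀ᵐ w ∂ν,
      IntegrableOn (fun s => (s * cumGen lapGen ((1 / 2) * (w ⬝ᵥ w + s ^ 2))) *
          φ (rem γ k ⬝ᵥ w + γ k * s)) (Ioi (lam k)) ∧
        ∫ s in Ioi (lam k), (s * cumGen lapGen ((1 / 2) * (w ⬝ᵥ w + s ^ 2))) *
          φ (rem γ k ⬝ᵥ w + γ k * s) =
          cumGen (cumGen lapGen) ((1 / 2) * (w ⬝ᵥ w + lam k ^ 2)) *
            φ (rem γ k ⬝ᵥ w + γ k * lam k) +
          γ k * ∫ s in Ioi (lam k), cumGen (cumGen lapGen) ((1 / 2) * (w ⬝ᵥ w + s ^ 2)) *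
            deriv φ (rem γ k ⬝ᵥ w + γ k * s) ∧
        ∫ s in Ioi (lam k), |(s * cumGen lapGen ((1 / 2) * (w ⬝ᵥ w + s ^ 2))) *
          φ (rem γ k ⬝ᵥ w + γ k * s)| ≤
          2 * Real.exp |lam k| * |cumGen (cumGen lapGen) ((1 / 2) * (w ⬝ᵥ w + lam k ^ 2)) *
            φ (rem γ k ⬝ᵥ w + γ k * lam k)| +
          2 * Real.exp |lam k| * |γ k| *
            ∫ s in Ioi (lam k), |cumGen (cumGen lapGen) ((1 / 2) * (w ⬝ᵥ w + s ^ 2)) *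
            deriv φ (rem γ k ⬝ᵥ w + γ k * s)| := by
    filter_upwards [hbulk'.prod_right_ae] with w hw
    have hb := dotProduct_self_nonneg w
    have hpos : ∀ t : ℝ, 0 < cumGen (cumGen lapGen) ((1 / 2) * (w ⬝ᵥ w + t ^ 2)) := fun t =>
      isDecayGen_cumGen_cumGen_lapGen.pos _ (by positivity)
    have hpQ := integral_Ioi_id_mul isDecayGen_cumGen_lapGen isDecayGen_cumGen_cumGen_lapGen
      hasDerivAt_cumGen_cumGen_lapGen hb
    obtain ⟨h1, h2, h3⟩ := integral_Ioi_mul_of_primitive (a := lam k)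
      (C := 2 * Real.exp |lam k|)
      (p := fun s => s * cumGen lapGen ((1 / 2) * (w ⬝ᵥ w + s ^ 2)))
      (Q := fun s => cumGen (cumGen lapGen) ((1 / 2) * (w ⬝ᵥ w + s ^ 2)))
      (φ := fun s => φ (rem γ k ⬝ᵥ w + γ k * s))
      (ψ := fun s => γ k * deriv φ (rem γ k ⬝ᵥ w + γ k * s))
      (hpQ _).1 (fun t => (hpos t).le) (fun t ht => integral_Ioi_abs_mul_le hb ht)
      (((measurable_deriv φ).comp (by fun_prop)).const_mul _).aestronglyMeasurable
      ((hw.const_mul (γ k)).congr (Eventually.of_forall fun s => by ring))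
      fun s hs => eq_add_integral_deriv_comp hφ _ _ hs
    refine ⟨h1, ?_, ?_⟩
    · rw [h2, (hpQ _).2, mul_comm (φ _), ← integral_const_mul]
      congr 1
      refine integral_congr_ae (Eventually.of_forall fun s => ?_)
      simp only [(hpQ s).2]
      ring
    · refine h3.trans (le_of_eq ?_)
      rw [abs_mul, abs_of_pos (hpos _), mul_assoc (2 * _) |γ k|, ← integral_const_mul |γ k|]
      congr 1
      · ring
      · congr 1
        refine integral_congr_ae (Eventually.of_forall fun s => ?_)
        simp only [abs_mul]
        ring
  have hmeas : AEStronglyMeasurable (fun p : ({l : ι // l ≠ k} → ℝ) × ℝ =>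
      p.2 * cumGen lapGen ((1 / 2) * (p.1 ⬝ᵥ p.1 + p.2 ^ 2)) *
          φ (rem γ k ⬝ᵥ p.1 + γ k * p.2)) (ν.prod (volume.restrict (Ioi (lam k)))) := by
    have := continuous_cumGen_lapGen
    refine Continuous.aestronglyMeasurable ?_
    unfold dotProduct
    fun_prop
  -- Not a hypothesis: by the fibrewise `L¹` bound the norm integrals over the lines are dominated
  -- by a function of `w` that `hface` and `hbulk` make integrable.
  have hint : IntegrableOn (fun x => x k * (cumGen lapGen ((1 / 2) * (x ⬝ᵥ x)) * φ (γ ⬝ᵥ x)))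
      (tailSet lam) := by
    rw [integrableOn_tailSet_iff lam k]
    simp only [ins_dotProduct_ins]
    simp only [dotProduct_ins, ins_self, ← mul_assoc]
    refine (integrable_prod_iff hmeas).2 ⟨hfib.mono fun w hw => hw.1, ?_⟩
    simp only [dotProduct_ins] at hface
    refine ((hface.abs.const_mul (2 * Real.exp |lam k|)).add
      (hbulk'.norm.integral_prod_left.const_mul
      (2 * Real.exp |lam k| * |γ k|))).mono' hmeas.norm.integral_prod_right' ?_
    filter_upwards [hfib] with w hw
    rw [Real.norm_eq_abs, abs_of_nonneg (integral_nonneg fun s => norm_nonneg _)]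
    exact hw.2.2
  refine ⟨hint, ?_⟩
  rw [setIntegral_tailSet k hint, setIntegral_tailSet k hbulk, ← integral_const_mul,
    ← integral_add hface]
  · refine integral_congr_ae ?_
    filter_upwards [hfib] with w hw
    simp only [ins_dotProduct_ins]
    simp only [dotProduct_ins, ins_self, ← mul_assoc]
    exact hw.2.1
  · simp only [ins_dotProduct_ins]
    simp only [dotProduct_ins]
    exact hbulk'.integral_prod_left.const_mul _

end

/-! ### Integration by parts for the moments of a skewed spherical density -/

section Moments

variable {ι : Type*} [Fintype ι]

theorem IsDecayGen.integrable_mul_skew {G : ℝ → ℝ} (hG : IsDecayGen G) {H : ℝ → ℝ}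
    (hH : Measurable H) (hb : ∀ x, |H x| ≤ 1) {a : ℝ} (ha : 0 ≤ a) (c : ℝ) (γ : ι → ℝ)
    {h : (ι → ℝ) → ℝ} (hm : Measurable h) (hb' : ∀ x, |h x| ≤ (1 + √(x ⬝ᵥ x)) ^ 2) :
    Integrable fun x : ι → ℝ => h x * (G ((1 / 2) * (x ⬝ᵥ x + a)) * H (c + γ ⬝ᵥ x)) := by
  have hG' := hG.shift (show 0 ≤ (1 / 2) * a by positivity)
  have h1 := hG'.integrable_mul (ι := ι) (h := fun x => h x * H (c + γ ⬝ᵥ x))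
    (hm.mul (hH.comp (by unfold dotProduct; fun_prop))).aestronglyMeasurable 1 fun x => by
      rw [abs_mul, one_mul]
      exact (mul_le_of_le_one_right (abs_nonneg _) (hb _)).trans (hb' x)
  refine h1.congr (Eventually.of_forall fun x => ?_)
  simp only [← mul_add]
  ring

theorem abs_coord_le (x : ι → ℝ) (i : ι) : |x i| ≤ (1 + √(x ⬝ᵥ x)) ^ 2 := by
  have := abs_le_sqrt_dotProduct x i
  have := sqrt_nonneg (x ⬝ᵥ x)
  nlinarith

theorem abs_coord_mul_coord_le (x : ι → ℝ) (i j : ι) : |x i * x j| ≤ (1 + √(x ⬝ᵥ x)) ^ 2 := by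
  rw [abs_mul]
  have h1 := mul_le_mul (abs_le_sqrt_dotProduct x i) (abs_le_sqrt_dotProduct x j)
    (abs_nonneg _) (sqrt_nonneg _)
  have := sqrt_nonneg (x ⬝ᵥ x)
  nlinarith

theorem abs_one_le (x : ι → ℝ) : |(1 : ℝ)| ≤ (1 + √(x ⬝ᵥ x)) ^ 2 := by
  have := sqrt_nonneg (x ⬝ᵥ x)
  rw [abs_one]
  nlinarith

variable [DecidableEq ι]

/-- The product rule for `ρ G H` in the coordinate `k`. The weight `ρ` is `1` for first moments and
`x_j` for second moments; the shifts `a` and `c` are there for a second use on the face `x_i = λ_i`,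
where they become `λ_i²` and `γ_i λ_i`. -/
theorem setIntegral_tailSet_by_parts {g G H : ℝ → ℝ} (hd : ∀ u, HasDerivAt G (- g u) u)
    (hH : Differentiable ℝ H) (hb : ∀ x, |H x| ≤ 1) (a c : ℝ) (γ lam : ι → ℝ) (k : ι)
    {ρ ρ' : (ι → ℝ) → ℝ} (hρ : ∀ w s, HasDerivAt (fun s => ρ (ins k s w)) (ρ' (ins k s w)) s)
    (h1 : IntegrableOn (fun x => ρ' x * (G ((1 / 2) * (x ⬝ᵥ x + a)) * H (c + γ ⬝ᵥ x)))
      (tailSet lam))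
    (h2 : IntegrableOn (fun x => ρ x * x k * (g ((1 / 2) * (x ⬝ᵥ x + a)) * H (c + γ ⬝ᵥ x)))
      (tailSet lam))
    (h3 : IntegrableOn (fun x => ρ x * (G ((1 / 2) * (x ⬝ᵥ x + a)) * deriv H (c + γ ⬝ᵥ x)))
      (tailSet lam))
    (hlim : ∀ w, Tendsto (fun s => ρ (ins k s w) * G ((1 / 2) * ((w ⬝ᵥ w + a) + s ^ 2)))
      atTop (𝓝 0)) :
    ∫ x in tailSet lam, ρ x * x k * (g ((1 / 2) * (x ⬝ᵥ x + a)) * H (c + γ ⬝ᵥ x)) =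
      (∫ w in tailSet (rem lam k), ρ (ins k (lam k) w) *
        (G ((1 / 2) * (w ⬝ᵥ w + lam k ^ 2 + a)) * H (c + γ ⬝ᵥ ins k (lam k) w))) +
      (∫ x in tailSet lam, ρ' x * (G ((1 / 2) * (x ⬝ᵥ x + a)) * H (c + γ ⬝ᵥ x))) +
      γ k * ∫ x in tailSet lam,
        ρ x * (G ((1 / 2) * (x ⬝ᵥ x + a)) * deriv H (c + γ ⬝ᵥ x)) := by
  have key := setIntegral_tailSet_of_hasDerivAt (lam := lam) k
    (F := fun x => ρ x * (G ((1 / 2) * (x ⬝ᵥ x + a)) * H (c + γ ⬝ᵥ x)))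
    (D := fun x => ρ' x * (G ((1 / 2) * (x ⬝ᵥ x + a)) * H (c + γ ⬝ᵥ x)) -
      ρ x * x k * (g ((1 / 2) * (x ⬝ᵥ x + a)) * H (c + γ ⬝ᵥ x)) +
      γ k * (ρ x * (G ((1 / 2) * (x ⬝ᵥ x + a)) * deriv H (c + γ ⬝ᵥ x))))
    ((h1.sub h2).add (h3.const_mul _)) (fun w s => ?_) (fun w => ?_)
  · have e : ∫ x in tailSet lam, (ρ' x * (G ((1 / 2) * (x ⬝ᵥ x + a)) * H (c + γ ⬝ᵥ x)) -
        ρ x * x k * (g ((1 / 2) * (x ⬝ᵥ x + a)) * H (c + γ ⬝ᵥ x)) +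
        γ k * (ρ x * (G ((1 / 2) * (x ⬝ᵥ x + a)) * deriv H (c + γ ⬝ᵥ x)))) =
        (∫ x in tailSet lam, ρ' x * (G ((1 / 2) * (x ⬝ᵥ x + a)) * H (c + γ ⬝ᵥ x))) -
        (∫ x in tailSet lam, ρ x * x k * (g ((1 / 2) * (x ⬝ᵥ x + a)) * H (c + γ ⬝ᵥ x))) +
        γ k * ∫ x in tailSet lam,
          ρ x * (G ((1 / 2) * (x ⬝ᵥ x + a)) * deriv H (c + γ ⬝ᵥ x)) := by
      rw [← integral_const_mul, ← integral_sub h1 h2]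
      exact integral_add (h1.sub h2) (h3.const_mul _)
    rw [e] at key
    simp only [ins_dotProduct_ins] at key ⊢
    linarith
  · simp only [ins_dotProduct_ins, ins_self]
    simp only [dotProduct_ins]
    have e1 : HasDerivAt (fun s : ℝ => G ((1 / 2) * (w ⬝ᵥ w + s ^ 2 + a)))
        (- (s * g ((1 / 2) * (w ⬝ᵥ w + s ^ 2 + a)))) s := by
      have := hasDerivAt_half_add_sq hd (w ⬝ᵥ w + a) s
      simpa only [add_right_comm _ a] using this
    have e2 : HasDerivAt (fun s : ℝ => H (c + (rem γ k ⬝ᵥ w + γ k * s)))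
        (deriv H (c + (rem γ k ⬝ᵥ w + γ k * s)) * γ k) s := by
      refine (hH _).hasDerivAt.comp s ?_
      refine ((((hasDerivAt_id s).const_mul (γ k)).const_add _).const_add c).congr_deriv ?_
      simp
    refine ((hρ w s).mul (e1.mul e2)).congr_deriv ?_
    simp only [Pi.mul_apply]
    ring
  -- Since `|H| ≤ 1`, the boundary term at infinity vanishes as soon as `ρ G` does.
  · have : Tendsto (fun s => |ρ (ins k s w) * G ((1 / 2) * ((w ⬝ᵥ w + a) + s ^ 2))|)
      atTop (𝓝 0) := by simpa using (hlim w).abs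
    refine squeeze_zero_norm (fun s => ?_) this
    simp only [ins_dotProduct_ins, Real.norm_eq_abs]
    rw [← mul_assoc, abs_mul, add_right_comm]
    exact mul_le_of_le_one_right (abs_nonneg _) (hb _)

/-- Integration by parts for the first moment. -/
theorem setIntegral_tailSet_coord {g G H : ℝ → ℝ} (hg : IsDecayGen g) (hG : IsDecayGen G)
    (hd : ∀ u, HasDerivAt G (- g u) u)
    (hH : Differentiable ℝ H) (hb : ∀ x, |H x| ≤ 1) {a : ℝ} (ha : 0 ≤ a) (c : ℝ)
    (γ lam : ι → ℝ) (k : ι)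
    (h : IntegrableOn (fun x => G ((1 / 2) * (x ⬝ᵥ x + a)) * deriv H (c + γ ⬝ᵥ x))
      (tailSet lam)) :
    ∫ x in tailSet lam, x k * (g ((1 / 2) * (x ⬝ᵥ x + a)) * H (c + γ ⬝ᵥ x)) =
      (∫ w in tailSet (rem lam k),
        G ((1 / 2) * (w ⬝ᵥ w + lam k ^ 2 + a)) * H (c + γ ⬝ᵥ ins k (lam k) w)) +
      γ k * ∫ x in tailSet lam, G ((1 / 2) * (x ⬝ᵥ x + a)) * deriv H (c + γ ⬝ᵥ x) := by
  have := setIntegral_tailSet_by_parts hd hH hb a c γ lam k (ρ := fun _ => 1) (ρ' := fun _ => 0)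
    (fun w s => hasDerivAt_const s 1) (by simp)
    (by
      simp only [one_mul]
      exact (hg.integrable_mul_skew hH.continuous.measurable hb ha c γ (by fun_prop)
        fun x => abs_coord_le x k).integrableOn)
    (by simpa using h) (fun w => by simpa using hG.tendsto_half_add_sq (w ⬝ᵥ w + a))
  simpa using this

/-- The boundary term at infinity for the weight `ρ = x_k`: `s` is at most `r = √(b + s²)`, and a
cubic in `r` loses to `exp(-r)`. -/
theorem IsDecayGen.tendsto_id_mul_half_add_sq {G : ℝ → ℝ} (hG : IsDecayGen G) {b : ℝ}
    (hb : 0 ≤ b) : Tendsto (fun s : ℝ => s * G ((1 / 2) * (b + s ^ 2))) atTop (𝓝 0) := by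
  have h : Tendsto (fun r : ℝ => r * (3 * (1 + r) ^ 2 * Real.exp (-r))) atTop (𝓝 0) := by
    have := (((tendsto_pow_mul_exp_neg 1).const_mul 3).add
      ((tendsto_pow_mul_exp_neg 2).const_mul 6)).add ((tendsto_pow_mul_exp_neg 3).const_mul 3)
    simp only [add_zero, mul_zero] at this
    exact this.congr fun r => by ring
  have h' : Tendsto (fun s : ℝ => √(2 * ((1 / 2) * (b + s ^ 2)))) atTop atTop :=
    tendsto_sqrt_two_mul_atTop.comp (Tendsto.const_mul_atTop (by norm_num)
      (tendsto_atTop_add_const_left _ b (tendsto_pow_atTop two_ne_zero)))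
  refine squeeze_zero' (eventually_atTop.2 ⟨0, fun s hs =>
    mul_nonneg hs (hG.pos _ (by positivity)).le⟩) (eventually_atTop.2 ⟨0, fun s hs => ?_⟩)
    (h.comp h')
  refine mul_le_mul ?_ (hG.bound _ (by positivity)) (hG.pos _ (by positivity)).le (sqrt_nonneg _)
  exact le_sqrt_of_sq_le (by linarith)

/-- Integration by parts for the second moments. -/
theorem setIntegral_tailSet_coord_mul_coord {g G H : ℝ → ℝ} (hg : IsDecayGen g)
    (hG : IsDecayGen G) (hd : ∀ u, HasDerivAt G (- g u) u)
    (hH : Differentiable ℝ H) (hb : ∀ x, |H x| ≤ 1) (γ lam : ι → ℝ) (i j : ι)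
    (h : IntegrableOn (fun x => x j * (G ((1 / 2) * (x ⬝ᵥ x)) * deriv H (γ ⬝ᵥ x)))
      (tailSet lam)) :
    ∫ x in tailSet lam, x j * x i * (g ((1 / 2) * (x ⬝ᵥ x)) * H (γ ⬝ᵥ x)) =
      (∫ w in tailSet (rem lam i), ins i (lam i) w j *
        (G ((1 / 2) * (w ⬝ᵥ w + lam i ^ 2)) * H (γ ⬝ᵥ ins i (lam i) w))) +
      (if j = i then ∫ x in tailSet lam, G ((1 / 2) * (x ⬝ᵥ x)) * H (γ ⬝ᵥ x) else 0) +
      γ i * ∫ x in tailSet lam, x j * (G ((1 / 2) * (x ⬝ᵥ x)) * deriv H (γ ⬝ᵥ x)) := by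
  have := setIntegral_tailSet_by_parts hd hH hb 0 0 γ lam i (ρ := fun x => x j)
    (ρ' := fun _ => if j = i then 1 else 0)
    (fun w s => ?_)
    ((hG.integrable_mul_skew hH.continuous.measurable hb le_rfl 0 γ (by fun_prop)
        fun x => ?_).integrableOn)
    ((hg.integrable_mul_skew hH.continuous.measurable hb le_rfl 0 γ (by fun_prop)
        fun x => abs_coord_mul_coord_le x j i).integrableOn)
    (by simpa using h) (fun w => ?_)
  · simp only [add_zero, zero_add] at this
    rw [this]
    split_ifs <;> simp
  · by_cases hj : j = i
    · subst hj
      simpa using! hasDerivAt_id' s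
    · simp only [ins_of_ne hj, if_neg hj]
      exact hasDerivAt_const _ _
  · refine le_trans ?_ (abs_one_le x)
    split_ifs <;> simp
  · by_cases hj : j = i
    · subst hj
      simpa using hG.tendsto_id_mul_half_add_sq (dotProduct_self_nonneg w)
    · simp only [ins_of_ne hj]
      simpa using (hG.tendsto_half_add_sq (w ⬝ᵥ w + 0)).const_mul (w ⟨j, hj⟩)

end Moments

/-! ### Removing two coordinates -/

section Two

variable {n : ℕ}

/-- Removing `i` and then `j` is removing `i` and `j`. -/
def removeEquiv {i j : Fin n} (hj : j ≠ i) :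
    {l : {l : Fin n // l ≠ i} // l ≠ ⟨j, hj⟩} ≃ {l : Fin n // l ≠ i ∧ l ≠ j} where
  toFun l := ⟨l.1.1, l.1.2, fun h => l.2 (Subtype.ext h)⟩
  invFun l := ⟨⟨l.1, l.2.1⟩, fun h => l.2.2 (congrArg Subtype.val h)⟩
  left_inv _ := rfl
  right_inv _ := rfl

/-- Two successive faces produce a nested subtype, whereas `U` lives on a single one; reindexing the
coordinates preserves volume, the squared norm and the reassembled vector. -/
theorem setIntegral_drop₂ (lam : Fin n → ℝ) {i j : Fin n} (hj : j ≠ i)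
    (f : ℝ → (Fin n → ℝ) → ℝ) :
    ∫ u in tailSet (rem (rem lam i) ⟨j, hj⟩),
      f (u ⬝ᵥ u) (ins i (lam i) (ins ⟨j, hj⟩ (lam j) u)) =
    ∫ u in tailSet (drop₂ lam i j), f (u ⬝ᵥ u) (put₂ lam i j u) := by
  have hmp := volume_measurePreserving_piCongrLeft (fun _ => ℝ) (removeEquiv hj)
  have happ : ∀ u l, MeasurableEquiv.piCongrLeft (fun _ => ℝ) (removeEquiv hj) u
      (removeEquiv hj l) = u l := fun u l =>
    Equiv.piCongrLeft_apply_apply (fun _ => ℝ) (removeEquiv hj) u l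
  have hpre : MeasurableEquiv.piCongrLeft (fun _ => ℝ) (removeEquiv hj) ⁻¹'
      tailSet (drop₂ lam i j) = tailSet (rem (rem lam i) ⟨j, hj⟩) := by
    ext u
    simp only [mem_preimage, tailSet, mem_ofPred_eq]
    rw [← (removeEquiv hj).forall_congr_right]
    simp only [happ]
    rfl
  rw [← hmp.setIntegral_preimage_emb (MeasurableEquiv.measurableEmbedding _), hpre]
  refine integral_congr_ae (Eventually.of_forall fun u => ?_)
  dsimp only
  congr 1
  · simp only [dotProduct]
    rw [← (removeEquiv hj).sum_comp]
    simp only [happ]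
  · ext l
    by_cases hi : l = i
    · subst hi; simp [put₂]
    by_cases hlj : l = j
    · subst hlj; rw [ins_of_ne hi, ins_self]; simp [put₂]
    · have hne : (⟨l, hi⟩ : {l : Fin n // l ≠ i}) ≠ ⟨j, hj⟩ := fun h =>
        hlj (congrArg Subtype.val h)
      rw [ins_of_ne hi, ins_of_ne hne, put₂, dif_pos ⟨hi, hlj⟩]
      exact (happ u ⟨⟨l, hi⟩, hne⟩).symm

end Two

/-! ### Tail moments in terms of the lower dimensional tail expectations -/

section TailMoments

variable {n : ℕ}

theorem standardize_zero_one (x : Fin n → ℝ) : standardize 0 1 x = x := by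
  simp [standardize]

theorem ellDensity_zero_one (g : ℝ → ℝ) (x : Fin n → ℝ) :
    ellDensity 0 1 g x = sphDensity g x := by
  simp [ellDensity, sphDensity]

theorem gseDensity_zero_one (g : ℝ → ℝ) (H : (Fin n → ℝ) → ℝ) (x : Fin n → ℝ) :
    gseDensity 0 1 g H x = 2 * normConst n g * (g ((1 / 2) * (x ⬝ᵥ x)) * H x) := by
  rw [gseDensity, standardize_zero_one, ellDensity_zero_one, sphDensity, Fintype.card_fin]
  ring

variable (lam : Fin n → ℝ)

theorem put_eq_ins (k : Fin n) (w : {l : Fin n // l ≠ k} → ℝ) :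
    put lam k w = ins k (lam k) w := by
  ext l
  by_cases h : l = k <;> simp [put, ins, h]

theorem genW_apply (g : ℝ → ℝ) (k : Fin n) (r : ℝ) :
    genW g lam k ((1 / 2) * r) = cumGen g ((1 / 2) * (r + lam k ^ 2)) := by
  rw [genW, mul_add]

theorem genV_apply (g : ℝ → ℝ) (k : Fin n) (r : ℝ) :
    genV g lam k ((1 / 2) * r) = cumGen (cumGen g) ((1 / 2) * (r + lam k ^ 2)) := by
  rw [genV, mul_add]

/-- The squares appear in the order produced by removing the coordinate `i` first and `j` second. -/
theorem genU_apply (g : ℝ → ℝ) (i j : Fin n) (r : ℝ) :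
    genU g lam i j ((1 / 2) * r) =
      cumGen (cumGen g) ((1 / 2) * (r + lam j ^ 2 + lam i ^ 2)) := by
  rw [genU, mul_add, mul_add, add_right_comm]

/-- The quotient of constants only undoes the normalization of the reduced density, leaving the
unnormalized face integral that integration by parts produces. The same holds for `V` and `U` below.
-/
theorem div_constW_mul_tailExp (c : ℝ) (k : Fin n) (h : ({l : Fin n // l ≠ k} → ℝ) → ℝ) :
    c / constW lapGen lam k * tailExp (densW lapGen lam k) (drop lam k) h =
      c * ∫ w in tailSet (rem lam k), cumGen lapGen ((1 / 2) * (w ⬝ᵥ w + lam k ^ 2)) * h w := by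
  have hc : constW lapGen lam k ≠ 0 := ((isDecayGen_genW lam k).normConst_pos _).ne'
  have : tailExp (densW lapGen lam k) (drop lam k) h = constW lapGen lam k *
      ∫ w in tailSet (rem lam k), cumGen lapGen ((1 / 2) * (w ⬝ᵥ w + lam k ^ 2)) * h w := by
    rw [tailExp, ← integral_const_mul]
    refine integral_congr_ae (Eventually.of_forall fun w => ?_)
    simp only [densW, genW_apply]
    ring
  rw [this]
  field_simp

theorem div_constV_mul_tailExp (c : ℝ) (k : Fin n) (h : ({l : Fin n // l ≠ k} → ℝ) → ℝ) :
    c / constV lapGen lam k * tailExp (densV lapGen lam k) (drop lam k) h =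
      c * ∫ w in tailSet (rem lam k),
        cumGen (cumGen lapGen) ((1 / 2) * (w ⬝ᵥ w + lam k ^ 2)) * h w := by
  have hc : constV lapGen lam k ≠ 0 := ((isDecayGen_genV lam k).normConst_pos _).ne'
  have : tailExp (densV lapGen lam k) (drop lam k) h = constV lapGen lam k *
      ∫ w in tailSet (rem lam k),
        cumGen (cumGen lapGen) ((1 / 2) * (w ⬝ᵥ w + lam k ^ 2)) * h w := by
    rw [tailExp, ← integral_const_mul]
    refine integral_congr_ae (Eventually.of_forall fun w => ?_)
    simp only [densV, genV_apply]
    ring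
  rw [this]
  field_simp

theorem div_constU_mul_tailExp (c : ℝ) (i j : Fin n)
    (h : ({l : Fin n // l ≠ i ∧ l ≠ j} → ℝ) → ℝ) :
    c / constU lapGen lam i j * tailExp (densU lapGen lam i j) (drop₂ lam i j) h =
      c * ∫ u in tailSet (drop₂ lam i j),
        cumGen (cumGen lapGen) ((1 / 2) * (u ⬝ᵥ u + lam j ^ 2 + lam i ^ 2)) * h u := by
  have hc : constU lapGen lam i j ≠ 0 := ((isDecayGen_genU lam i j).normConst_pos _).ne'
  have : tailExp (densU lapGen lam i j) (drop₂ lam i j) h = constU lapGen lam i j *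
      ∫ u in tailSet (drop₂ lam i j),
        cumGen (cumGen lapGen) ((1 / 2) * (u ⬝ᵥ u + lam j ^ 2 + lam i ^ 2)) * h u := by
    rw [tailExp, ← integral_const_mul]
    refine integral_congr_ae (Eventually.of_forall fun u => ?_)
    simp only [densU, genU_apply]
    ring
  rw [this]
  field_simp

theorem tailExp_sphDensity (g : ℝ → ℝ) (h : (Fin n → ℝ) → ℝ) :
    tailExp (sphDensity g) lam h =
      normConst n g * ∫ x in tailSet lam, g ((1 / 2) * (x ⬝ᵥ x)) * h x := by
  rw [tailExp, ← integral_const_mul]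
  refine integral_congr_ae (Eventually.of_forall fun x => ?_)
  simp only [sphDensity, Fintype.card_fin]
  ring

/-- Explains the weight `1 + √(MᵀM)`: it turns a tail expectation under `M` into an integral against
the first cumulative generator. -/
theorem cumGen_lapGen_half (x : Fin n → ℝ) :
    cumGen lapGen ((1 / 2) * (x ⬝ᵥ x)) = (1 + √(x ⬝ᵥ x)) * lapGen ((1 / 2) * (x ⬝ᵥ x)) := by
  have := dotProduct_self_nonneg x
  rw [cumGen_lapGen (by positivity), lapGen, show 2 * (1 / 2 * (x ⬝ᵥ x)) = x ⬝ᵥ x by ring]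

variable {lam} {γ : Fin n → ℝ} {H : ℝ → ℝ}

theorem IsSkewing.abs_le_one (h : IsSkewing H) (x : ℝ) : |H x| ≤ 1 := by
  rw [abs_of_nonneg (h.1 x).1]
  exact (h.1 x).2

theorem hasTailExp_densV_iff {k : Fin n} {h : ({l : Fin n // l ≠ k} → ℝ) → ℝ} :
    HasTailExp (densV lapGen lam k) (drop lam k) h ↔
      IntegrableOn (fun w => cumGen (cumGen lapGen) ((1 / 2) * (w ⬝ᵥ w + lam k ^ 2)) * h w)
        (tailSet (rem lam k)) := by
  have hc : constV lapGen lam k ≠ 0 := ((isDecayGen_genV lam k).normConst_pos _).ne'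
  have : (fun w => h w * densV lapGen lam k w) = fun w => constV lapGen lam k *
      (cumGen (cumGen lapGen) ((1 / 2) * (w ⬝ᵥ w + lam k ^ 2)) * h w) := by
    ext w
    simp only [densV, genV_apply]
    ring
  rw [HasTailExp, this]
  exact integrable_const_mul_iff (isUnit_iff_ne_zero.2 hc) _

theorem hasTailExp_sphDensity_iff {g : ℝ → ℝ} (hg : IsDecayGen g) {h : (Fin n → ℝ) → ℝ} :
    HasTailExp (sphDensity g) lam h ↔
      IntegrableOn (fun x => g ((1 / 2) * (x ⬝ᵥ x)) * h x) (tailSet lam) := by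
  have : (fun x => h x * sphDensity g x) = fun x => normConst n g *
      (g ((1 / 2) * (x ⬝ᵥ x)) * h x) := by
    ext x
    simp only [sphDensity, Fintype.card_fin]
    ring
  rw [HasTailExp, this]
  exact integrable_const_mul_iff (isUnit_iff_ne_zero.2 (hg.normConst_pos n).ne') _

/-- The first tail moments. -/
theorem setIntegral_coord_mul_gseDensity (hs : IsSkewing H) (hH : Differentiable ℝ H)
    (hM : HasTailExp (sphDensity lapGen) lam
        (fun m => (1 + √(m ⬝ᵥ m)) * deriv H (γ ⬝ᵥ m))) (k : Fin n) :
    ∫ x in tailSet lam, x k * gseDensity 0 1 lapGen (fun z => H (γ ⬝ᵥ z)) x =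
      2 * (normConst n lapGen / constW lapGen lam k *
              tailExp (densW lapGen lam k) (drop lam k)
                (fun w => H (γ ⬝ᵥ put lam k w))
            + γ k * tailExp (sphDensity lapGen) lam
                (fun m => (1 + √(m ⬝ᵥ m)) * deriv H (γ ⬝ᵥ m))) := by
  rw [hasTailExp_sphDensity_iff isDecayGen_lapGen] at hM
  have e : ∀ x : Fin n → ℝ, lapGen ((1 / 2) * (x ⬝ᵥ x)) * ((1 + √(x ⬝ᵥ x)) * deriv H (γ ⬝ᵥ x)) =
      cumGen lapGen ((1 / 2) * (x ⬝ᵥ x)) * deriv H (γ ⬝ᵥ x) := fun x => by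
    rw [cumGen_lapGen_half]; ring
  simp only [e] at hM
  have key := setIntegral_tailSet_coord isDecayGen_lapGen isDecayGen_cumGen_lapGen
    hasDerivAt_cumGen_lapGen hH hs.abs_le_one le_rfl 0 γ lam k (by simpa using hM)
  simp only [add_zero, zero_add] at key
  rw [div_constW_mul_tailExp, tailExp_sphDensity]
  simp only [e, gseDensity_zero_one]
  have : ∀ x : Fin n → ℝ, x k * (2 * normConst n lapGen *
      (lapGen ((1 / 2) * (x ⬝ᵥ x)) * H (γ ⬝ᵥ x))) = 2 * normConst n lapGen *
      (x k * (lapGen ((1 / 2) * (x ⬝ᵥ x)) * H (γ ⬝ᵥ x))) := fun x => by ring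
  simp only [this]
  rw [integral_const_mul, key]
  simp only [put_eq_ins]
  ring

/-- The part common to diagonal and off-diagonal entries. The face integral on `x_i = λ_i` is left
unevaluated because its treatment depends on whether `i = j`. -/
theorem setIntegral_coord_mul_coord_mul_gseDensity (hs : IsSkewing H) (hH : Differentiable ℝ H)
    (hAC : ∀ a b : ℝ, AbsolutelyContinuousOnInterval (deriv H) a b)
    (hV : ∀ k, HasTailExp (densV lapGen lam k) (drop lam k)
        fun v => deriv H (γ ⬝ᵥ put lam k v))
    (hX : HasTailExp (sphDensity (cumGen (cumGen lapGen))) lam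
        (fun x => deriv (deriv H) (γ ⬝ᵥ x))) (hn : 1 ≤ n) (i j : Fin n) :
    ∫ x in tailSet lam, x i * x j * gseDensity 0 1 lapGen (fun z => H (γ ⬝ᵥ z)) x =
      2 * normConst n lapGen * (∫ w in tailSet (rem lam i), ins i (lam i) w j *
        (cumGen lapGen ((1 / 2) * (w ⬝ᵥ w + lam i ^ 2)) * H (γ ⬝ᵥ ins i (lam i) w))) +
      2 * normConst n lapGen * (if j = i then
        ∫ x in tailSet lam, cumGen lapGen ((1 / 2) * (x ⬝ᵥ x)) * H (γ ⬝ᵥ x) else 0) +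
      2 * (normConst n lapGen / constV lapGen lam j * γ i *
              tailExp (densV lapGen lam j) (drop lam j)
                (fun v => deriv H (γ ⬝ᵥ put lam j v)) +
        (n + 3) * (n + 1) * γ i * γ j *
              tailExp (sphDensity (cumGen (cumGen lapGen))) lam
                (fun x => deriv (deriv H) (γ ⬝ᵥ x))) := by
  have hface := hasTailExp_densV_iff.1 (hV j)
  simp only [put_eq_ins] at hface
  have hbulk := (hasTailExp_sphDensity_iff isDecayGen_cumGen_cumGen_lapGen).1 hX
  -- The integration by parts in `x_j` is done first: it supplies the integrability of `x_j G H'`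
  -- that the one in `x_i` requires.
  obtain ⟨hint, heq⟩ := setIntegral_tailSet_coord_mul hAC γ lam j hface hbulk
  have key := setIntegral_tailSet_coord_mul_coord isDecayGen_lapGen isDecayGen_cumGen_lapGen
    hasDerivAt_cumGen_lapGen hH hs.abs_le_one γ lam i j hint
  rw [heq] at key
  rw [mul_right_comm _ (γ i) (tailExp (densV lapGen lam j) _ _), div_constV_mul_tailExp, tailExp_sphDensity]
  simp only [gseDensity_zero_one]
  have : ∀ x : Fin n → ℝ, x i * x j * (2 * normConst n lapGen *
      (lapGen ((1 / 2) * (x ⬝ᵥ x)) * H (γ ⬝ᵥ x))) = 2 * normConst n lapGen *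
      (x j * x i * (lapGen ((1 / 2) * (x ⬝ᵥ x)) * H (γ ⬝ᵥ x))) := fun x => by ring
  simp only [this]
  rw [integral_const_mul, key, normConst_lapGen_eq_mul_cumGen_cumGen hn]
  simp only [put_eq_ins]
  ring

/-- The mixed second tail moments. -/
theorem setIntegral_mixed_mul_gseDensity (hs : IsSkewing H) (hH : Differentiable ℝ H)
    (hAC : ∀ a b : ℝ, AbsolutelyContinuousOnInterval (deriv H) a b)
    (hV : ∀ k, HasTailExp (densV lapGen lam k) (drop lam k)
        fun v => deriv H (γ ⬝ᵥ put lam k v))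
    (hX : HasTailExp (sphDensity (cumGen (cumGen lapGen))) lam
        (fun x => deriv (deriv H) (γ ⬝ᵥ x))) (hn : 1 ≤ n) {i j : Fin n} (hij : i ≠ j) :
    ∫ x in tailSet lam, x i * x j * gseDensity 0 1 lapGen (fun z => H (γ ⬝ᵥ z)) x =
      2 * (normConst n lapGen / constU lapGen lam i j *
              tailExp (densU lapGen lam i j) (drop₂ lam i j)
                (fun u => H (γ ⬝ᵥ put₂ lam i j u))
            + normConst n lapGen / constV lapGen lam i * γ j *
              tailExp (densV lapGen lam i) (drop lam i)
                (fun v => deriv H (γ ⬝ᵥ put lam i v))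
            + normConst n lapGen / constV lapGen lam j * γ i *
              tailExp (densV lapGen lam j) (drop lam j)
                (fun v => deriv H (γ ⬝ᵥ put lam j v))
            + (n + 3) * (n + 1) * γ i * γ j *
              tailExp (sphDensity (cumGen (cumGen lapGen))) lam
                (fun x => deriv (deriv H) (γ ⬝ᵥ x))) := by
  rw [setIntegral_coord_mul_coord_mul_gseDensity hs hH hAC hV hX hn, if_neg hij.symm]
  have hface := hasTailExp_densV_iff.1 (hV i)
  simp only [put_eq_ins, dotProduct_ins, add_comm _ (γ i * lam i)] at hface
  -- The face integral is a first moment in dimension `n - 1` for the generator `G` shifted by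
  -- `λ_i²`; one more integration by parts, in `x_j`, reaches the second cumulative generator.
  have key := setIntegral_tailSet_coord isDecayGen_cumGen_lapGen isDecayGen_cumGen_cumGen_lapGen
    hasDerivAt_cumGen_cumGen_lapGen hH hs.abs_le_one (sq_nonneg (lam i)) (γ i * lam i)
    (rem γ i) (rem lam i) ⟨j, hij.symm⟩ hface
  have e : ∀ w, γ i * lam i + rem γ i ⬝ᵥ w = γ ⬝ᵥ ins i (lam i) w := fun w => by
    rw [dotProduct_ins, add_comm]
  simp only [e] at key
  have hU := setIntegral_drop₂ lam hij.symm
    (fun r x => cumGen (cumGen lapGen) ((1 / 2) * (r + lam j ^ 2 + lam i ^ 2)) * H (γ ⬝ᵥ x))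
  have key' : ∫ w in tailSet (rem lam i), ins i (lam i) w j *
        (cumGen lapGen ((1 / 2) * (w ⬝ᵥ w + lam i ^ 2)) * H (γ ⬝ᵥ ins i (lam i) w)) =
      (∫ u in tailSet (drop₂ lam i j), cumGen (cumGen lapGen)
        ((1 / 2) * (u ⬝ᵥ u + lam j ^ 2 + lam i ^ 2)) * H (γ ⬝ᵥ put₂ lam i j u)) +
      γ j * ∫ w in tailSet (rem lam i), cumGen (cumGen lapGen)
        ((1 / 2) * (w ⬝ᵥ w + lam i ^ 2)) * deriv H (γ ⬝ᵥ ins i (lam i) w) := by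
    rw [← hU]
    simp only [ins_of_ne hij.symm]
    exact key
  rw [key', div_constU_mul_tailExp, mul_right_comm _ (γ j) (tailExp (densV lapGen lam i) _ _),
    div_constV_mul_tailExp lam _ i]
  simp only [put_eq_ins]
  ring

theorem tailFn_gseDensity_cumGen (hn : 1 ≤ n) (H : (Fin n → ℝ) → ℝ) :
    (n + 1) * tailFn (gseDensity 0 1 (cumGen lapGen) H) lam =
      2 * normConst n lapGen *
        ∫ x in tailSet lam, cumGen lapGen ((1 / 2) * (x ⬝ᵥ x)) * H x := by
  simp only [tailFn, gseDensity_zero_one, integral_const_mul]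
  rw [normConst_lapGen_eq_mul_cumGen hn]
  ring

/-- The second tail moments of one coordinate. -/
theorem setIntegral_sq_mul_gseDensity (hs : IsSkewing H) (hH : Differentiable ℝ H)
    (hAC : ∀ a b : ℝ, AbsolutelyContinuousOnInterval (deriv H) a b)
    (hV : ∀ k, HasTailExp (densV lapGen lam k) (drop lam k)
        fun v => deriv H (γ ⬝ᵥ put lam k v))
    (hX : HasTailExp (sphDensity (cumGen (cumGen lapGen))) lam
        (fun x => deriv (deriv H) (γ ⬝ᵥ x))) (hn : 1 ≤ n) (i : Fin n) :
    ∫ x in tailSet lam, x i * x i * gseDensity 0 1 lapGen (fun z => H (γ ⬝ᵥ z)) x =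
      2 * (normConst n lapGen / constW lapGen lam i * lam i *
              tailExp (densW lapGen lam i) (drop lam i)
                (fun w => H (γ ⬝ᵥ put lam i w))
            + normConst n lapGen / constV lapGen lam i * γ i *
              tailExp (densV lapGen lam i) (drop lam i)
                (fun v => deriv H (γ ⬝ᵥ put lam i v))
            + (n + 3) * (n + 1) * γ i ^ 2 *
              tailExp (sphDensity (cumGen (cumGen lapGen))) lam
                (fun x => deriv (deriv H) (γ ⬝ᵥ x))) +
        (n + 1) * tailFn (gseDensity 0 1 (cumGen lapGen) fun z => H (γ ⬝ᵥ z)) lam := by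
  rw [setIntegral_coord_mul_coord_mul_gseDensity hs hH hAC hV hX hn, if_pos rfl,
    tailFn_gseDensity_cumGen hn, mul_right_comm _ (lam i) (tailExp _ _ _),
    div_constW_mul_tailExp]
  -- On the face `x_i = λ_i` the remaining factor `x_i` is the constant `λ_i`.
  simp only [ins_self, integral_const_mul, put_eq_ins]
  ring

end TailMoments

/-! ### Standardization -/

section Standardize

variable {n : ℕ}

/-- Change of variables: Lebesgue measure is `|det M|` times its own image under `z ↦ M z + μ`. -/
theorem map_lawOf_affine {M : Matrix (Fin n) (Fin n) ℝ} (hM : M.det ≠ 0) (μ : Fin n → ℝ)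
    {f : (Fin n → ℝ) → ℝ} (hf : Measurable f) :
    (lawOf f).map (fun y => M⁻¹ *ᵥ (y - μ)) = lawOf fun z => |M.det| * f (M *ᵥ z + μ) := by
  have hmv : ∀ N : Matrix (Fin n) (Fin n) ℝ, Measurable fun z : Fin n → ℝ => N *ᵥ z :=
    fun N => (Continuous.matrix_mulVec continuous_const continuous_id).measurable
  have hstd : Measurable fun y : Fin n → ℝ => M⁻¹ *ᵥ (y - μ) :=
    (hmv _).comp (measurable_id.sub_const μ)
  have hT : Measurable fun z : Fin n → ℝ => M *ᵥ z + μ := (hmv M).add_const μ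
  have hvol : (volume : Measure (Fin n → ℝ)) =
      ENNReal.ofReal |M.det| • volume.map fun z => M *ᵥ z + μ := by
    have h1 := Real.map_matrix_volume_pi_eq_smul_volume_pi hM
    have h2 : volume.map (fun z => M *ᵥ z + μ) =
        (volume.map (toLin' M)).map (fun z => z + μ) :=
      (Measure.map_map (g := fun z => z + μ) (by fun_prop) (hmv M : Measurable (toLin' M))).symm
    rw [h2, h1, Measure.map_smul, map_add_right_eq_self, smul_smul,
      ← ENNReal.ofReal_mul (abs_nonneg _), ← abs_mul, mul_inv_cancel₀ hM]
    simp
  ext s hs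
  have hdet : IsUnit M.det := isUnit_iff_ne_zero.2 hM
  rw [Measure.map_apply hstd hs, lawOf, lawOf, withDensity_apply _ (hstd hs),
    withDensity_apply _ hs, hvol, Measure.restrict_smul, lintegral_smul_measure,
    setLIntegral_map (hstd hs) (by fun_prop) hT, ← hvol]
  have hpre : (fun z => M *ᵥ z + μ) ⁻¹' ((fun y => M⁻¹ *ᵥ (y - μ)) ⁻¹' s) = s := by
    ext z
    simp [mulVec_mulVec, nonsing_inv_mul _ hdet]
  rw [hpre, smul_eq_mul, ← lintegral_const_mul _ (by fun_prop)]
  simp only [ENNReal.ofReal_mul (abs_nonneg _)]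

variable {Sg : Matrix (Fin n) (Fin n) ℝ}

theorem sqrt_mul_sqrt (hSg : Sg.PosDef) : CFC.sqrt Sg * CFC.sqrt Sg = Sg :=
  CFC.sqrt_mul_sqrt_self Sg hSg.posSemidef.nonneg

theorem sqrt_transpose (Sg : Matrix (Fin n) (Fin n) ℝ) : (CFC.sqrt Sg)ᵀ = CFC.sqrt Sg := by
  have := (CFC.sqrt_nonneg Sg).posSemidef.isHermitian
  simpa [IsHermitian, conjTranspose_eq_transpose_of_trivial] using this

theorem det_sqrt_ne_zero (hSg : Sg.PosDef) : (CFC.sqrt Sg).det ≠ 0 := fun h => by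
  have := hSg.det_pos
  rw [← sqrt_mul_sqrt hSg, det_mul, h] at this
  simp at this

theorem abs_det_sqrt (hSg : Sg.PosDef) : |(CFC.sqrt Sg).det| = √Sg.det := by
  conv_rhs => rw [← sqrt_mul_sqrt hSg, det_mul]
  rw [sqrt_mul_self_eq_abs]

theorem sqrt_mulVec_standardize (hSg : Sg.PosDef) (μ y : Fin n → ℝ) :
    CFC.sqrt Sg *ᵥ standardize μ Sg y + μ = y := by
  rw [standardize, mulVec_mulVec, mul_nonsing_inv _ (isUnit_iff_ne_zero.2 (det_sqrt_ne_zero hSg)),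
    one_mulVec, sub_add_cancel]

theorem standardize_sqrt_mulVec (hSg : Sg.PosDef) (μ z : Fin n → ℝ) :
    standardize μ Sg (CFC.sqrt Sg *ᵥ z + μ) = z := by
  rw [standardize, add_sub_cancel_right, mulVec_mulVec,
    nonsing_inv_mul _ (isUnit_iff_ne_zero.2 (det_sqrt_ne_zero hSg)), one_mulVec]

theorem measurable_standardize (μ : Fin n → ℝ) (Sg : Matrix (Fin n) (Fin n) ℝ) :
    Measurable (standardize μ Sg) :=
  (Continuous.matrix_mulVec continuous_const (continuous_id.sub continuous_const)).measurable

theorem measurable_gseDensity {g : ℝ → ℝ} (hg : Measurable g) {H : (Fin n → ℝ) → ℝ}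
    (hH : Measurable H) (μ : Fin n → ℝ) (Sg : Matrix (Fin n) (Fin n) ℝ) :
    Measurable (gseDensity μ Sg g H) := by
  have h1 : Continuous fun x : Fin n → ℝ => (1 / 2) * ((x - μ) ⬝ᵥ (Sg⁻¹ *ᵥ (x - μ))) := by
    have : Continuous fun x : Fin n → ℝ => Sg⁻¹ *ᵥ (x - μ) :=
      Continuous.matrix_mulVec continuous_const (continuous_id.sub continuous_const)
    exact continuous_const.mul ((continuous_id.sub continuous_const).dotProduct this)
  exact (((hg.comp h1.measurable).const_mul _).const_mul 2).mul
    (hH.comp (measurable_standardize μ Sg))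

/-- The Jacobian `|det Σ^(1/2)| = √(det Σ)` cancels the normalization, and `Σ^(1/2) Σ⁻¹ Σ^(1/2) = 1`
reduces the quadratic form to `zᵀz`. -/
theorem gseDensity_sqrt_mulVec (hSg : Sg.PosDef) (μ : Fin n → ℝ) (g : ℝ → ℝ)
    (H : (Fin n → ℝ) → ℝ) (z : Fin n → ℝ) :
    |(CFC.sqrt Sg).det| * gseDensity μ Sg g H (CFC.sqrt Sg *ᵥ z + μ) = gseDensity 0 1 g H z := by
  have hd : √Sg.det ≠ 0 := (sqrt_pos.2 hSg.det_pos).ne'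
  have hu : IsUnit (CFC.sqrt Sg).det := isUnit_iff_ne_zero.2 (det_sqrt_ne_zero hSg)
  have e : (CFC.sqrt Sg *ᵥ z) ⬝ᵥ (Sg⁻¹ *ᵥ (CFC.sqrt Sg *ᵥ z)) = z ⬝ᵥ z := by
    have h1 : Sg⁻¹ * CFC.sqrt Sg = (CFC.sqrt Sg)⁻¹ := by
      conv_lhs => rw [← sqrt_mul_sqrt hSg]
      rw [sqrt_mul_sqrt hSg, ← sqrt_mul_sqrt hSg, Matrix.mul_inv_rev, sqrt_mul_sqrt hSg,
        mul_assoc, nonsing_inv_mul _ hu, mul_one]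
    have h2 : CFC.sqrt Sg *ᵥ z = z ᵥ* CFC.sqrt Sg := by
      conv_lhs => rw [← sqrt_transpose Sg, mulVec_transpose]
    rw [mulVec_mulVec, h1, h2, ← dotProduct_mulVec, mulVec_mulVec, mul_nonsing_inv _ hu,
      one_mulVec]
  rw [gseDensity, gseDensity, standardize_sqrt_mulVec hSg, standardize_zero_one,
    ellDensity_zero_one, ellDensity, add_sub_cancel_right, e, abs_det_sqrt hSg, sphDensity]
  field_simp

theorem sqrt_diagonal {d : Fin n → ℝ} (hd : ∀ i, 0 ≤ d i) :
    CFC.sqrt (diagonal d) = diagonal fun i => √(d i) := by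
  refine CFC.sqrt_unique ?_ (PosSemidef.diagonal fun i => sqrt_nonneg _).nonneg
  rw [diagonal_mul_diagonal]
  congr 1
  ext i
  exact mul_self_sqrt (hd i)

/-- For diagonal `Σ` standardization is an increasing affine map in each coordinate and so preserves
orthants; a general `Σ^(1/2)` mixes coordinates. -/
theorem exceed_standardize_of_isDiag {Ω : Type*} (hSg : Sg.PosDef) (hd : Sg.IsDiag) (μ t : Fin n → ℝ)
    (Y : Ω → Fin n → ℝ) :
    exceed (fun ω => standardize μ Sg (Y ω)) (standardize μ Sg t) = exceed Y t := by
  have hpos : ∀ i, 0 < Sg i i := fun i => hSg.diag_pos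
  have hS : CFC.sqrt Sg = diagonal fun i => √(Sg i i) := by
    conv_lhs => rw [← hd.diagonal_diag]
    exact sqrt_diagonal fun i => (hpos i).le
  have hstd : ∀ y, standardize μ Sg y = fun i => (√(Sg i i))⁻¹ * (y i - μ i) := by
    intro y
    have hinv : (CFC.sqrt Sg)⁻¹ = diagonal fun i => (√(Sg i i))⁻¹ := by
      refine inv_eq_left_inv ?_
      rw [hS, diagonal_mul_diagonal, ← diagonal_one]
      congr 1
      ext i
      exact inv_mul_cancel₀ (sqrt_pos.2 (hpos i)).ne'
    ext i
    rw [standardize, hinv, mulVec_diagonal, Pi.sub_apply]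
  ext ω
  simp only [exceed, mem_ofPred_eq, hstd]
  refine forall_congr' fun i => ?_
  rw [mul_lt_mul_iff_right₀ (inv_pos.2 (sqrt_pos.2 (hpos i))), sub_lt_sub_iff_right]

variable {Ω : Type*} [MeasurableSpace Ω] {P : Measure Ω}

theorem measurable_comp_dotProduct {H : ℝ → ℝ} (hH : Measurable H) (γ : Fin n → ℝ) :
    Measurable fun z : Fin n → ℝ => H (γ ⬝ᵥ z) :=
  hH.comp (by unfold dotProduct; fun_prop)

theorem hasLaw_standardize (hSg : Sg.PosDef) {μ γ : Fin n → ℝ} {H : ℝ → ℝ} (hH : Measurable H)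
    {Y : Ω → Fin n → ℝ} (hY : HasLaw Y (gsLaplaceLaw μ Sg γ H) P) :
    HasLaw (fun ω => standardize μ Sg (Y ω)) (gsLaplaceLaw 0 1 γ H) P where
  aemeasurable := (measurable_standardize μ Sg).comp_aemeasurable hY.aemeasurable
  map_eq := by
    have h1 : P.map (fun ω => standardize μ Sg (Y ω)) = (P.map Y).map (standardize μ Sg) :=
      (AEMeasurable.map_map_of_aemeasurable (measurable_standardize μ Sg).aemeasurable
        hY.aemeasurable).symm
    rw [h1, hY.map_eq, gsLaplaceLaw]
    refine (map_lawOf_affine (det_sqrt_ne_zero hSg) μ (measurable_gseDensity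
      continuous_lapGen.measurable (measurable_comp_dotProduct hH γ) μ Sg)).trans ?_
    simp only [gseDensity_sqrt_mulVec hSg]
    rfl

/-! ### Conditional moments -/

theorem gseDensity_nonneg {g : ℝ → ℝ} (hg : IsDecayGen g) {H : (Fin n → ℝ) → ℝ}
    (hH : ∀ x, 0 ≤ H x) (x : Fin n → ℝ) : 0 ≤ gseDensity 0 1 g H x := by
  rw [gseDensity_zero_one]
  have := hg.normConst_pos n
  have := hg.pos ((1 / 2) * (x ⬝ᵥ x)) (by have := dotProduct_self_nonneg x; positivity)
  have := hH x
  positivity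

theorem memLp_coord {γ : Fin n → ℝ} {H : ℝ → ℝ} (hs : IsSkewing H) (hH : Measurable H)
    {Z : Ω → Fin n → ℝ} (hZ : HasLaw Z (gsLaplaceLaw 0 1 γ H) P) (k : Fin n) :
    MemLp (fun ω => Z ω k) 2 P := by
  have hm : Measurable fun x : Fin n → ℝ => x k := measurable_pi_apply k
  have hf : Measurable (gseDensity 0 1 lapGen fun z => H (γ ⬝ᵥ z)) := measurable_gseDensity
      continuous_lapGen.measurable (measurable_comp_dotProduct hH γ) 0 1
  have key : MemLp (fun x : Fin n → ℝ => x k) 2 (P.map Z) := by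
    rw [hZ.map_eq, memLp_two_iff_integrable_sq hm.aestronglyMeasurable, gsLaplaceLaw, lawOf,
      integrable_withDensity_iff_integrable_smul' (by fun_prop) (by simp)]
    have h := (isDecayGen_lapGen.integrable_mul_skew hH hs.abs_le_one le_rfl 0 γ
      (h := fun x => x k * x k) (by fun_prop) fun x => abs_coord_mul_coord_le x k k).const_mul
      (2 * normConst n lapGen)
    refine h.congr (Eventually.of_forall fun x => ?_)
    simp only [add_zero, zero_add]
    rw [ENNReal.toReal_ofReal (gseDensity_nonneg isDecayGen_lapGen
      (fun x => (hs.1 (γ ⬝ᵥ x)).1) x), gseDensity_zero_one, smul_eq_mul]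
    ring
  exact (memLp_map_measure_iff hm.aestronglyMeasurable hZ.aemeasurable).1 key

theorem setIntegral_exceed {f : (Fin n → ℝ) → ℝ} (hf : Measurable f) (h0 : ∀ x, 0 ≤ f x)
    {Z : Ω → Fin n → ℝ} (hZ : HasLaw Z (lawOf f) P) (lam : Fin n → ℝ) {h : (Fin n → ℝ) → ℝ}
    (hh : Measurable h) :
    ∫ ω in exceed Z lam, h (Z ω) ∂P = ∫ x in tailSet lam, h x * f x := by
  have h1 := setIntegral_map (μ := P) (measurableSet_tailSet lam)
    (f := h) hh.aestronglyMeasurable hZ.aemeasurable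
  refine h1.symm.trans ?_
  rw [hZ.map_eq, lawOf, setIntegral_withDensity_eq_setIntegral_toReal_smul₀ (by fun_prop)
    (by simp) _ (measurableSet_tailSet lam)]
  refine integral_congr_ae (Eventually.of_forall fun x => ?_)
  simp only [ENNReal.toReal_ofReal (h0 x), smul_eq_mul, mul_comm]

theorem integral_cond_exceed {f : (Fin n → ℝ) → ℝ} (hf : Measurable f) (h0 : ∀ x, 0 ≤ f x)
    {Z : Ω → Fin n → ℝ} (hZ : HasLaw Z (lawOf f) P) (lam : Fin n → ℝ) {h : (Fin n → ℝ) → ℝ}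
    (hh : Measurable h) :
    ∫ ω, h (Z ω) ∂(ProbabilityTheory.cond P (exceed Z lam)) =
      (tailFn f lam)⁻¹ * ∫ x in tailSet lam, h x * f x := by
  have h1 := setIntegral_exceed hf h0 hZ lam (h := fun _ => 1) measurable_const
  simp only [one_mul, setIntegral_const, smul_eq_mul, mul_one] at h1
  rw [ProbabilityTheory.cond, integral_smul_measure, setIntegral_exceed hf h0 hZ lam hh,
    ENNReal.toReal_inv, smul_eq_mul, ← measureReal_def, h1, tailFn]

theorem MTCE_eq {f : (Fin n → ℝ) → ℝ} (hf : Measurable f) (h0 : ∀ x, 0 ≤ f x)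
    {Z : Ω → Fin n → ℝ} (hZ : HasLaw Z (lawOf f) P) (lam : Fin n → ℝ) (k : Fin n) :
    MTCE P Z lam k = (tailFn f lam)⁻¹ * ∫ x in tailSet lam, x k * f x :=
  integral_cond_exceed hf h0 hZ lam (h := fun x => x k) (measurable_pi_apply k)

theorem memLp_cond [IsFiniteMeasure P] {X : Ω → ℝ} (hX : MemLp X 2 P) {A : Set Ω}
    (hA : P A ≠ 0) : MemLp X 2 (ProbabilityTheory.cond P A) :=
  (hX.restrict A).smul_measure (ENNReal.inv_ne_top.2 hA)

theorem condCov_eq_covariance (A : Set Ω) (X : Ω → Fin n → ℝ) (i j : Fin n) :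
    condCov P A X i j =
      covariance (fun ω => X ω i) (fun ω => X ω j) (ProbabilityTheory.cond P A) := rfl

theorem MTCov_eq [IsFiniteMeasure P] {f : (Fin n → ℝ) → ℝ} (hf : Measurable f)
    (h0 : ∀ x, 0 ≤ f x) {Z : Ω → Fin n → ℝ} (hZ : HasLaw Z (lawOf f) P)
    (hmem : ∀ k, MemLp (fun ω => Z ω k) 2 P) {lam : Fin n → ℝ} (hpos : 0 < P (exceed Z lam))
    (i j : Fin n) :
    MTCov P Z lam i j = (tailFn f lam)⁻¹ * (∫ x in tailSet lam, x i * x j * f x) -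
      MTCE P Z lam i * MTCE P Z lam j := by
  have := cond_isProbabilityMeasure hpos.ne'
  rw [MTCov, condCov_eq_covariance, covariance_eq_sub (memLp_cond (hmem i) hpos.ne')
    (memLp_cond (hmem j) hpos.ne')]
  congr 1
  exact integral_cond_exceed hf h0 hZ lam (h := fun x => x i * x j) (by fun_prop)

theorem condCov_affine [IsFiniteMeasure P] {Z : Ω → Fin n → ℝ}
    (hmem : ∀ k, MemLp (fun ω => Z ω k) 2 P) (A : Set Ω) (S : Matrix (Fin n) (Fin n) ℝ)
    (μ : Fin n → ℝ) :
    condCov P A (fun ω => S *ᵥ Z ω + μ) = S * condCov P A Z * Sᵀ := by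
  ext i j
  -- Conditioning on a null event gives the zero measure and both sides vanish, so no positivity of
  -- `P A` is needed.
  by_cases hA : P A = 0
  · have h : ProbabilityTheory.cond P A = 0 := by
      rw [ProbabilityTheory.cond, Measure.restrict_eq_zero.2 hA, smul_zero]
    have h' : condCov P A Z = 0 := by
      ext i j
      rw [condCov_eq_covariance, h, covariance_zero_measure]
      rfl
    rw [condCov_eq_covariance, h, covariance_zero_measure, h']
    simp
  have := cond_isProbabilityMeasure hA
  have hm := fun k => memLp_cond (hmem k) hA
  have hm' : ∀ i k, MemLp (fun ω => S i k * Z ω k) 2 (ProbabilityTheory.cond P A) :=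
    fun i k => (hm k).const_mul _
  have hi : ∀ i, Integrable (fun ω => ∑ k, S i k * Z ω k) (ProbabilityTheory.cond P A) :=
    fun i => integrable_finsetSum _ fun k _ => (hm' i k).integrable (by norm_num)
  rw [condCov_eq_covariance]
  simp only [Pi.add_apply, mulVec, dotProduct]
  rw [covariance_add_const_left (hi i), covariance_add_const_right (hi j),
    covariance_fun_sum_fun_sum (hm' i) (hm' j)]
  simp only [covariance_const_mul_left, covariance_const_mul_right, mul_apply, transpose_apply,
    condCov_eq_covariance, Finset.sum_mul]
  rw [Finset.sum_comm]
  refine Finset.sum_congr rfl fun k _ => Finset.sum_congr rfl fun l _ => by ring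

theorem measure_exceed_pos {f : (Fin n → ℝ) → ℝ} (hf : Measurable f) (h0 : ∀ x, 0 < f x)
    {Z : Ω → Fin n → ℝ} (hZ : HasLaw Z (lawOf f) P) (lam : Fin n → ℝ) :
    0 < P (exceed Z lam) := by
  have h1 : P (exceed Z lam) = lawOf f (tailSet lam) := by
    rw [← hZ.map_eq, Measure.map_apply_of_aemeasurable hZ.aemeasurable (measurableSet_tailSet lam)]
    rfl
  rw [h1, pos_iff_ne_zero, lawOf, Ne, withDensity_apply_eq_zero (by fun_prop)]
  have h2 : {x | ENNReal.ofReal (f x) ≠ 0} ∩ tailSet lam = tailSet lam := by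
    refine inter_eq_right.2 fun x _ => ?_
    simpa using h0 x
  rw [h2]
  have ho : IsOpen (tailSet lam) := by
    have : tailSet lam = ⋂ k, {x | lam k < x k} := by ext x; simp [tailSet]
    rw [this]
    exact isOpen_iInter_of_finite fun k => isOpen_lt continuous_const (continuous_apply k)
  exact (ho.measure_pos volume ⟨fun k => lam k + 1, fun k => by simp⟩).ne'

end Standardize

/-! ### The univariate Laplace distribution -/

theorem continuous_lapPdf : Continuous lapPdf := by unfold lapPdf; fun_prop

theorem lapPdf_pos (x : ℝ) : 0 < lapPdf x := by unfold lapPdf; positivity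

theorem lapPdf_neg (x : ℝ) : lapPdf (-x) = lapPdf x := by simp [lapPdf]

theorem lapPdf_le_one (x : ℝ) : lapPdf x ≤ 1 := by
  have : Real.exp (-|x|) ≤ 1 := Real.exp_le_one_iff.2 (by simp)
  unfold lapPdf
  linarith

theorem integrable_lapPdf : Integrable lapPdf := by
  have := (integrable_exp_neg_mul_abs one_pos).div_const 2
  simp only [one_mul] at this
  exact this

theorem integral_lapPdf : ∫ x, lapPdf x = 1 := by
  have h := integral_comp_abs (f := fun x => Real.exp (-x) / 2)
  rw [integral_div 2 fun x => Real.exp (-x), integral_exp_neg_Ioi_zero] at h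
  simpa [lapPdf] using h

theorem lapCdf_add (x : ℝ) : lapCdf x + ∫ t in Ioi x, lapPdf t = 1 := by
  rw [lapCdf, intervalIntegral.integral_Iic_add_Ioi integrable_lapPdf.integrableOn
    integrable_lapPdf.integrableOn, integral_lapPdf]

theorem isSkewing_lapCdf : IsSkewing lapCdf := by
  have h0 : ∀ s : Set ℝ, 0 ≤ ∫ t in s, lapPdf t := fun s =>
    integral_nonneg fun t => (lapPdf_pos t).le
  refine ⟨fun x => ⟨h0 _, by linarith [lapCdf_add x, h0 (Ioi x)]⟩, fun x => ?_⟩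
  have : lapCdf (-x) = ∫ t in Ioi x, lapPdf t := by
    rw [lapCdf, ← integral_comp_neg_Ioi]
    simp only [lapPdf_neg]
  linarith [lapCdf_add x]

theorem hasDerivAt_lapCdf (x : ℝ) : HasDerivAt lapCdf (lapPdf x) x := by
  have h : lapCdf = fun x => 1 - cumGen lapPdf x := by
    ext x
    rw [cumGen, ← lapCdf_add x, add_sub_cancel_right]
  rw [h]
  simpa using (hasDerivAt_cumGen continuous_lapPdf integrable_lapPdf.integrableOn x).const_sub 1

theorem lapCdf_pos (x : ℝ) : 0 < lapCdf x := by
  have hs : Function.support lapPdf = univ := by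
    ext t
    simpa using (lapPdf_pos t).ne'
  rw [lapCdf, setIntegral_pos_iff_support_of_nonneg_ae
    (Eventually.of_forall fun t => (lapPdf_pos t).le) integrable_lapPdf.integrableOn, hs]
  simp

theorem deriv_lapCdf : deriv lapCdf = lapPdf := funext fun x => (hasDerivAt_lapCdf x).deriv

/-- Taking logarithms recovers `|x|` from the density, so a derivative at the origin would
differentiate the absolute value there. -/
theorem not_differentiableAt_lapPdf_zero : ¬ DifferentiableAt ℝ lapPdf 0 := by
  intro h
  have h1 : DifferentiableAt ℝ (fun x => - Real.log (2 * lapPdf x)) 0 :=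
    ((h.const_mul 2).log (by have := lapPdf_pos 0; positivity)).neg
  have h2 : (fun x => - Real.log (2 * lapPdf x)) = fun x : ℝ => |x| := by
    ext x
    rw [lapPdf, mul_div_cancel₀ _ two_ne_zero, Real.log_exp, neg_neg]
  rw [h2] at h1
  exact not_differentiableAt_abs_zero h1

/-- Also true at `x = 0`: `deriv` is zero at a point of non-differentiability, and `0 / |0| = 0`.
The formula can thus be substituted under integrals without discarding a null set. -/
theorem deriv_lapPdf (x : ℝ) : deriv lapPdf x = - (x / |x| * lapPdf x) := by
  rcases lt_trichotomy x 0 with hx | rfl | hx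
  · have h : HasDerivAt lapPdf (Real.exp x / 2) x := by
      refine ((Real.hasDerivAt_exp x).div_const 2).congr_of_eventuallyEq ?_
      filter_upwards [eventually_lt_nhds hx] with y hy
      rw [lapPdf, abs_of_neg hy, neg_neg]
    rw [h.deriv, lapPdf, abs_of_neg hx, neg_neg, div_neg, div_self hx.ne]
    ring
  · rw [deriv_zero_of_not_differentiableAt not_differentiableAt_lapPdf_zero]
    simp
  · have h : HasDerivAt lapPdf (-Real.exp (-x) / 2) x := by
      have := (hasDerivAt_neg x).exp.div_const 2
      refine (this.congr_of_eventuallyEq ?_).congr_deriv (by ring)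
      filter_upwards [eventually_gt_nhds hx] with y hy
      rw [lapPdf, abs_of_pos hy]
    rw [h.deriv, lapPdf, abs_of_pos hx, div_self hx.ne']
    ring

/-- Supplies the absolute continuity of `H'` in the skew-Laplace case, where `H'` has a corner at
the origin. -/
theorem lipschitzWith_lapPdf : LipschitzWith 1 lapPdf := by
  have key : ∀ a b : ℝ, 0 ≤ a → a ≤ b → Real.exp (-a) - Real.exp (-b) ≤ b - a := by
    intro a b ha hab
    have h1 : Real.exp (-b) = Real.exp (-a) * Real.exp (-(b - a)) := by
      rw [← Real.exp_add]; ring_nf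
    have h2 := Real.add_one_le_exp (-(b - a))
    have h3 : Real.exp (-a) ≤ 1 := Real.exp_le_one_iff.2 (by linarith)
    have h4 := Real.exp_pos (-a)
    nlinarith
  have key' : ∀ x y : ℝ, |x| ≤ |y| → |lapPdf x - lapPdf y| ≤ |x - y| := by
    intro x y h
    have h1 := key |x| |y| (abs_nonneg x) h
    have h2 : Real.exp (-|y|) ≤ Real.exp (-|x|) := Real.exp_le_exp.2 (by linarith)
    have h3 := abs_sub_abs_le_abs_sub y x
    rw [abs_sub_comm y x] at h3
    have h4 : (0 : ℝ) ≤ |x - y| := abs_nonneg _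
    rw [lapPdf, lapPdf, abs_of_nonneg (by linarith)]
    linarith
  refine LipschitzWith.of_dist_le_mul fun x y => ?_
  rw [NNReal.coe_one, one_mul, Real.dist_eq, Real.dist_eq]
  rcases le_total |x| |y| with h | h
  · exact key' x y h
  · rw [abs_sub_comm, abs_sub_comm x]
    exact key' y x h

/-! ### The tail covariance and the tail conditional expectation -/

section Tail

variable {n : ℕ} {Ω : Type*} [MeasurableSpace Ω] {P : Measure Ω}
  {Z : Ω → Fin n → ℝ} {lam γ : Fin n → ℝ} {H : ℝ → ℝ}

theorem MTCov_of_ne [IsFiniteMeasure P] (hn : 1 ≤ n) (hs : IsSkewing H)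
    (hH : Differentiable ℝ H) (hAC : ∀ a b : ℝ, AbsolutelyContinuousOnInterval (deriv H) a b)
    (hZ : HasLaw Z (gsLaplaceLaw 0 1 γ H) P) (hpos : 0 < P (exceed Z lam))
    (hV : ∀ k, HasTailExp (densV lapGen lam k) (drop lam k)
        fun v => deriv H (γ ⬝ᵥ put lam k v))
    (hX : HasTailExp (sphDensity (cumGen (cumGen lapGen))) lam
        (fun x => deriv (deriv H) (γ ⬝ᵥ x))) {i j : Fin n} (hij : i ≠ j) :
    MTCov P Z lam i j =
        2 / tailFn (gseDensity 0 1 lapGen fun z => H (γ ⬝ᵥ z)) lam *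
          (normConst n lapGen / constU lapGen lam i j *
              tailExp (densU lapGen lam i j) (drop₂ lam i j)
                (fun u => H (γ ⬝ᵥ put₂ lam i j u))
            + normConst n lapGen / constV lapGen lam i * γ j *
              tailExp (densV lapGen lam i) (drop lam i)
                (fun v => deriv H (γ ⬝ᵥ put lam i v))
            + normConst n lapGen / constV lapGen lam j * γ i *
              tailExp (densV lapGen lam j) (drop lam j)
                (fun v => deriv H (γ ⬝ᵥ put lam j v))
            + (n + 3) * (n + 1) * γ i * γ j *
              tailExp (sphDensity (cumGen (cumGen lapGen))) lam
                (fun x => deriv (deriv H) (γ ⬝ᵥ x)))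
          - MTCE P Z lam i * MTCE P Z lam j := by
  have hm := hH.continuous.measurable
  rw [MTCov_eq (measurable_gseDensity continuous_lapGen.measurable
    (measurable_comp_dotProduct hm γ) 0 1) (gseDensity_nonneg isDecayGen_lapGen
    fun x => (hs.1 (γ ⬝ᵥ x)).1) hZ (memLp_coord hs hm hZ) hpos,
    setIntegral_mixed_mul_gseDensity hs hH hAC hV hX hn hij]
  ring

theorem MTCov_self [IsFiniteMeasure P] (hn : 1 ≤ n) (hs : IsSkewing H)
    (hH : Differentiable ℝ H) (hAC : ∀ a b : ℝ, AbsolutelyContinuousOnInterval (deriv H) a b)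
    (hZ : HasLaw Z (gsLaplaceLaw 0 1 γ H) P) (hpos : 0 < P (exceed Z lam))
    (hV : ∀ k, HasTailExp (densV lapGen lam k) (drop lam k)
        fun v => deriv H (γ ⬝ᵥ put lam k v))
    (hX : HasTailExp (sphDensity (cumGen (cumGen lapGen))) lam
        (fun x => deriv (deriv H) (γ ⬝ᵥ x))) (i : Fin n) :
    MTCov P Z lam i i =
        2 / tailFn (gseDensity 0 1 lapGen fun z => H (γ ⬝ᵥ z)) lam *
          (normConst n lapGen / constW lapGen lam i * lam i *
              tailExp (densW lapGen lam i) (drop lam i)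
                (fun w => H (γ ⬝ᵥ put lam i w))
            + normConst n lapGen / constV lapGen lam i * γ i *
              tailExp (densV lapGen lam i) (drop lam i)
                (fun v => deriv H (γ ⬝ᵥ put lam i v))
            + (n + 3) * (n + 1) * γ i ^ 2 *
              tailExp (sphDensity (cumGen (cumGen lapGen))) lam
                (fun x => deriv (deriv H) (γ ⬝ᵥ x)))
          + (n + 1) *
            (tailFn (gseDensity 0 1 (cumGen lapGen) fun z => H (γ ⬝ᵥ z)) lam /
              tailFn (gseDensity 0 1 lapGen fun z => H (γ ⬝ᵥ z)) lam)
          - MTCE P Z lam i ^ 2 := by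
  have hm := hH.continuous.measurable
  rw [MTCov_eq (measurable_gseDensity continuous_lapGen.measurable
    (measurable_comp_dotProduct hm γ) 0 1) (gseDensity_nonneg isDecayGen_lapGen
    fun x => (hs.1 (γ ⬝ᵥ x)).1) hZ (memLp_coord hs hm hZ) hpos,
    setIntegral_sq_mul_gseDensity hs hH hAC hV hX hn]
  ring

theorem MTCE_eq_tailExp (hs : IsSkewing H) (hH : Differentiable ℝ H)
    (hZ : HasLaw Z (gsLaplaceLaw 0 1 γ H) P)
    (hM : HasTailExp (sphDensity lapGen) lam
        (fun m => (1 + √(m ⬝ᵥ m)) * deriv H (γ ⬝ᵥ m))) (k : Fin n) :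
    MTCE P Z lam k =
        2 / tailFn (gseDensity 0 1 lapGen fun z => H (γ ⬝ᵥ z)) lam *
          (normConst n lapGen / constW lapGen lam k *
              tailExp (densW lapGen lam k) (drop lam k)
                (fun w => H (γ ⬝ᵥ put lam k w))
            + γ k * tailExp (sphDensity lapGen) lam
                (fun m => (1 + √(m ⬝ᵥ m)) * deriv H (γ ⬝ᵥ m))) := by
  rw [MTCE_eq (measurable_gseDensity continuous_lapGen.measurable
    (measurable_comp_dotProduct hH.continuous.measurable γ) 0 1)
    (gseDensity_nonneg isDecayGen_lapGen fun x => (hs.1 (γ ⬝ᵥ x)).1) hZ,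
    setIntegral_coord_mul_gseDensity hs hH hM]
  ring

theorem measure_exceed_pos_of_pos (hH : Measurable H) (h0 : ∀ x, 0 < H x)
    (hZ : HasLaw Z (gsLaplaceLaw 0 1 γ H) P) : 0 < P (exceed Z lam) := by
  refine measure_exceed_pos (measurable_gseDensity continuous_lapGen.measurable
    (measurable_comp_dotProduct hH γ) 0 1) (fun x => ?_) hZ lam
  rw [gseDensity_zero_one]
  have := isDecayGen_lapGen.normConst_pos n
  have := isDecayGen_lapGen.pos ((1 / 2) * (x ⬝ᵥ x))
    (by have := dotProduct_self_nonneg x; positivity)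
  have := h0 (γ ⬝ᵥ x)
  positivity

/-! ### Bounded skewing derivatives -/

/-- For bounded derivatives of the skewing function the assumed tail expectations exist
automatically; this covers the skew-Laplace and the symmetric case. -/
theorem hasTailExp_densV_of_bounded {φ : ℝ → ℝ} (hφ : Measurable φ) (hb : ∀ x, |φ x| ≤ 1)
    (k : Fin n) : HasTailExp (densV lapGen lam k) (drop lam k) fun v => φ (γ ⬝ᵥ put lam k v) := by
  rw [hasTailExp_densV_iff]
  have := isDecayGen_cumGen_cumGen_lapGen.integrable_mul_skew hφ hb (sq_nonneg (lam k))
    (γ k * lam k) (rem γ k) (h := fun _ => 1) (by fun_prop) fun x => abs_one_le x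
  simp only [put_eq_ins, dotProduct_ins, one_mul] at this ⊢
  simp only [add_comm (rem γ k ⬝ᵥ _)]
  exact this.integrableOn

theorem hasTailExp_sphDensity_of_bounded {g : ℝ → ℝ} (hg : IsDecayGen g) {φ : ℝ → ℝ}
    (hφ : Measurable φ) (hb : ∀ x, |φ x| ≤ 1) {h : (Fin n → ℝ) → ℝ} (hm : Measurable h)
    (hb' : ∀ x, |h x| ≤ (1 + √(x ⬝ᵥ x)) ^ 2) :
    HasTailExp (sphDensity g) lam fun x => h x * φ (γ ⬝ᵥ x) := by
  rw [hasTailExp_sphDensity_iff hg]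
  have := hg.integrable_mul_skew hφ hb le_rfl 0 γ hm hb'
  simp only [add_zero, zero_add] at this
  exact (this.congr (Eventually.of_forall fun x => by ring)).integrableOn

theorem tailExp_neg {ι : Type*} [Fintype ι] (f : (ι → ℝ) → ℝ) (t : ι → ℝ) (h : (ι → ℝ) → ℝ) :
    tailExp f t (fun x => - h x) = - tailExp f t h := by
  simp only [tailExp, neg_mul, integral_neg]

theorem tailExp_const {ι : Type*} [Fintype ι] (f : (ι → ℝ) → ℝ) (t : ι → ℝ) (c : ℝ) :
    tailExp f t (fun _ => c) = c * tailFn f t := by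
  simp only [tailExp, tailFn, integral_const_mul]

theorem abs_lapPdf_le (x : ℝ) : |lapPdf x| ≤ 1 := by
  rw [abs_of_pos (lapPdf_pos x)]
  exact lapPdf_le_one x

theorem abs_deriv_lapPdf_le (x : ℝ) : |deriv lapPdf x| ≤ 1 := by
  rw [deriv_lapPdf, abs_neg, abs_mul, abs_div, abs_abs]
  exact mul_le_one₀ (div_self_le_one _) (abs_nonneg _) (abs_lapPdf_le x)

theorem hasTailExp_one_add_sqrt {φ : ℝ → ℝ} (hφ : Measurable φ) (hb : ∀ x, |φ x| ≤ 1) :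
    HasTailExp (sphDensity lapGen) lam fun m => (1 + √(m ⬝ᵥ m)) * φ (γ ⬝ᵥ m) := by
  refine hasTailExp_sphDensity_of_bounded isDecayGen_lapGen hφ hb
    (by unfold dotProduct; fun_prop) fun x => ?_
  have := sqrt_nonneg (x ⬝ᵥ x)
  rw [abs_of_nonneg (by positivity)]
  nlinarith

theorem hasTailExp_sphDensity_cumGen_cumGen {φ : ℝ → ℝ} (hφ : Measurable φ)
    (hb : ∀ x, |φ x| ≤ 1) :
    HasTailExp (sphDensity (cumGen (cumGen lapGen))) lam fun x => φ (γ ⬝ᵥ x) := by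
  have := hasTailExp_sphDensity_of_bounded (lam := lam) (γ := γ) isDecayGen_cumGen_cumGen_lapGen
    hφ hb (h := fun _ => 1) (by fun_prop) abs_one_le
  simpa only [one_mul] using this

/-! ### The symmetric case -/

theorem isSkewing_half : IsSkewing fun _ => (1 / 2 : ℝ) :=
  ⟨fun _ => by norm_num, fun _ => by norm_num⟩

theorem gseDensity_half (μ : Fin n → ℝ) (Sg : Matrix (Fin n) (Fin n) ℝ) (g : ℝ → ℝ) :
    gseDensity μ Sg g (fun _ => 1 / 2) = ellDensity μ Sg g := by
  ext x
  rw [gseDensity]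
  ring

theorem gsLaplaceLaw_half (μ γ : Fin n → ℝ) (Sg : Matrix (Fin n) (Fin n) ℝ) :
    gsLaplaceLaw μ Sg γ (fun _ => 1 / 2) = lawOf (ellDensity μ Sg lapGen) := by
  rw [gsLaplaceLaw, gseDensity_half]

theorem ellDensity_zero_one_eq (g : ℝ → ℝ) :
    ellDensity (0 : Fin n → ℝ) 1 g = sphDensity g := funext (ellDensity_zero_one g)

end Tail

end SkewLaplace

end

/-! ### Assembly of the main theorem -/

theorem mainTheorem5 {Ω : Type*} [MeasurableSpace Ω] (P : Measure Ω) [IsProbabilityMeasure P]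
    (n : ℕ) (hn : 1 ≤ n)
    (μ γ : Fin n → ℝ) (Sg : Matrix (Fin n) (Fin n) ℝ) (hSg : Sg.PosDef)
    (q : Fin n → ℝ) (hq : ∀ k, q k ∈ Ioo (0 : ℝ) 1)
    (Y Z : Ω → Fin n → ℝ) (hZ : Z = fun ω => standardize μ Sg (Y ω))
    (lam : Fin n → ℝ) (hlam : lam = standardize μ Sg (vectorVaR P q Y)) :
    -- cumulative generators
    (∀ t : ℝ, 0 ≤ t →
      cumGen lapGen t = (1 + √(2 * t)) * Real.exp (-√(2 * t)) ∧
      cumGen (cumGen lapGen) t = (3 + 2 * t + 3 * √(2 * t)) * Real.exp (-√(2 * t))) ∧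
    -- normalizing constants in dimension `n`
    (normConst n lapGen =
        Real.Gamma ((n : ℝ) / 2) / (2 * π ^ ((n : ℝ) / 2) * Real.Gamma n) ∧
      normConst n (cumGen lapGen) =
        n * Real.Gamma ((n : ℝ) / 2) / (2 * π ^ ((n : ℝ) / 2) * Real.Gamma (n + 2)) ∧
      normConst n (cumGen (cumGen lapGen)) =
        n * (n + 2) * Real.Gamma ((n : ℝ) / 2) /
          (2 * π ^ ((n : ℝ) / 2) * Real.Gamma (n + 4))) ∧
    -- the functions used below are probability densities
    (∫ x : Fin n → ℝ, sphDensity lapGen x = 1 ∧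
      ∫ x : Fin n → ℝ, sphDensity (cumGen (cumGen lapGen)) x = 1 ∧
      (∀ k, ∫ w, densW lapGen lam k w = 1 ∧ ∫ v, densV lapGen lam k v = 1) ∧
      (∀ i j, i ≠ j → ∫ u, densU lapGen lam i j u = 1)) ∧
    -- explicit densities of `W_{-k}`, `V_{-k}`, `U_{-ij}`
    ((∀ k w, densW lapGen lam k w =
        constW lapGen lam k * (1 + √(w ⬝ᵥ w + lam k ^ 2)) *
          Real.exp (-√(w ⬝ᵥ w + lam k ^ 2))) ∧
      (∀ k v, densV lapGen lam k v =
        constV lapGen lam k *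
          (3 + (v ⬝ᵥ v + lam k ^ 2) + 3 * √(v ⬝ᵥ v + lam k ^ 2)) *
          Real.exp (-√(v ⬝ᵥ v + lam k ^ 2))) ∧
      (∀ i j u, i ≠ j → densU lapGen lam i j u =
        constU lapGen lam i j *
          (3 + (u ⬝ᵥ u + lam i ^ 2 + lam j ^ 2) + 3 * √(u ⬝ᵥ u + lam i ^ 2 + lam j ^ 2)) *
          Real.exp (-√(u ⬝ᵥ u + lam i ^ 2 + lam j ^ 2)))) ∧
    -- normalizing constants of `W_{-k}`, `V_{-k}`, `U_{-ij}` and the ratios with `c_n`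
    (∀ k, 2 ≤ n →
      constW lapGen lam k =
        Real.Gamma (((n : ℝ) - 1) / 2) / (2 * π) ^ (((n : ℝ) - 1) / 2) *
          (∫ t in Ioi (0 : ℝ), t ^ (((n : ℝ) - 3) / 2) *
            (1 + √(2 * t + lam k ^ 2)) * Real.exp (-√(2 * t + lam k ^ 2)))⁻¹ ∧
      constV lapGen lam k =
        Real.Gamma (((n : ℝ) - 1) / 2) / (2 * π) ^ (((n : ℝ) - 1) / 2) *
          (∫ t in Ioi (0 : ℝ), t ^ (((n : ℝ) - 3) / 2) *
            (3 + (2 * t + lam k ^ 2) + 3 * √(2 * t + lam k ^ 2)) *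
            Real.exp (-√(2 * t + lam k ^ 2)))⁻¹ ∧
      normConst n lapGen / constW lapGen lam k =
        Real.Gamma ((n : ℝ) / 2) * 2 ^ (((n : ℝ) - 3) / 2) /
            (Real.Gamma n * Real.Gamma (((n : ℝ) - 1) / 2) * √π) *
          ∫ t in Ioi (0 : ℝ), t ^ (((n : ℝ) - 3) / 2) *
            (1 + √(2 * t + lam k ^ 2)) * Real.exp (-√(2 * t + lam k ^ 2)) ∧
      normConst n lapGen / constV lapGen lam k =
        Real.Gamma ((n : ℝ) / 2) * 2 ^ (((n : ℝ) - 3) / 2) /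
            (Real.Gamma n * Real.Gamma (((n : ℝ) - 1) / 2) * √π) *
          ∫ t in Ioi (0 : ℝ), t ^ (((n : ℝ) - 3) / 2) *
            (3 + (2 * t + lam k ^ 2) + 3 * √(2 * t + lam k ^ 2)) *
            Real.exp (-√(2 * t + lam k ^ 2))) ∧
    (∀ i j, i ≠ j → 3 ≤ n →
      constU lapGen lam i j =
        Real.Gamma (((n : ℝ) - 2) / 2) / (2 * π) ^ (((n : ℝ) - 2) / 2) *
          (∫ t in Ioi (0 : ℝ), t ^ (((n : ℝ) - 4) / 2) *
            (3 + (2 * t + lam i ^ 2 + lam j ^ 2) + 3 * √(2 * t + lam i ^ 2 + lam j ^ 2)) *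
            Real.exp (-√(2 * t + lam i ^ 2 + lam j ^ 2)))⁻¹ ∧
      normConst n lapGen / constU lapGen lam i j =
        ((n : ℝ) - 2) * 2 ^ (((n : ℝ) - 6) / 2) / (Real.Gamma n * π) *
          ∫ t in Ioi (0 : ℝ), t ^ (((n : ℝ) - 4) / 2) *
            (3 + (2 * t + lam i ^ 2 + lam j ^ 2) + 3 * √(2 * t + lam i ^ 2 + lam j ^ 2)) *
            Real.exp (-√(2 * t + lam i ^ 2 + lam j ^ 2))) ∧
    -- reduction of `Y` to `Z`, for every skewing function
    (∀ H : ℝ → ℝ, IsSkewing H → Measurable H → HasLaw Y (gsLaplaceLaw μ Sg γ H) P →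
      HasLaw Z (gsLaplaceLaw 0 1 γ H) P ∧
      (∀ k, MemLp (fun ω => Y ω k) 2 P ∧ MemLp (fun ω => Z ω k) 2 P) ∧
      condCov P (exceed Z lam) Y = CFC.sqrt Sg * MTCov P Z lam * CFC.sqrt Sg ∧
      (Sg.IsDiag →
        MTCov P Y (vectorVaR P q Y) = CFC.sqrt Sg * MTCov P Z lam * CFC.sqrt Sg)) ∧
    -- generalized skew-Laplace: the entries of `Ω_q` and the tail conditional expectation of `Z`
    (∀ H : ℝ → ℝ, IsSkewing H → Differentiable ℝ H →
      (∀ a b : ℝ, AbsolutelyContinuousOnInterval (deriv H) a b) →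
      HasLaw Y (gsLaplaceLaw μ Sg γ H) P →
      0 < P (exceed Z lam) →
      (∀ k, HasTailExp (densV lapGen lam k) (drop lam k)
        fun v => deriv H (γ ⬝ᵥ put lam k v)) →
      HasTailExp (sphDensity (cumGen (cumGen lapGen))) lam
        (fun x => deriv (deriv H) (γ ⬝ᵥ x)) →
      HasTailExp (sphDensity lapGen) lam
        (fun m => (1 + √(m ⬝ᵥ m)) * deriv H (γ ⬝ᵥ m)) →
      (∀ i j, i ≠ j → MTCov P Z lam i j =
        2 / tailFn (gseDensity 0 1 lapGen fun z => H (γ ⬝ᵥ z)) lam *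
          (normConst n lapGen / constU lapGen lam i j *
              tailExp (densU lapGen lam i j) (drop₂ lam i j)
                (fun u => H (γ ⬝ᵥ put₂ lam i j u))
            + normConst n lapGen / constV lapGen lam i * γ j *
              tailExp (densV lapGen lam i) (drop lam i)
                (fun v => deriv H (γ ⬝ᵥ put lam i v))
            + normConst n lapGen / constV lapGen lam j * γ i *
              tailExp (densV lapGen lam j) (drop lam j)
                (fun v => deriv H (γ ⬝ᵥ put lam j v))
            + (n + 3) * (n + 1) * γ i * γ j *
              tailExp (sphDensity (cumGen (cumGen lapGen))) lam
                (fun x => deriv (deriv H) (γ ⬝ᵥ x)))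
          - MTCE P Z lam i * MTCE P Z lam j) ∧
      (∀ i, MTCov P Z lam i i =
        2 / tailFn (gseDensity 0 1 lapGen fun z => H (γ ⬝ᵥ z)) lam *
          (normConst n lapGen / constW lapGen lam i * lam i *
              tailExp (densW lapGen lam i) (drop lam i)
                (fun w => H (γ ⬝ᵥ put lam i w))
            + normConst n lapGen / constV lapGen lam i * γ i *
              tailExp (densV lapGen lam i) (drop lam i)
                (fun v => deriv H (γ ⬝ᵥ put lam i v))
            + (n + 3) * (n + 1) * γ i ^ 2 *
              tailExp (sphDensity (cumGen (cumGen lapGen))) lam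
                (fun x => deriv (deriv H) (γ ⬝ᵥ x)))
          + (n + 1) *
            (tailFn (gseDensity 0 1 (cumGen lapGen) fun z => H (γ ⬝ᵥ z)) lam /
              tailFn (gseDensity 0 1 lapGen fun z => H (γ ⬝ᵥ z)) lam)
          - MTCE P Z lam i ^ 2) ∧
      (∀ k, MTCE P Z lam k =
        2 / tailFn (gseDensity 0 1 lapGen fun z => H (γ ⬝ᵥ z)) lam *
          (normConst n lapGen / constW lapGen lam k *
              tailExp (densW lapGen lam k) (drop lam k)
                (fun w => H (γ ⬝ᵥ put lam k w))
            + γ k * tailExp (sphDensity lapGen) lam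
                (fun m => (1 + √(m ⬝ᵥ m)) * deriv H (γ ⬝ᵥ m))))) ∧
    -- skew-Laplace: `H` is the standard Laplace distribution function
    (HasLaw Y (gsLaplaceLaw μ Sg γ lapCdf) P →
      0 < P (exceed Z lam) ∧
      (∀ i j, i ≠ j → MTCov P Z lam i j =
        2 / tailFn (gseDensity 0 1 lapGen fun z => lapCdf (γ ⬝ᵥ z)) lam *
          (normConst n lapGen / constU lapGen lam i j *
              tailExp (densU lapGen lam i j) (drop₂ lam i j)
                (fun u => lapCdf (γ ⬝ᵥ put₂ lam i j u))
            + normConst n lapGen / constV lapGen lam i * γ j *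
              tailExp (densV lapGen lam i) (drop lam i)
                (fun v => lapPdf (γ ⬝ᵥ put lam i v))
            + normConst n lapGen / constV lapGen lam j * γ i *
              tailExp (densV lapGen lam j) (drop lam j)
                (fun v => lapPdf (γ ⬝ᵥ put lam j v))
            - (n + 3) * (n + 1) * γ i * γ j *
              tailExp (sphDensity (cumGen (cumGen lapGen))) lam
                (fun x => (γ ⬝ᵥ x) / |γ ⬝ᵥ x| * lapPdf (γ ⬝ᵥ x)))
          - MTCE P Z lam i * MTCE P Z lam j) ∧
      (∀ i, MTCov P Z lam i i =
        2 / tailFn (gseDensity 0 1 lapGen fun z => lapCdf (γ ⬝ᵥ z)) lam *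
          (normConst n lapGen / constW lapGen lam i * lam i *
              tailExp (densW lapGen lam i) (drop lam i)
                (fun w => lapCdf (γ ⬝ᵥ put lam i w))
            + normConst n lapGen / constV lapGen lam i * γ i *
              tailExp (densV lapGen lam i) (drop lam i)
                (fun v => lapPdf (γ ⬝ᵥ put lam i v))
            - (n + 3) * (n + 1) * γ i ^ 2 *
              tailExp (sphDensity (cumGen (cumGen lapGen))) lam
                (fun x => (γ ⬝ᵥ x) / |γ ⬝ᵥ x| * lapPdf (γ ⬝ᵥ x)))
          + (n + 1) *
            (tailFn (gseDensity 0 1 (cumGen lapGen) fun z => lapCdf (γ ⬝ᵥ z)) lam /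
              tailFn (gseDensity 0 1 lapGen fun z => lapCdf (γ ⬝ᵥ z)) lam)
          - MTCE P Z lam i ^ 2) ∧
      (∀ k, MTCE P Z lam k =
        2 / tailFn (gseDensity 0 1 lapGen fun z => lapCdf (γ ⬝ᵥ z)) lam *
          (normConst n lapGen / constW lapGen lam k *
              tailExp (densW lapGen lam k) (drop lam k)
                (fun w => lapCdf (γ ⬝ᵥ put lam k w))
            + γ k * tailExp (sphDensity lapGen) lam
                (fun m => (1 + √(m ⬝ᵥ m)) * lapPdf (γ ⬝ᵥ m))))) ∧
    -- symmetric Laplace: `H = 1/2`, so that `Y ~ E_n(μ, Σ, g)`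
    (HasLaw Y (lawOf (ellDensity μ Sg lapGen)) P →
      HasLaw Z (lawOf (sphDensity lapGen)) P ∧
      0 < P (exceed Z lam) ∧
      (∀ i j, i ≠ j → MTCov P Z lam i j =
        1 / tailFn (sphDensity lapGen) lam *
          (normConst n lapGen / constU lapGen lam i j *
            tailFn (densU lapGen lam i j) (drop₂ lam i j))
          - MTCE P Z lam i * MTCE P Z lam j) ∧
      (∀ i, MTCov P Z lam i i =
        1 / tailFn (sphDensity lapGen) lam *
          (normConst n lapGen / constW lapGen lam i * lam i *
            tailFn (densW lapGen lam i) (drop lam i))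
          + (n + 1) * (tailFn (sphDensity (cumGen lapGen)) lam / tailFn (sphDensity lapGen) lam)
          - MTCE P Z lam i ^ 2) ∧
      (∀ k, MTCE P Z lam k =
        1 / tailFn (sphDensity lapGen) lam *
          (normConst n lapGen / constW lapGen lam k *
            tailFn (densW lapGen lam k) (drop lam k)))) := by
  subst hZ
  refine ⟨fun t ht => ⟨cumGen_lapGen ht, cumGen_cumGen_lapGen ht⟩,
    ⟨normConst_lapGen hn, normConst_cumGen_lapGen hn, normConst_cumGen_cumGen_lapGen hn⟩,
    ⟨integral_sphDensity isDecayGen_lapGen, integral_sphDensity isDecayGen_cumGen_cumGen_lapGen,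
      fun k => ⟨integral_densW lam k, integral_densV lam k⟩,
      fun i j hij => integral_densU lam hij⟩,
    ⟨densW_lapGen lam, densV_lapGen lam, fun i j u _ => densU_lapGen lam i j u⟩,
    fun k h2 => ⟨constW_lapGen lam h2 k, constV_lapGen lam h2 k, ?_, ?_⟩,
    fun i j _ h3 => ⟨constU_lapGen lam h3 i j, ?_⟩,
    fun H hs hH hY => ?_, fun H hs hH hAC hY hpos hV hX hM => ?_, fun hY => ?_, fun hY => ?_⟩
  · rw [constW_lapGen lam h2, normConst_div_sub_one h2]
  · rw [constV_lapGen lam h2, normConst_div_sub_one h2]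
  · rw [constU_lapGen lam h3, normConst_div_sub_two h3]
  · have hZ := hasLaw_standardize hSg hH hY
    have hmZ := memLp_coord hs hH hZ
    have hYZ : Y = fun ω => CFC.sqrt Sg *ᵥ standardize μ Sg (Y ω) + μ :=
      funext fun ω => (sqrt_mulVec_standardize hSg μ (Y ω)).symm
    have hcov : condCov P (exceed (fun ω => standardize μ Sg (Y ω)) lam) Y =
        CFC.sqrt Sg * MTCov P (fun ω => standardize μ Sg (Y ω)) lam * CFC.sqrt Sg := by
      conv_lhs => rw [hYZ]
      simp only [standardize_sqrt_mulVec hSg]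
      rw [condCov_affine hmZ, sqrt_transpose]
      rfl
    refine ⟨hZ, fun k => ⟨?_, hmZ k⟩, hcov, fun hd => ?_⟩
    · rw [hYZ]
      simp only [Pi.add_apply, mulVec, dotProduct]
      exact (memLp_finsetSum _ fun l _ => (hmZ l).const_mul _).add (memLp_const _)
    -- Here the threshold must be the standardized quantile vector, so that `{Z > λ}` is `{Y >
    -- VaR}`.
    · rw [← hcov, hlam, exceed_standardize_of_isDiag hSg hd]
      rfl
  · have hZ := hasLaw_standardize hSg hH.continuous.measurable hY
    exact ⟨fun i j hij => MTCov_of_ne hn hs hH hAC hZ hpos hV hX hij,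
      MTCov_self hn hs hH hAC hZ hpos hV hX, MTCE_eq_tailExp hs hH hZ hM⟩
  · have hH : Differentiable ℝ lapCdf := fun x => (hasDerivAt_lapCdf x).differentiableAt
    have hZ := hasLaw_standardize hSg hH.continuous.measurable hY
    have hpos := measure_exceed_pos_of_pos (lam := lam) hH.continuous.measurable lapCdf_pos hZ
    have hAC : ∀ a b : ℝ, AbsolutelyContinuousOnInterval (deriv lapCdf) a b := fun a b => by
      rw [deriv_lapCdf]
      exact lipschitzWith_lapPdf.lipschitzOnWith.absolutelyContinuousOnInterval
    have hV : ∀ k, HasTailExp (densV lapGen lam k) (drop lam k)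
        fun v => deriv lapCdf (γ ⬝ᵥ put lam k v) := by
      rw [deriv_lapCdf]
      exact hasTailExp_densV_of_bounded continuous_lapPdf.measurable abs_lapPdf_le
    have hX : HasTailExp (sphDensity (cumGen (cumGen lapGen))) lam
        (fun x => deriv (deriv lapCdf) (γ ⬝ᵥ x)) := by
      rw [deriv_lapCdf]
      exact hasTailExp_sphDensity_cumGen_cumGen (measurable_deriv _) abs_deriv_lapPdf_le
    have hM : HasTailExp (sphDensity lapGen) lam
        (fun m => (1 + √(m ⬝ᵥ m)) * deriv lapCdf (γ ⬝ᵥ m)) := by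
      rw [deriv_lapCdf]
      exact hasTailExp_one_add_sqrt continuous_lapPdf.measurable abs_lapPdf_le
    refine ⟨hpos, fun i j hij => ?_, fun i => ?_, fun k => ?_⟩
    · rw [MTCov_of_ne hn isSkewing_lapCdf hH hAC hZ hpos hV hX hij]
      simp only [deriv_lapCdf, deriv_lapPdf, tailExp_neg, mul_neg, ← sub_eq_add_neg]
    · rw [MTCov_self hn isSkewing_lapCdf hH hAC hZ hpos hV hX]
      simp only [deriv_lapCdf, deriv_lapPdf, tailExp_neg, mul_neg, ← sub_eq_add_neg]
    · rw [MTCE_eq_tailExp isSkewing_lapCdf hH hZ hM, deriv_lapCdf]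
  -- The case `H = 1/2`: both derivatives vanish, which removes every `V`, `X**` and `M` term, and
  -- the constant `1/2` cancels the factor 2.
  · have hd : deriv (fun _ : ℝ => (1 / 2 : ℝ)) = fun _ => 0 := funext fun x => deriv_const x _
    have hd' : deriv (fun _ : ℝ => (0 : ℝ)) = fun _ => 0 := funext fun x => deriv_const x _
    have hH : Differentiable ℝ fun _ : ℝ => (1 / 2 : ℝ) := differentiable_const _
    rw [← gsLaplaceLaw_half μ γ Sg] at hY
    have hZ := hasLaw_standardize hSg measurable_const hY
    have hpos := measure_exceed_pos_of_pos (lam := lam) measurable_const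
      (fun _ => by norm_num) hZ
    have hb : ∀ x : ℝ, |(fun _ : ℝ => (0 : ℝ)) x| ≤ 1 := fun _ => by simp
    have hAC : ∀ a b : ℝ, AbsolutelyContinuousOnInterval (deriv fun _ : ℝ => (1 / 2 : ℝ)) a b :=
      fun a b => by
        rw [hd]
        exact (LipschitzWith.const 0).lipschitzOnWith.absolutelyContinuousOnInterval (K := 0)
    have hV : ∀ k, HasTailExp (densV lapGen lam k) (drop lam k)
        fun v => deriv (fun _ : ℝ => (1 / 2 : ℝ)) (γ ⬝ᵥ put lam k v) := by
      rw [hd]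
      exact hasTailExp_densV_of_bounded (γ := γ) measurable_const hb
    have hX : HasTailExp (sphDensity (cumGen (cumGen lapGen))) lam
        (fun x => deriv (deriv fun _ : ℝ => (1 / 2 : ℝ)) (γ ⬝ᵥ x)) := by
      rw [hd, hd']
      exact hasTailExp_sphDensity_cumGen_cumGen (γ := γ) measurable_const hb
    have hM : HasTailExp (sphDensity lapGen) lam
        (fun m => (1 + √(m ⬝ᵥ m)) * deriv (fun _ : ℝ => (1 / 2 : ℝ)) (γ ⬝ᵥ m)) := by
      rw [hd]
      exact hasTailExp_one_add_sqrt (γ := γ) measurable_const hb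
    refine ⟨?_, hpos, fun i j hij => ?_, fun i => ?_, fun k => ?_⟩
    · rwa [gsLaplaceLaw_half, ellDensity_zero_one_eq] at hZ
    · rw [MTCov_of_ne hn isSkewing_half hH hAC hZ hpos hV hX hij]
      simp only [hd, hd', tailExp_const, gseDensity_half, ellDensity_zero_one_eq]
      ring
    · rw [MTCov_self hn isSkewing_half hH hAC hZ hpos hV hX]
      simp only [hd, hd', tailExp_const, gseDensity_half, ellDensity_zero_one_eq]
      ring
    · rw [MTCE_eq_tailExp isSkewing_half hH hZ hM]
      simp only [hd, mul_zero, tailExp_const, gseDensity_half, ellDensity_zero_one_eq]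
      ring
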